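/- **The language LNL-FPC.** Types are $A,B ::= X \mid A+B \mid A\otimes B \mid A\multimap B \mid\ !A \mid \mu X.A$; the *non-linear* types are $P,R ::= X\mid P+R\mid P\otimes R\mid\ !A\mid \mu X.P$. Terms (up to renaming of bound variables) are $$m,n,p ::= x\mid \mathtt{left}_{A,B}\,m\mid \mathtt{right}_{A,B}\,m\mid \mathtt{case}\ m\ \mathtt{of}\ \{\mathtt{left}\,x\to n\mid \mathtt{right}\,y\to p\}\mid\langle m,n\rangle\mid \mathtt{let}\,\langle x,y\rangle=m\ \mathtt{in}\ n\mid\lambda x^A.m\mid mn\mid\mathtt{lift}\,m\mid\mathtt{force}\,m\mid\mathtt{fold}_{\mu X.A}\,m\mid\mathtt{unfold}\,m,$$ and values are $v,w ::= x\mid\mathtt{left}_{A,B}\,v\mid\mathtt{right}_{A,B}\,v\mid\langle v,w\rangle\mid\lambda x^A.m\mid\mathtt{lift}\,m\mid\mathtt{fold}_{\mu X.A}\,v$. Contexts $\Gamma,\Sigma$ are finite lists of distinct variables with closed types, considered up to exchange; $\Phi$ denotes a context whose types are all non-linear. The judgement $\Gamma\vdash m:A$ is derived by the following rules, where $\Gamma$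 and $\Sigma$ have no common variables: - $\Phi,x:A\vdash x:A$; - $\Gamma\vdash m:A$ implies $\Gamma\vdash\mathtt{left}_{A,B}\,m:A+B$, and $\Gamma\vdash m:B$ implies $\Gamma\vdash\mathtt{right}_{A,B}\,m:A+B$; - $\Phi,\Gamma\vdash m:A+B$ and $\Phi,\Sigma,x:A\vdash n:C$ and $\Phi,\Sigma,y:B\vdash p:C$ imply $\Phi,\Gamma,\Sigma\vdash\mathtt{case}\ m\ \mathtt{of}\ \{\mathtt{left}\,x\to n\mid\mathtt{right}\,y\to p\}:C$; - $\Phi,\Gamma\vdash m:A$ and $\Phi,\Sigma\vdash n:B$ imply $\Phi,\Gamma,\Sigma\vdash\langle m,n\rangle:A\otimes B$; - $\Phi,\Gamma\vdash m:A\otimes B$ and $\Phi,\Sigma,x:A,y:B\vdash n:C$ imply $\Phi,\Gamma,\Sigma\vdash\mathtt{let}\,\langle x,y\rangle=m\ \mathtt{in}\ n:C$; - $\Gamma,x:A\vdash m:B$ implies $\Gamma\vdash\lambda x^A.m:A\multimap B$; - $\Phi,\Gamma\vdash m:A\multimap B$ and $\Phi,\Sigma\vdash n:A$ imply $\Phi,\Gamma,\Sigma\vdash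 mn:B$; - $\Phi\vdash m:A$ implies $\Phi\vdash\mathtt{lift}\,m:\ !A$, and $\Gamma\vdash m:\ !A$ implies $\Gamma\vdash\mathtt{force}\,m:A$; - $\Gamma\vdash m:A[\mu X.A/X]$ implies $\Gamma\vdash\mathtt{fold}_{\mu X.A}\,m:\mu X.A$, and $\Gamma\vdash m:\mu X.A$ implies $\Gamma\vdash\mathtt{unfold}\,m:A[\mu X.A/X]$. A *program* of closed type $A$ is a term $p$ with $\cdot\vdash p:A$. The call-by-value evaluation relation $m\Downarrow v$ is the least relation such that: $x\Downarrow x$, $\lambda x^A.m\Downarrow\lambda x^A.m$ and $\mathtt{lift}\,m\Downarrow\mathtt{lift}\,m$; it is compatible with $\mathtt{left}$, $\mathtt{right}$, pairing and $\mathtt{fold}$; if $m\Downarrow\mathtt{left}\,v$ and $n[v/x]\Downarrow w$, or $m\Downarrow\mathtt{right}\,v$ and $p[v/y]\Downarrow w$, then $\mathtt{case}\ m\ \mathtt{of}\ \{\mathtt{left}\,x\to n\mid\mathtt{right}\,y\to p\}\Downarrow w$; if $m\Downarrow\langle v,v'\rangle$ and $n[v/x,v'/y]\Downarrow w$, then $\mathtt{let}\,\langle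 x,y\rangle=m\ \mathtt{in}\ n\Downarrow w$; if $m\Downarrow\lambda x^A.m'$, $n\Downarrow v$ and $m'[v/x]\Downarrow w$, then $mn\Downarrow w$; if $m\Downarrow\mathtt{lift}\,m'$ and $m'\Downarrow v$, then $\mathtt{force}\,m\Downarrow v$; if $m\Downarrow\mathtt{fold}\,v$, then $\mathtt{unfold}\,m\Downarrow v$. The term $m$ *terminates*, written $m\Downarrow$, if $m\Downarrow v$ for some value $v$. **Models.** A cpo is a poset with suprema of increasing sequences; a $\mathbf{CPO}$-category has cpo's as hom-sets and Scott-continuous composition, and a $\mathbf{CPO}$-functor is Scott continuous on hom-cpo's. In a $\mathbf{CPO}$-category, $e:X\to Y$ is an *embedding* if there is a (necessarily unique) *projection counterpart* $e^\bullet:Y\to X$ with $e^\bullet\circ e=\mathrm{id}$ and $e\circ e^\bullet\le\mathrm{id}$. A *$\mathbf{CPO}$-LNL model* consists of a $\mathbf{CPO}$-symmetric monoidal closed category $(\mathbf L,\otimes,\multimap,I)$ with finite $\mathbf{CPO}$-coproducts $(+,0)$, a $\mathbf{CPO}$-cartesian monoidal category $(\mathbf C,\times,1)$ with finite $\mathbf{CPO}$-coproducts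 $(\amalg,\varnothing)$, and a $\mathbf{CPO}$-symmetric monoidal adjunction $F\dashv G:\mathbf L\to\mathbf C$, such that: every morphism $0\to X$ in $\mathbf L$ is an embedding; $\mathbf L$ has all colimits of $\omega$-diagrams of embeddings; $\mathbf C$ has all colimits of $\omega$-diagrams of *pre-embeddings* (morphisms that $F$ sends to embeddings), and $\times:\mathbf C\times\mathbf C\to\mathbf C$ preserves them. Put $!=F\circ G$ and $\perp_{X,Y}=(X\to 0\to Y)$, where $X\to 0$ is the projection counterpart of $0\to X$. The model is *computationally adequate* if $\mathrm{id}_I\ne\perp_{I,I}$ and if, for all $f_1,g_1:I\to A$ and $f_2,g_2:I\to B$ different from $\perp$, $f_1\otimes f_2\le g_1\otimes g_2$ implies $f_1\le g_1$ and $f_2\le g_2$. **Interpretation.** Let $\mathbf L_e$ be the category of embeddings of $\mathbf L$ and $\mathbf C_{pe}$ the category of pre-embeddings of $\mathbf C$; $F$ and $G$ restrict to functors $F_{pe},G_{pe}$ between them. A type with $n$ free variables is interpreted as a functor $[\![A]\!]:\mathbf L_e^n\to\mathbf L_e$: variables are projections, the connectives $+,\otimes,!$ are the restrictions of the corresponding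 functors, $\multimap$ acts by $(e_1,e_2)\mapsto e_1^\bullet\multimap e_2$, and $[\![\mu X.A]\!]=[\![A]\!]^\dagger$ is the parameterised initial algebra, given by colimits of initial sequences. A non-linear type also has an interpretation $(\!|P|\!):\mathbf C_{pe}^n\to\mathbf C_{pe}$, using projections, $\amalg$, $\times$, $(\!|{!A}|\!)=G_{pe}\circ[\![A]\!]\circ F_{pe}^{n}$ and $(\!|\mu X.P|\!)=(\!|P|\!)^\dagger$, and there is a canonical natural isomorphism $\alpha^P:[\![P]\!]\circ F_{pe}^n\cong F_{pe}\circ(\!|P|\!)$, built by induction on $P$ from identities, from $FX\otimes FY\cong F(X\times Y)$ and $FX+FY\cong F(X\amalg Y)$, and from the colimit comparisons. Contexts are interpreted as $\otimes$-products (in $\mathbf L$) and, when non-linear, as products (in $\mathbf C$), with induced isomorphisms $\alpha^\Phi$. Through $\alpha$, the terminal map, the diagonal and the unit $\eta$ of the adjunction induce discarding $[\![\Phi]\!]\to I$, copying $[\![\Phi]\!]\to[\![\Phi]\!]\otimes[\![\Phi]\!]$ and promotion $[\![\Phi]\!]\to\ ![\![\Phi]\!]$. A derivation of $\Gamma\vdash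 m:A$ is interpreted as a morphism $[\![\Gamma]\!]\to[\![A]\!]$ of $\mathbf L$ in the usual way: a variable by discarding the rest of the context; the rules with two parts $\Phi,\Gamma$ and $\Phi,\Sigma$ by first copying $\Phi$; $\mathtt{left},\mathtt{right}$ by the coproduct injections and $\mathtt{case}$ by distributivity and copairing; pairing and $\mathtt{let}$ by $\otimes$; $\lambda$ and application by currying and evaluation; $\mathtt{lift}\,m$ by promotion followed by $![\![m]\!]$; $\mathtt{force}$ by the counit $\epsilon$; $\mathtt{fold}$ and $\mathtt{unfold}$ by the initial-algebra isomorphism $[\![A[\mu X.A/X]]\!]\cong[\![\mu X.A]\!]$. For a program $p$ of type $A$ write $[\![p]\!]:I\to[\![A]\!]$ for the interpretation of any derivation of $\cdot\vdash p:A$. **Theorem.** In every computationally adequate $\mathbf{CPO}$-LNL model: 1. (Termination) for every closed type $A$ and every program $\cdot\vdash p:A$, if $[\![p]\!]\neq\perp$ then $p\Downarrow$; 2. (Adequacy) for every closed non-linear type $P$ and every program $\cdot\vdash p:P$, $p\Downarrow$ if and only if $[\![p]\!]\neq\perp$. -/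

import Mathlib

universe v u

namespace LNLFPC

open CategoryTheory CategoryTheory.Limits OmegaCompletePartialOrder MonoidalCategory

/-! ## Categories enriched over cpo's -/

/-- A `CPO`-category: hom-sets are posets with suprema of increasing sequences and composition is
Scott continuous. -/
class CPOCategory (C : Type u) [Category.{v} C] where
  homCPO : ∀ X Y : C, OmegaCompletePartialOrder (X ⟶ Y)
  comp_continuous : ∀ X Y Z : C,
    ωScottContinuous (fun p : (X ⟶ Y) × (Y ⟶ Z) => p.1 ≫ p.2)

attribute [reducible, instance] CPOCategory.homCPO

/-- A `CPO`-functor is a functor whose action on hom-cpo's is Scott continuous. -/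
class CPOFunctor {C : Type u} {D : Type u} [Category.{v} C] [Category.{v} D] [CPOCategory C]
    [CPOCategory D] (F : C ⥤ D) : Prop where
  map_continuous : ∀ X Y : C, ωScottContinuous (fun f : X ⟶ Y => F.map f)

section Embeddings

variable {C : Type u} [Category.{v} C] [CPOCategory C]

theorem comp_mono {X Y Z : C} {f f' : X ⟶ Y} {g g' : Y ⟶ Z} (hf : f ≤ f') (hg : g ≤ g') :
    f ≫ g ≤ f' ≫ g' :=
  (CPOCategory.comp_continuous X Y Z).monotone (a := (f, g)) (b := (f', g')) ⟨hf, hg⟩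

theorem map_mono {D : Type u} [Category.{v} D] [CPOCategory D] (F : C ⥤ D) [CPOFunctor F]
    {X Y : C} {f g : X ⟶ Y} (h : f ≤ g) : F.map f ≤ F.map g :=
  (CPOFunctor.map_continuous (F := F) X Y).monotone h

/-- `(e, p)` is an embedding-projection pair. -/
structure IsEPPair {X Y : C} (e : X ⟶ Y) (p : Y ⟶ X) : Prop where
  emb_proj : e ≫ p = 𝟙 X
  proj_emb : p ≫ e ≤ 𝟙 Y

/-- The embeddings of a `CPO`-category. -/
def embeddings (C : Type u) [Category.{v} C] [CPOCategory C] : MorphismProperty C :=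
  fun _ _ e => ∃ p, IsEPPair e p

/-- The projection counterpart `e^•` of an embedding `e`. -/
noncomputable def proj {X Y : C} {e : X ⟶ Y} (he : embeddings C e) : Y ⟶ X := he.choose

theorem proj_spec {X Y : C} {e : X ⟶ Y} (he : embeddings C e) : IsEPPair e (proj he) :=
  he.choose_spec

theorem IsEPPair.le {X Y : C} {e : X ⟶ Y} {p q : Y ⟶ X} (h : IsEPPair e p) (h' : IsEPPair e q) :
    p ≤ q := by
  have := comp_mono h.proj_emb (le_refl q)
  rwa [Category.assoc, h'.emb_proj, Category.comp_id, Category.id_comp] at this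

theorem IsEPPair.unique {X Y : C} {e : X ⟶ Y} {p q : Y ⟶ X} (h : IsEPPair e p)
    (h' : IsEPPair e q) : p = q := le_antisymm (h.le h') (h'.le h)

theorem IsEPPair.comp {X Y Z : C} {e : X ⟶ Y} {p : Y ⟶ X} {e' : Y ⟶ Z} {p' : Z ⟶ Y}
    (h : IsEPPair e p) (h' : IsEPPair e' p') : IsEPPair (e ≫ e') (p' ≫ p) := by
  refine ⟨?_, ?_⟩
  · rw [Category.assoc, reassoc_of% h'.emb_proj, h.emb_proj]
  · have := comp_mono (comp_mono (le_refl p') h.proj_emb) (le_refl e')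
    rw [Category.comp_id] at this
    simpa using this.trans h'.proj_emb

theorem IsEPPair.of_iso {X Y : C} (i : X ≅ Y) : IsEPPair i.hom i.inv :=
  ⟨i.hom_inv_id, i.inv_hom_id.le⟩

theorem embedding_of_isIso {X Y : C} (f : X ⟶ Y) [IsIso f] : embeddings C f :=
  ⟨inv f, IsEPPair.of_iso (asIso f)⟩

theorem IsEPPair.map {D : Type u} [Category.{v} D] [CPOCategory D] (F : C ⥤ D) [CPOFunctor F]
    {X Y : C} {e : X ⟶ Y} {p : Y ⟶ X} (h : IsEPPair e p) : IsEPPair (F.map e) (F.map p) := by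
  refine ⟨by rw [← F.map_comp, h.emb_proj, F.map_id], ?_⟩
  have := map_mono F h.proj_emb
  rwa [F.map_id, F.map_comp] at this

instance : (embeddings C).IsMultiplicative where
  id_mem X := ⟨𝟙 X, by simp, by simp⟩
  comp_mem f g hf hg := ⟨_, (proj_spec hf).comp (proj_spec hg)⟩

/-- The subcategory `C_e` of embeddings. -/
abbrev Emb (C : Type u) [Category.{v} C] [CPOCategory C] := WideSubcategory (embeddings C)

/-- The pre-embeddings with respect to `F`: the morphisms that `F` sends to embeddings. -/
abbrev preEmbeddings {D : Type u} [Category.{v} D] [CPOCategory D] {C : Type u} [Category.{v} C]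
    (F : C ⥤ D) : MorphismProperty C := (embeddings D).inverseImage F

/-- The subcategory `C_pe` of pre-embeddings with respect to `F`. -/
abbrev PreEmb {D : Type u} [Category.{v} D] [CPOCategory D] {C : Type u} [Category.{v} C]
    (F : C ⥤ D) := WideSubcategory (preEmbeddings F)

/-- `D` is an `ω`-diagram all of whose morphisms have the property `W`. -/
def IsChainOver {C : Type u} [Category.{v} C] (W : MorphismProperty C) (D : ℕ ⥤ C) : Prop :=
  ∀ ⦃i j : ℕ⦄ (f : i ⟶ j), W (D.map f)

theorem comp_ωSup_eq {X Y Z : C} (f : X ⟶ Y) (c : Chain (Y ⟶ Z)) {g : X ⟶ Z} (k : ℕ)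
    (h : ∀ j, k ≤ j → f ≫ c j = g) : f ≫ ωSup c = g := by
  have hf : ωScottContinuous (fun q : Y ⟶ Z => f ≫ q) :=
    (CPOCategory.comp_continuous X Y Z).comp
      (Prod.ωScottContinuous.prodMk (ωScottContinuous.const (x := f)) ωScottContinuous.id)
  refine (hf.map_ωSup c).trans (le_antisymm (ωSup_le _ _ fun i => ?_) ?_)
  · have h1 : f ≫ c i ≤ f ≫ c (max i k) := comp_mono le_rfl (c.monotone (le_max_left i k))
    exact h1.trans (h _ (le_max_right i k)).le
  · exact (h k le_rfl).symm.le.trans (le_ωSup (c.map ⟨_, hf.monotone⟩) k)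

theorem ωSup_comp_le {X Y Z : C} (c : Chain (X ⟶ Y)) (f : Y ⟶ Z) {g : X ⟶ Z}
    (h : ∀ j, c j ≫ f ≤ g) : ωSup c ≫ f ≤ g := by
  have hf : ωScottContinuous (fun q : X ⟶ Y => q ≫ f) :=
    (CPOCategory.comp_continuous X Y Z).comp
      (Prod.ωScottContinuous.prodMk ωScottContinuous.id (ωScottContinuous.const (x := f)))
  exact (hf.map_ωSup c).le.trans (ωSup_le _ _ fun i => h i)

section LimitColimit

variable {D : ℕ ⥤ C} (hD : IsChainOver (embeddings C) D) {c : Cocone D} (hc : IsColimit c)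

/-- The canonical morphism `D k ⟶ D j` going up and then back down a chain of embeddings. -/
noncomputable def chainBack (k j : ℕ) : D.obj k ⟶ D.obj j :=
  D.map (homOfLE (Nat.le_add_right k j)) ≫ proj (hD (homOfLE (Nat.le_add_left j k)))

theorem proj_chain {i j k : ℕ} (hij : i ≤ j) (hjk : j ≤ k) :
    proj (hD (homOfLE (hij.trans hjk))) = proj (hD (homOfLE hjk)) ≫ proj (hD (homOfLE hij)) := by
  have h := (proj_spec (hD (homOfLE hij))).comp (proj_spec (hD (homOfLE hjk)))
  rw [← D.map_comp] at h
  exact (proj_spec (hD (homOfLE (hij.trans hjk)))).unique h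

theorem chainBack_aux {k j n m : ℕ} (hk : k ≤ n) (hj : j ≤ n) (hn : n ≤ m) :
    D.map (homOfLE (hk.trans hn)) ≫ proj (hD (homOfLE (hj.trans hn))) =
      D.map (homOfLE hk) ≫ proj (hD (homOfLE hj)) := by
  rw [proj_chain hD hj hn, ← homOfLE_comp hk hn, D.map_comp, Category.assoc,
    reassoc_of% (proj_spec (hD (homOfLE hn))).emb_proj]

theorem chainBack_eq {k j n : ℕ} (hk : k ≤ n) (hj : j ≤ n) :
    chainBack hD k j = D.map (homOfLE hk) ≫ proj (hD (homOfLE hj)) :=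
  (chainBack_aux hD (Nat.le_add_right k j) (Nat.le_add_left j k) (Nat.le_add_left (k + j) n)).symm.trans
    (chainBack_aux hD hk hj (Nat.le_add_right n (k + j)))

theorem map_chainBack {k k' : ℕ} (h : k ≤ k') (j : ℕ) :
    D.map (homOfLE h) ≫ chainBack hD k' j = chainBack hD k j := by
  have h1 : k' ≤ k' + j := Nat.le_add_right _ _
  rw [chainBack_eq hD h1 (Nat.le_add_left j k'), chainBack_eq hD (h.trans h1) (Nat.le_add_left j k'),
    ← homOfLE_comp h h1, D.map_comp, Category.assoc]

theorem chainBack_proj (k : ℕ) {j j' : ℕ} (h : j ≤ j') :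
    chainBack hD k j' ≫ proj (hD (homOfLE h)) = chainBack hD k j := by
  have h1 : k ≤ k + j' := Nat.le_add_right _ _
  have h2 : j' ≤ k + j' := Nat.le_add_left _ _
  rw [chainBack_eq hD h1 h2, chainBack_eq hD h1 (h.trans h2), proj_chain hD h h2, Category.assoc]

/-- The projection from the colimit of a chain of embeddings to one of its members. -/
noncomputable def colimProj (j : ℕ) : c.pt ⟶ D.obj j :=
  hc.desc ⟨D.obj j, ⟨fun k => chainBack hD k j, fun k k' f => by
    rw [Subsingleton.elim f (homOfLE (leOfHom f))]
    exact (map_chainBack hD (leOfHom f) j).trans (Category.comp_id _).symm⟩⟩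

theorem ι_colimProj (k j : ℕ) : c.ι.app k ≫ colimProj hD hc j = chainBack hD k j := hc.fac _ _

theorem ι_colimProj_self (j : ℕ) : c.ι.app j ≫ colimProj hD hc j = 𝟙 _ := by
  rw [ι_colimProj, chainBack_eq hD (le_refl j) (le_refl j), (proj_spec _).emb_proj]

theorem colimProj_proj {j j' : ℕ} (h : j ≤ j') :
    colimProj hD hc j' ≫ proj (hD (homOfLE h)) = colimProj hD hc j :=
  hc.hom_ext fun k => by
    rw [← Category.assoc, ι_colimProj, ι_colimProj, chainBack_proj]

theorem ι_of_le {C : Type u} [Category.{v} C] {D : ℕ ⥤ C} {k j : ℕ} (h : k ≤ j) (s : Cocone D) :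
    D.map (homOfLE h) ≫ s.ι.app j = s.ι.app k := s.w _

theorem proj_ι_mono {Y : C} {p : ∀ j, Y ⟶ D.obj j} (s : Cocone D)
    (hp : ∀ {j j' : ℕ} (h : j ≤ j'), p j' ≫ proj (hD (homOfLE h)) = p j) :
    Monotone fun j => p j ≫ s.ι.app j := by
  intro j j' h
  have h1 := comp_mono (comp_mono (le_refl (p j')) (proj_spec (hD (homOfLE h))).proj_emb)
    (le_refl (s.ι.app j'))
  rw [Category.comp_id] at h1
  refine le_trans (le_of_eq ?_) h1
  simp only [Category.assoc]
  rw [ι_of_le h s, ← hp h, Category.assoc]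

/-- The idempotents on the colimit of a chain of embeddings. -/
noncomputable def colimChain : Chain (c.pt ⟶ c.pt) :=
  ⟨fun j => colimProj hD hc j ≫ c.ι.app j, proj_ι_mono hD c (colimProj_proj hD hc)⟩

theorem ωSup_colimChain : ωSup (colimChain hD hc) = 𝟙 c.pt :=
  hc.hom_ext fun k => by
    rw [Category.comp_id]
    refine comp_ωSup_eq _ _ k fun j hj => ?_
    change c.ι.app k ≫ colimProj hD hc j ≫ c.ι.app j = _
    rw [← Category.assoc, ι_colimProj, chainBack_eq hD hj le_rfl, Category.assoc,
      ← ι_of_le hj c]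
    congr 1
    have h := (proj_spec (hD (homOfLE (le_refl j)))).emb_proj
    have h1 : D.map (homOfLE (le_refl j)) = 𝟙 _ := D.map_id j
    have h2 : proj (hD (homOfLE (le_refl j))) = 𝟙 _ :=
      (Category.id_comp _).symm.trans
        ((congrArg (· ≫ proj (hD (homOfLE (le_refl j)))) h1.symm).trans h)
    rw [h2, Category.id_comp]

theorem isEPPair_ι (j : ℕ) : IsEPPair (c.ι.app j) (colimProj hD hc j) :=
  ⟨ι_colimProj_self hD hc j,
    (le_ωSup (colimChain hD hc) j).trans (ωSup_colimChain hD hc).le⟩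

theorem embedding_desc {D : ℕ ⥤ C} (hD : IsChainOver (embeddings C) D) {c : Cocone D}
    (hc : IsColimit c) (s : Cocone D) (hs : ∀ j, embeddings C (s.ι.app j)) :
    embeddings C (hc.desc s) := by
  have hp : ∀ {j j' : ℕ} (h : j ≤ j'), proj (hs j') ≫ proj (hD (homOfLE h)) = proj (hs j) := by
    intro j j' h
    have h1 := (proj_spec (hD (homOfLE h))).comp (proj_spec (hs j'))
    rw [ι_of_le h s] at h1
    exact h1.unique (proj_spec (hs j))
  let q : Chain (s.pt ⟶ c.pt) := ⟨fun j => proj (hs j) ≫ c.ι.app j, proj_ι_mono hD c hp⟩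
  refine ⟨ωSup q, hc.hom_ext fun k => ?_, ωSup_comp_le _ _ fun j => ?_⟩
  · rw [← Category.assoc, hc.fac, Category.comp_id]
    refine comp_ωSup_eq _ _ k fun j hj => ?_
    change s.ι.app k ≫ proj (hs j) ≫ c.ι.app j = _
    rw [← ι_of_le hj s, Category.assoc, reassoc_of% (proj_spec (hs j)).emb_proj, ι_of_le hj c]
  · change (proj (hs j) ≫ c.ι.app j) ≫ _ ≤ _
    rw [Category.assoc, hc.fac]
    exact (proj_spec (hs j)).proj_emb

end LimitColimit

theorem hasColimit_wide {C : Type u} [Category.{v} C] {W : MorphismProperty C}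
    [W.IsMultiplicative] (D : ℕ ⥤ WideSubcategory W)
    {c : Cocone (D ⋙ wideSubcategoryInclusion W)} (hc : IsColimit c)
    (hι : ∀ j, W (c.ι.app j))
    (hdesc : ∀ s : Cocone (D ⋙ wideSubcategoryInclusion W), (∀ j, W (s.ι.app j)) →
      W (hc.desc s)) : HasColimit D := by
  let I := wideSubcategoryInclusion W
  refine ⟨⟨⟨⟨⟨c.pt⟩, ⟨fun j => ⟨c.ι.app j, hι j⟩, fun i j f => ?_⟩⟩, ?_⟩⟩⟩
  · apply WideSubcategory.hom_ext
    exact c.ι.naturality f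
  · exact
      { desc := fun s => ⟨hc.desc (I.mapCocone s), hdesc _ fun j => (s.ι.app j).property⟩
        fac := fun s j => WideSubcategory.hom_ext _ (hc.fac (I.mapCocone s) j)
        uniq := fun s m hm => WideSubcategory.hom_ext _
          (hc.uniq (I.mapCocone s) m.hom fun j => congrArg InducedWideCategory.Hom.hom (hm j)) }

end Embeddings
/-! ## Initial sequences and (parameterised) initial algebras -/

section InitialAlgebras

variable {K : Type u} [Category.{v} K] [HasInitial K]

/-- The objects `T^n ∅` of the initial sequence of `T`. -/
noncomputable def seqObj (T : K ⥤ K) : ℕ → K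
  | 0 => ⊥_ K
  | n + 1 => T.obj (seqObj T n)

/-- The morphisms `T^n ι : T^n ∅ ⟶ T^(n+1) ∅`. -/
noncomputable def seqMap (T : K ⥤ K) : ∀ n, seqObj T n ⟶ seqObj T (n + 1)
  | 0 => initial.to _
  | n + 1 => T.map (seqMap T n)

/-- The initial sequence `∅ ⟶ T ∅ ⟶ T² ∅ ⟶ ⋯`. -/
noncomputable abbrev seq (T : K ⥤ K) : ℕ ⥤ K := Functor.ofSequence (seqMap T)

/-- The component at `∅` of the `n`-fold horizontal composition of `τ`. -/
noncomputable def seqTransApp {T H : K ⥤ K} (τ : T ⟶ H) : ∀ n, seqObj T n ⟶ seqObj H n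
  | 0 => 𝟙 _
  | n + 1 => T.map (seqTransApp τ n) ≫ τ.app (seqObj H n)

theorem nat_square {K : Type u} [Category.{v} K] {T H : K ⥤ K} (τ : T ⟶ H) {X X' Z Z' : K} {f : X ⟶ X'} {g' : X' ⟶ Z'}
    {g : X ⟶ Z} {f' : Z ⟶ Z'} (h : f ≫ g' = g ≫ f') :
    T.map f ≫ T.map g' ≫ τ.app Z' = (T.map g ≫ τ.app Z) ≫ H.map f' := by
  rw [Category.assoc, ← τ.naturality, ← Category.assoc, ← Category.assoc, ← T.map_comp,
    ← T.map_comp, h]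

theorem seqTrans_naturality {T H : K ⥤ K} (τ : T ⟶ H) :
    ∀ n, seqMap T n ≫ seqTransApp τ (n + 1) = seqTransApp τ n ≫ seqMap H n
  | 0 => initialIsInitial.hom_ext _ _
  | n + 1 => nat_square τ (seqTrans_naturality τ n)

theorem seqTransApp_id (T : K ⥤ K) : ∀ n, seqTransApp (𝟙 T) n = 𝟙 (seqObj T n)
  | 0 => rfl
  | n + 1 => by
    rw [seqTransApp, seqTransApp_id T n, T.map_id, NatTrans.id_app]
    exact Category.id_comp _

theorem seqTransApp_comp {T H J : K ⥤ K} (τ : T ⟶ H) (σ : H ⟶ J) :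
    ∀ n, seqTransApp (τ ≫ σ) n = seqTransApp τ n ≫ seqTransApp σ n
  | 0 => (Category.id_comp _).symm
  | n + 1 => by
    rw [seqTransApp, seqTransApp_comp τ σ n]
    have h : ∀ {X Z Z' : K} (a : X ⟶ Z) (b : Z ⟶ Z'),
        T.map (a ≫ b) ≫ (τ ≫ σ).app Z' = (T.map a ≫ τ.app Z) ≫ H.map b ≫ σ.app Z' := by simp
    exact h _ _

/-- The functor `S` sending an endofunctor to its initial sequence. -/
noncomputable def S (K : Type u) [Category.{v} K] [HasInitial K] : (K ⥤ K) ⥤ (ℕ ⥤ K) where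
  obj T := seq T
  map {T H} τ := NatTrans.ofSequence (seqTransApp τ) fun n => by
    rw [Functor.ofSequence_map_homOfLE_succ, Functor.ofSequence_map_homOfLE_succ]
    exact seqTrans_naturality τ n
  map_id T := NatTrans.ext (funext fun n => seqTransApp_id T n)
  map_comp τ σ := NatTrans.ext (funext fun n => seqTransApp_comp τ σ n)

variable {A : Type u} [Category.{v} A] {A' K' : Type u} [Category.{v} A'] [Category.{v} K']
  [HasInitial K'] {T : A' × K' ⥤ K'} {H : A × K ⥤ K} {N : A ⥤ A'} {M : K ⥤ K'}

/-- The sequence of morphisms `α*_a`. -/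
noncomputable def starApp (α : N.prod M ⋙ T ⟶ H ⋙ M) (a : A) : ∀ n,
    seqObj ((Functor.curry.obj T).obj (N.obj a)) n ⟶ M.obj (seqObj ((Functor.curry.obj H).obj a) n)
  | 0 => initial.to _
  | n + 1 => ((Functor.curry.obj T).obj (N.obj a)).map (starApp α a n) ≫ α.app (a, _)

theorem starApp_naturality (α : N.prod M ⋙ T ⟶ H ⋙ M) (a : A) :
    ∀ n, seqMap ((Functor.curry.obj T).obj (N.obj a)) n ≫ starApp α a (n + 1) =
      starApp α a n ≫ M.map (seqMap ((Functor.curry.obj H).obj a) n)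
  | 0 => initialIsInitial.hom_ext _ _
  | n + 1 => by
    have h : ∀ {X X' : K'} {Z Z' : K} {f : X ⟶ X'} {g' : X' ⟶ M.obj Z'} {g : X ⟶ M.obj Z}
        {f' : Z ⟶ Z'}, f ≫ g' = g ≫ M.map f' →
        ((Functor.curry.obj T).obj (N.obj a)).map f ≫
            ((Functor.curry.obj T).obj (N.obj a)).map g' ≫ α.app (a, Z') =
          (((Functor.curry.obj T).obj (N.obj a)).map g ≫ α.app (a, Z)) ≫
            M.map (((Functor.curry.obj H).obj a).map f') := by
      intro X X' Z Z' f g' g f' h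
      have h1 := α.naturality ((𝟙 a, f') : ((a, Z) : A × K) ⟶ (a, Z'))
      have h2 := congrArg ((Functor.curry.obj T).obj (N.obj a)).map h
      simp only [Functor.map_comp] at h2
      rw [← Category.assoc, h2, Category.assoc, Category.assoc]
      congr 1
      simpa using h1
    exact h (starApp_naturality α a n)

/-- The natural transformation `α*_a`. -/
noncomputable def star (α : N.prod M ⋙ T ⟶ H ⋙ M) (a : A) :
    seq ((Functor.curry.obj T).obj (N.obj a)) ⟶ seq ((Functor.curry.obj H).obj a) ⋙ M :=
  NatTrans.ofSequence (starApp α a) fun n => by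
    rw [Functor.comp_map, Functor.ofSequence_map_homOfLE_succ,
      Functor.ofSequence_map_homOfLE_succ]
    exact starApp_naturality α a n

theorem starApp_natural_param (α : N.prod M ⋙ T ⟶ H ⋙ M) {a b : A} (f : a ⟶ b) :
    ∀ n, seqTransApp ((Functor.curry.obj T).map (N.map f)) n ≫ starApp α b n =
      starApp α a n ≫ M.map (seqTransApp ((Functor.curry.obj H).map f) n)
  | 0 => initialIsInitial.hom_ext _ _
  | n + 1 => by
    have h : ∀ {X X' : K'} {Z Z' : K} {s : X ⟶ X'} {t : X' ⟶ M.obj Z'} {t' : X ⟶ M.obj Z}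
        {r : Z ⟶ Z'}, s ≫ t = t' ≫ M.map r →
        (((Functor.curry.obj T).obj (N.obj a)).map s ≫
            ((Functor.curry.obj T).map (N.map f)).app X') ≫
            ((Functor.curry.obj T).obj (N.obj b)).map t ≫ α.app (b, Z') =
          (((Functor.curry.obj T).obj (N.obj a)).map t' ≫ α.app (a, Z)) ≫
            M.map (((Functor.curry.obj H).obj a).map r ≫
              ((Functor.curry.obj H).map f).app Z') := by
      intro X X' Z Z' s t t' r h
      have h1 := α.naturality ((f, r) : ((a, Z) : A × K) ⟶ (b, Z'))
      have e1 : T.map ((N.map f, M.map r) : (N.obj a, M.obj Z) ⟶ (N.obj b, M.obj Z')) ≫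
          α.app (b, Z') = α.app (a, Z) ≫ M.map (H.map (f, r)) := h1
      have e2 : (((Functor.curry.obj T).obj (N.obj a)).map s ≫
            ((Functor.curry.obj T).map (N.map f)).app X') ≫
            ((Functor.curry.obj T).obj (N.obj b)).map t = T.map (N.map f, s ≫ t) := by
        simp [← T.map_comp]
      have e3 : ((Functor.curry.obj T).obj (N.obj a)).map t' ≫
          T.map ((N.map f, M.map r) : (N.obj a, M.obj Z) ⟶ (N.obj b, M.obj Z')) =
            T.map (N.map f, t' ≫ M.map r) := by
        simp [← T.map_comp]
      have e4 : ((Functor.curry.obj H).obj a).map r ≫ ((Functor.curry.obj H).map f).app Z' =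
          H.map (f, r) := by
        simp [← H.map_comp]
      rw [← Category.assoc, e2, h, ← e3, e4, Category.assoc, Category.assoc, e1]
    exact h (starApp_natural_param α f n)

variable [HasColimitsOfShape ℕ K]

/-- The functor sending an endofunctor `T` to the colimit `Y(T)` of its initial sequence, which
is the carrier of the initial `T`-algebra when `T` preserves colimits of `ω`-diagrams. -/
noncomputable def Y (K : Type u) [Category.{v} K] [HasInitial K] [HasColimitsOfShape ℕ K] :
    (K ⥤ K) ⥤ K := S K ⋙ colim

/-- The natural transformation `s^T : S(T) ⟶ T ∘ S(T)` with components `T^n ι`. -/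
noncomputable def seqShift (T : K ⥤ K) : seq T ⟶ seq T ⋙ T :=
  NatTrans.ofSequence (seqMap T) fun n => by
    simp only [Functor.ofSequence_map_homOfLE_succ, Functor.comp_map]
    rfl

/-- The comparison `Y(T) = colim S(T) ⟶ colim (T ∘ S(T)) ⟶ T (colim S(T)) = T (Y(T))`. When `T`
preserves colimits of `ω`-diagrams, it is the inverse of the structure map of the initial
`T`-algebra. -/
noncomputable def unroll (T : K ⥤ K) : (Y K).obj T ⟶ T.obj ((Y K).obj T) :=
  colimMap (seqShift T) ≫ colimit.post (seq T) T

/-- The parameterised initial algebra `T† = Y ∘ (λ B, T(-, B))`. -/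
noncomputable def dagger (T : A × K ⥤ K) : A ⥤ K := Functor.curry.obj T ⋙ Y K

/-- `(T ∘ (H × Id))† = T† ∘ H`. -/
theorem dagger_comp {B : Type u} [Category.{v} B] (H : B ⥤ A) (T : A × K ⥤ K) :
    dagger (H.prod (𝟭 K) ⋙ T) = H ⋙ dagger T := by
  have : Functor.curry.obj (H.prod (𝟭 K) ⋙ T) = H ⋙ Functor.curry.obj T := by
    refine CategoryTheory.Functor.ext (fun b => CategoryTheory.Functor.ext (fun _ => rfl) ?_) ?_
    · intro X Y f
      simp
    · intro X Y f
      ext k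
      simp [eqToHom_app]
  unfold dagger
  rw [this]
  rfl

variable [HasColimitsOfShape ℕ K']

/-- The natural transformation `α† : T† ∘ N ⟶ M ∘ H†` induced by `α : T ∘ (N × M) ⟶ M ∘ H`, with
components `colim (T* N a) ⟶ colim (M H* a) ⟶ M (colim (H* a))`. -/
noncomputable def daggerTrans (α : N.prod M ⋙ T ⟶ H ⋙ M) : N ⋙ dagger T ⟶ dagger H ⋙ M where
  app a := colimMap (star α a) ≫ colimit.post (seq ((Functor.curry.obj H).obj a)) M
  naturality a b f := by
    refine colimit.hom_ext fun n => ?_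
    have h := starApp_natural_param α f n
    have l1 : colimit.ι (seq ((Functor.curry.obj T).obj (N.obj a))) n ≫
        (N ⋙ dagger T).map f = seqTransApp ((Functor.curry.obj T).map (N.map f)) n ≫
          colimit.ι (seq ((Functor.curry.obj T).obj (N.obj b))) n :=
      ι_colimMap _ _
    have l2 : colimit.ι (seq ((Functor.curry.obj H).obj a)) n ≫ (dagger H).map f =
        seqTransApp ((Functor.curry.obj H).map f) n ≫
          colimit.ι (seq ((Functor.curry.obj H).obj b)) n :=
      ι_colimMap _ _
    have l3 : ∀ c : A, colimit.ι (seq ((Functor.curry.obj T).obj (N.obj c))) n ≫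
        colimMap (star α c) ≫ colimit.post (seq ((Functor.curry.obj H).obj c)) M =
          starApp α c n ≫ M.map (colimit.ι (seq ((Functor.curry.obj H).obj c)) n) := by
      intro c
      rw [ι_colimMap_assoc, colimit.ι_post]
      rfl
    have l4 : M.map (colimit.ι (seq ((Functor.curry.obj H).obj a)) n) ≫ M.map ((dagger H).map f) =
        M.map (seqTransApp ((Functor.curry.obj H).map f) n) ≫
          M.map (colimit.ι (seq ((Functor.curry.obj H).obj b)) n) :=
      (M.map_comp _ _).symm.trans ((congrArg M.map l2).trans (M.map_comp _ _))
    have glue : ∀ {x₁ x₂ x₃ x₄ y₁ y₂ y₃ : K'} {p : x₁ ⟶ x₂} {q : x₂ ⟶ x₃} {r : x₃ ⟶ x₄}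
        {p' : x₁ ⟶ y₁} {t : y₁ ⟶ x₃} {u : y₁ ⟶ y₂} {w : y₂ ⟶ x₄} {q' : x₂ ⟶ y₃} {r' : y₃ ⟶ x₄}
        {d : x₁ ⟶ y₃}, p ≫ q = p' ≫ t → t ≫ r = u ≫ w → p ≫ q' = d →
        p' ≫ u ≫ w = d ≫ r' → p ≫ q ≫ r = p ≫ q' ≫ r' := by
      intro x₁ x₂ x₃ x₄ y₁ y₂ y₃ p q r p' t u w q' r' d h1 h2 h3 h4
      rw [reassoc_of% h1, h2, h4, reassoc_of% h3]
    refine glue l1 (l3 b) (l3 a) ?_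
    exact (Category.assoc _ _ _).symm.trans
      ((congrArg (· ≫ M.map (colimit.ι (seq ((Functor.curry.obj H).obj b)) n)) h).trans
        ((Category.assoc _ _ _).trans
          ((Category.assoc _ _ _).trans (congrArg (starApp α a n ≫ ·) l4)).symm))

end InitialAlgebras

/-! ## `CPO`-LNL models -/

set_option linter.checkUnivs false in
/-- A `CPO`-LNL model. -/
structure CPOLNLModel where
  /-- the linear category -/
  L : Type u
  /-- the cartesian category -/
  C : Type u
  [catL : Category.{v} L]
  [catC : Category.{v} C]
  [cpoL : CPOCategory L]
  [cpoC : CPOCategory C]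
  [monoidalL : MonoidalCategory L]
  [symmetricL : SymmetricCategory L]
  [closedL : MonoidalClosed L]
  [coproductsL : HasFiniteCoproducts L]
  [cartesianC : CartesianMonoidalCategory C]
  [braidedC : BraidedCategory C]
  [coproductsC : HasFiniteCoproducts C]
  /-- the left adjoint -/
  F : C ⥤ L
  /-- the right adjoint -/
  G : L ⥤ C
  /-- the adjunction -/
  adj : F ⊣ G
  [braidedF : F.Braided]
  [braidedG : G.LaxBraided]
  [monoidalAdj : adj.IsMonoidal]
  [cpoF : CPOFunctor F]
  [cpoG : CPOFunctor G]
  /-- `⊗` is a `CPO`-functor. -/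
  tensor_continuous : ∀ X X' Y Y' : L,
    ωScottContinuous (fun p : (X ⟶ X') × (Y ⟶ Y') => p.1 ⊗ₘ p.2)
  /-- `⊸` is a `CPO`-functor. -/
  ihom_continuous : ∀ X X' Y Y' : L,
    ωScottContinuous (fun p : (X' ⟶ X) × (Y ⟶ Y') =>
      (MonoidalClosed.pre p.1).app Y ≫ (ihom X').map p.2)
  /-- The coproducts of `L` are `CPO`-coproducts. -/
  desc_continuous_L : ∀ X Y Z : L,
    ωScottContinuous (fun p : (X ⟶ Z) × (Y ⟶ Z) => coprod.desc p.1 p.2)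
  /-- The products of `C` are `CPO`-products. -/
  lift_continuous : ∀ X Y Z : C,
    ωScottContinuous (fun p : (X ⟶ Y) × (X ⟶ Z) => CartesianMonoidalCategory.lift p.1 p.2)
  /-- The coproducts of `C` are `CPO`-coproducts. -/
  desc_continuous_C : ∀ X Y Z : C,
    ωScottContinuous (fun p : (X ⟶ Z) × (Y ⟶ Z) => coprod.desc p.1 p.2)
  /-- The initial object of `L` is e-initial. -/
  eInitial : ∀ X : L, embeddings L (initial.to X)
  /-- `L` has all `ω`-colimits over embeddings. -/
  hasColimit_L : ∀ D : ℕ ⥤ L, IsChainOver (embeddings L) D → HasColimit D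
  /-- `C` has all `ω`-colimits over pre-embeddings. -/
  hasColimit_C : ∀ D : ℕ ⥤ C, IsChainOver (preEmbeddings F) D → HasColimit D
  /-- The product functor preserves `ω`-colimits over pre-embeddings. -/
  prod_preserves : ∀ D : ℕ ⥤ C × C, IsChainOver (preEmbeddings F) (D ⋙ CategoryTheory.Prod.fst C C) →
    IsChainOver (preEmbeddings F) (D ⋙ CategoryTheory.Prod.snd C C) →
    PreservesColimit D (MonoidalCategory.tensor C)

namespace CPOLNLModel

attribute [instance] catL catC cpoL cpoC monoidalL symmetricL closedL cartesianC braidedC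
  braidedF braidedG coproductsL coproductsC monoidalAdj cpoF cpoG

variable (M : CPOLNLModel.{v, u})

/-- The comonad endofunctor `! = F ∘ G`. -/
abbrev bangFunctor : M.L ⥤ M.L := M.G ⋙ M.F

/-- The morphism `⊥_{X,Y} = (X ⟶ 0 ⟶ Y)`, where the first morphism is the projection counterpart of
the unique embedding `0 ⟶ X`. -/
noncomputable def bot (X Y : M.L) : X ⟶ Y := proj (M.eInitial X) ≫ initial.to Y

/-- Computationally adequate `CPO`-LNL models. -/
structure ComputationallyAdequate : Prop where
  id_ne_bot : 𝟙 (𝟙_ M.L) ≠ M.bot (𝟙_ M.L) (𝟙_ M.L)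
  tensor_reflects : ∀ {A B : M.L} (f₁ g₁ : 𝟙_ M.L ⟶ A) (f₂ g₂ : 𝟙_ M.L ⟶ B),
    f₁ ≠ M.bot _ _ → g₁ ≠ M.bot _ _ → f₂ ≠ M.bot _ _ → g₂ ≠ M.bot _ _ →
    f₁ ⊗ₘ f₂ ≤ g₁ ⊗ₘ g₂ → f₁ ≤ g₁ ∧ f₂ ≤ g₂

/-! ### The `ω`-categories `L_e` and `C_pe` -/

/-- The category `L_e` of embeddings of `L`. -/
abbrev Le := Emb M.L

/-- The category `C_pe` of pre-embeddings of `C` with respect to `F`. -/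
abbrev Cpe := PreEmb M.F

instance : HasColimitsOfShape ℕ M.Le where
  has_colimit D := by
    have hD : IsChainOver (embeddings M.L) (D ⋙ wideSubcategoryInclusion _) :=
      fun _ _ f => (D.map f).property
    have := M.hasColimit_L _ hD
    exact hasColimit_wide D (colimit.isColimit (D ⋙ wideSubcategoryInclusion _))
      (fun j => ⟨_, isEPPair_ι hD (colimit.isColimit _) j⟩)
      (fun s hs => embedding_desc hD (colimit.isColimit _) s hs)

instance : HasColimitsOfShape ℕ M.Cpe where
  has_colimit D := by
    have hD : IsChainOver (preEmbeddings M.F) (D ⋙ wideSubcategoryInclusion _) :=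
      fun _ _ f => (D.map f).property
    have := M.hasColimit_C _ hD
    have hF : IsChainOver (embeddings M.L) ((D ⋙ wideSubcategoryInclusion _) ⋙ M.F) :=
      fun _ _ f => hD f
    have := M.adj.leftAdjoint_preservesColimits
    let hc := colimit.isColimit (D ⋙ wideSubcategoryInclusion (preEmbeddings M.F))
    have hFc : IsColimit (M.F.mapCocone (colimit.cocone _)) := isColimitOfPreserves M.F hc
    refine hasColimit_wide D hc (fun j => ⟨_, isEPPair_ι hF hFc j⟩) (fun s hs => ?_)
    have h := embedding_desc hF hFc (M.F.mapCocone s) hs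
    rwa [show hFc.desc (M.F.mapCocone s) = M.F.map (hc.desc s) from
      hFc.hom_ext fun j => by
        rw [hFc.fac]
        exact (congrArg M.F.map (hc.fac s j)).symm.trans (M.F.map_comp _ _)] at h

theorem preEmbedding_initial (X : M.C) : preEmbeddings M.F (initial.to X) := by
  have := M.adj.leftAdjoint_preservesColimits
  have hF : IsInitial (M.F.obj (⊥_ M.C)) := IsInitial.isInitialObj M.F _ initialIsInitial
  have h : M.F.map (initial.to X) =
      (hF.uniqueUpToIso initialIsInitial).hom ≫ initial.to (M.F.obj X) := hF.hom_ext _ _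
  change embeddings M.L (M.F.map (initial.to X))
  rw [h]
  exact (embeddings M.L).comp_mem _ _ (embedding_of_isIso _) (M.eInitial _)

instance : HasInitial M.Le :=
  IsInitial.hasInitial (X := (⟨⊥_ M.L⟩ : M.Le)) <|
    IsInitial.ofUniqueHom (fun X => ⟨initial.to X.obj, M.eInitial _⟩)
      fun _ _ => WideSubcategory.hom_ext _ (initialIsInitial.hom_ext _ _)

instance : HasInitial M.Cpe :=
  IsInitial.hasInitial (X := (⟨⊥_ M.C⟩ : M.Cpe)) <|
    IsInitial.ofUniqueHom (fun X => ⟨initial.to X.obj, M.preEmbedding_initial _⟩)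
      fun _ _ => WideSubcategory.hom_ext _ (initialIsInitial.hom_ext _ _)

/-! ### The functors used to interpret types -/

variable {M} in
theorem isEPPair_tensor {X X' Y Y' : M.L} {e : X ⟶ X'} {p : X' ⟶ X} {e' : Y ⟶ Y'} {p' : Y' ⟶ Y}
    (h : IsEPPair e p) (h' : IsEPPair e' p') : IsEPPair (e ⊗ₘ e') (p ⊗ₘ p') := by
  refine ⟨by simp [h.emb_proj, h'.emb_proj], ?_⟩
  have := (M.tensor_continuous X' X' Y' Y').monotone (a := (p ≫ e, p' ≫ e'))
    (b := (𝟙 _, 𝟙 _)) ⟨h.proj_emb, h'.proj_emb⟩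
  simpa using this

variable {M} in
theorem isEPPair_coprod {X X' Y Y' : M.L} {e : X ⟶ X'} {p : X' ⟶ X} {e' : Y ⟶ Y'} {p' : Y' ⟶ Y}
    (h : IsEPPair e p) (h' : IsEPPair e' p') :
    IsEPPair (coprod.map e e') (coprod.map p p') := by
  refine ⟨by simp [h.emb_proj, h'.emb_proj], ?_⟩
  have := (M.desc_continuous_L X' Y' (X' ⨿ Y')).monotone
    (a := ((p ≫ e) ≫ coprod.inl, (p' ≫ e') ≫ coprod.inr))
    (b := (𝟙 _ ≫ coprod.inl, 𝟙 _ ≫ coprod.inr))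
    ⟨comp_mono h.proj_emb le_rfl, comp_mono h'.proj_emb le_rfl⟩
  have e1 : coprod.map p p' ≫ coprod.map e e' =
      coprod.desc ((p ≫ e) ≫ coprod.inl) ((p' ≫ e') ≫ coprod.inr) :=
    coprod.hom_ext
      (by
        rw [coprod.inl_desc, coprod.inl_map_assoc, coprod.inl_map, Category.assoc])
      (by
        rw [coprod.inr_desc, coprod.inr_map_assoc, coprod.inr_map, Category.assoc])
  have e2 : 𝟙 (X' ⨿ Y') = coprod.desc (𝟙 _ ≫ coprod.inl) (𝟙 _ ≫ coprod.inr) := by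
    apply coprod.hom_ext <;> simp
  rw [e1, e2]
  exact this

/-- The action `f ⊸ g` of the internal hom on morphisms. -/
def lolliMap {X X' Y Y' : M.L} (f : X' ⟶ X) (g : Y ⟶ Y') :
    (ihom X).obj Y ⟶ (ihom X').obj Y' :=
  (MonoidalClosed.pre f).app Y ≫ (ihom X').map g

theorem lolliMap_id (X Y : M.L) : M.lolliMap (𝟙 X) (𝟙 Y) = 𝟙 _ := by
  simp [lolliMap]

variable {M} in
theorem lolliMap_comp {X X' X'' Y Y' Y'' : M.L} (f : X' ⟶ X) (g : Y ⟶ Y') (f' : X'' ⟶ X')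
    (g' : Y' ⟶ Y'') : M.lolliMap (f' ≫ f) (g ≫ g') = M.lolliMap f g ≫ M.lolliMap f' g' := by
  simp [lolliMap]

variable {M} in
theorem isEPPair_lolli {X X' Y Y' : M.L} {e : X ⟶ X'} {p : X' ⟶ X} {e' : Y ⟶ Y'} {p' : Y' ⟶ Y}
    (h : IsEPPair e p) (h' : IsEPPair e' p') :
    IsEPPair (M.lolliMap p e') (M.lolliMap e p') := by
  refine ⟨by rw [← lolliMap_comp, h.emb_proj, h'.emb_proj, lolliMap_id], ?_⟩
  rw [← lolliMap_comp, ← lolliMap_id]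
  exact (M.ihom_continuous X' X' Y' Y').monotone (a := (p ≫ e, p' ≫ e'))
    (b := (𝟙 _, 𝟙 _)) ⟨h.proj_emb, h'.proj_emb⟩

/-- The functor `⊗_e`. -/
def tensorE : M.Le × M.Le ⥤ M.Le where
  obj X := ⟨X.1.obj ⊗ X.2.obj⟩
  map f := ⟨f.1.hom ⊗ₘ f.2.hom, _, isEPPair_tensor (proj_spec f.1.property) (proj_spec f.2.property)⟩
  map_id X := WideSubcategory.hom_ext _ (by simp)
  map_comp f g := WideSubcategory.hom_ext _ (by simp)

/-- The functor `+_e`. -/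
noncomputable def sumE : M.Le × M.Le ⥤ M.Le where
  obj X := ⟨X.1.obj ⨿ X.2.obj⟩
  map f := ⟨coprod.map f.1.hom f.2.hom, _,
    isEPPair_coprod (proj_spec f.1.property) (proj_spec f.2.property)⟩
  map_id X := WideSubcategory.hom_ext _ (by simp)
  map_comp f g := WideSubcategory.hom_ext _ (by simp)

/-- The functor `⊸_e`, with `(e₁ ⊸_e e₂) = (e₁^• ⊸ e₂)`. -/
noncomputable def lolliE : M.Le × M.Le ⥤ M.Le where
  obj X := ⟨(ihom X.1.obj).obj X.2.obj⟩
  map f := ⟨M.lolliMap (proj f.1.property) f.2.hom, _,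
    isEPPair_lolli (proj_spec f.1.property) (proj_spec f.2.property)⟩
  map_id X := WideSubcategory.hom_ext _ (by
    have h : proj (𝟙 X : X ⟶ X).1.property = 𝟙 X.1.obj :=
      (proj_spec _).unique ⟨Category.id_comp _, (Category.id_comp _).le⟩
    exact (congrArg (fun t => M.lolliMap t (𝟙 X.2.obj)) h).trans (M.lolliMap_id _ _))
  map_comp f g := WideSubcategory.hom_ext _ (by
    have h : proj (f ≫ g).1.property = proj g.1.property ≫ proj f.1.property :=
      (proj_spec _).unique ((proj_spec f.1.property).comp (proj_spec g.1.property))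
    exact (congrArg (fun t => M.lolliMap t (f.2.hom ≫ g.2.hom)) h).trans (lolliMap_comp _ _ _ _))

/-- The restriction `F_pe` of `F`. -/
def Fpe : M.Cpe ⥤ M.Le where
  obj X := ⟨M.F.obj X.obj⟩
  map f := ⟨M.F.map f.hom, f.property⟩
  map_id _ := WideSubcategory.hom_ext _ (M.F.map_id _)
  map_comp _ _ := WideSubcategory.hom_ext _ (M.F.map_comp _ _)

/-- The restriction `G_pe` of `G`. -/
def Gpe : M.Le ⥤ M.Cpe where
  obj X := ⟨M.G.obj X.obj⟩
  map f := ⟨M.G.map f.hom, _, ((proj_spec f.property).map M.G).map M.F⟩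
  map_id _ := WideSubcategory.hom_ext _ (M.G.map_id _)
  map_comp _ _ := WideSubcategory.hom_ext _ (M.G.map_comp _ _)

variable {M} in
theorem preEmbedding_tensor {X X' Y Y' : M.C} {f : X ⟶ X'} {g : Y ⟶ Y'}
    (hf : preEmbeddings M.F f) (hg : preEmbeddings M.F g) : preEmbeddings M.F (f ⊗ₘ g) := by
  change embeddings M.L (M.F.map (f ⊗ₘ g))
  rw [Functor.Monoidal.map_tensor]
  have h : embeddings M.L (M.F.map f ⊗ₘ M.F.map g) := ⟨_, isEPPair_tensor (proj_spec hf) (proj_spec hg)⟩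
  exact (embeddings M.L).comp_mem _ _ (embedding_of_isIso _)
    ((embeddings M.L).comp_mem _ _ h (embedding_of_isIso _))

instance isIso_coprodComparison (X Y : M.C) : IsIso (coprodComparison M.F X Y) := by
  have := M.adj.leftAdjoint_preservesColimits
  infer_instance

variable {M} in
theorem preEmbedding_coprod {X X' Y Y' : M.C} {f : X ⟶ X'} {g : Y ⟶ Y'}
    (hf : preEmbeddings M.F f) (hg : preEmbeddings M.F g) :
    preEmbeddings M.F (coprod.map f g) := by
  change embeddings M.L (M.F.map (coprod.map f g))
  have e : M.F.map (coprod.map f g) = inv (coprodComparison M.F X Y) ≫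
      coprod.map (M.F.map f) (M.F.map g) ≫ coprodComparison M.F X' Y' := by
    rw [IsIso.eq_inv_comp, coprodComparison_natural]
  rw [e]
  have h : embeddings M.L (coprod.map (M.F.map f) (M.F.map g)) :=
    ⟨_, isEPPair_coprod (proj_spec hf) (proj_spec hg)⟩
  exact (embeddings M.L).comp_mem _ _ (embedding_of_isIso _)
    ((embeddings M.L).comp_mem _ _ h (embedding_of_isIso _))

/-- The restriction of the product functor of `C` to pre-embeddings. -/
def prodPe : M.Cpe × M.Cpe ⥤ M.Cpe where
  obj X := ⟨X.1.obj ⊗ X.2.obj⟩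
  map f := ⟨f.1.hom ⊗ₘ f.2.hom, preEmbedding_tensor f.1.property f.2.property⟩
  map_id X := WideSubcategory.hom_ext _ (by simp)
  map_comp f g := WideSubcategory.hom_ext _ (by simp)

/-- The restriction of the coproduct functor of `C` to pre-embeddings. -/
noncomputable def coprodPe : M.Cpe × M.Cpe ⥤ M.Cpe where
  obj X := ⟨X.1.obj ⨿ X.2.obj⟩
  map f := ⟨coprod.map f.1.hom f.2.hom, preEmbedding_coprod f.1.property f.2.property⟩
  map_id X := WideSubcategory.hom_ext _ (by simp)
  map_comp f g := WideSubcategory.hom_ext _ (by simp)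

theorem embedding_μ (X Y : M.C) : embeddings M.L (Functor.LaxMonoidal.μ M.F X Y) :=
  embedding_of_isIso _

theorem embedding_coprodComparison (X Y : M.C) :
    embeddings M.L (coprodComparison M.F X Y) := embedding_of_isIso _

/-- The natural isomorphism `m : FX ⊗ FY ⟶ F(X × Y)`, restricted to (pre-)embeddings. -/
def mPe : M.Fpe.prod M.Fpe ⋙ M.tensorE ⟶ M.prodPe ⋙ M.Fpe where
  app X := ⟨Functor.LaxMonoidal.μ M.F X.1.obj X.2.obj, M.embedding_μ _ _⟩
  naturality _ _ _ := WideSubcategory.hom_ext _ (Functor.LaxMonoidal.μ_natural M.F _ _)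

/-- The natural isomorphism `c : FX + FY ⟶ F(X ⨿ Y)`, restricted to (pre-)embeddings. -/
noncomputable def cPe : M.Fpe.prod M.Fpe ⋙ M.sumE ⟶ M.coprodPe ⋙ M.Fpe where
  app X := ⟨coprodComparison M.F X.1.obj X.2.obj, M.embedding_coprodComparison _ _⟩
  naturality _ _ _ := WideSubcategory.hom_ext _ (coprodComparison_natural M.F _ _).symm

end CPOLNLModel

/-! ## Syntax -/

/-- Types whose type variables are among `n` given ones; the binder `mu` binds variable `0` (and
shifts the others). -/
inductive Ty : ℕ → Type
  | var {n : ℕ} (i : Fin n) : Ty n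
  | sum {n : ℕ} (A B : Ty n) : Ty n
  | tensor {n : ℕ} (A B : Ty n) : Ty n
  | lolli {n : ℕ} (A B : Ty n) : Ty n
  | bang {n : ℕ} (A : Ty n) : Ty n
  | mu {n : ℕ} (A : Ty (n + 1)) : Ty n

namespace Ty

/-- Extend a renaming under a binder. -/
def liftRen {n m : ℕ} (ξ : Fin n → Fin m) : Fin (n + 1) → Fin (m + 1) :=
  Fin.cases 0 fun i => (ξ i).succ

/-- Renaming of type variables. -/
def rename : {n m : ℕ} → (Fin n → Fin m) → Ty n → Ty m
  | _, _, ξ, var i => var (ξ i)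
  | _, _, ξ, sum A B => sum (A.rename ξ) (B.rename ξ)
  | _, _, ξ, tensor A B => tensor (A.rename ξ) (B.rename ξ)
  | _, _, ξ, lolli A B => lolli (A.rename ξ) (B.rename ξ)
  | _, _, ξ, bang A => bang (A.rename ξ)
  | _, _, ξ, mu A => mu (A.rename (liftRen ξ))

/-- Extend a substitution under a binder. -/
def liftSub {n m : ℕ} (σ : Fin n → Ty m) : Fin (n + 1) → Ty (m + 1) :=
  Fin.cases (var 0) fun i => (σ i).rename Fin.succ

/-- Simultaneous capture-avoiding substitution of types for type variables. -/
def subst : {n m : ℕ} → (Fin n → Ty m) → Ty n → Ty m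
  | _, _, σ, var i => σ i
  | _, _, σ, sum A B => sum (A.subst σ) (B.subst σ)
  | _, _, σ, tensor A B => tensor (A.subst σ) (B.subst σ)
  | _, _, σ, lolli A B => lolli (A.subst σ) (B.subst σ)
  | _, _, σ, bang A => bang (A.subst σ)
  | _, _, σ, mu A => mu (A.subst (liftSub σ))

/-- `A[B/X]`, where `X` is the variable `0` of `A`. -/
def inst {n : ℕ} (A : Ty (n + 1)) (B : Ty n) : Ty n := A.subst (Fin.cases B var)

/-- The non-linear types `P, R ::= X | P + R | P ⊗ R | !A | μ X. P`. -/
def NonLinear : {n : ℕ} → Ty n → Prop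
  | _, var _ => True
  | _, sum A B => A.NonLinear ∧ B.NonLinear
  | _, tensor A B => A.NonLinear ∧ B.NonLinear
  | _, lolli _ _ => False
  | _, bang _ => True
  | _, mu A => A.NonLinear

end Ty

/-- Terms whose term variables are among `n` given ones. The branches of `case` and the body of
`lam` bind one variable, namely `0`; the body of `letp` binds two, namely `x = 1` and `y = 0` for
`let ⟨x, y⟩ = m in n`. -/
inductive Tm : ℕ → Type
  | var {n : ℕ} (i : Fin n) : Tm n
  | left {n : ℕ} (A B : Ty 0) (m : Tm n) : Tm n
  | right {n : ℕ} (A B : Ty 0) (m : Tm n) : Tm n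
  | case {n : ℕ} (m : Tm n) (l r : Tm (n + 1)) : Tm n
  | pair {n : ℕ} (m p : Tm n) : Tm n
  | letp {n : ℕ} (m : Tm n) (p : Tm (n + 2)) : Tm n
  | lam {n : ℕ} (A : Ty 0) (m : Tm (n + 1)) : Tm n
  | app {n : ℕ} (m p : Tm n) : Tm n
  | lift {n : ℕ} (m : Tm n) : Tm n
  | force {n : ℕ} (m : Tm n) : Tm n
  | fold {n : ℕ} (A : Ty 1) (m : Tm n) : Tm n
  | unfold {n : ℕ} (m : Tm n) : Tm n

namespace Tm

/-- Renaming of term variables. -/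
def rename : {n k : ℕ} → (Fin n → Fin k) → Tm n → Tm k
  | _, _, ξ, var i => var (ξ i)
  | _, _, ξ, left A B m => left A B (m.rename ξ)
  | _, _, ξ, right A B m => right A B (m.rename ξ)
  | _, _, ξ, case m l r => case (m.rename ξ) (l.rename (Ty.liftRen ξ)) (r.rename (Ty.liftRen ξ))
  | _, _, ξ, pair m p => pair (m.rename ξ) (p.rename ξ)
  | _, _, ξ, letp m p => letp (m.rename ξ) (p.rename (Ty.liftRen (Ty.liftRen ξ)))
  | _, _, ξ, lam A m => lam A (m.rename (Ty.liftRen ξ))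
  | _, _, ξ, app m p => app (m.rename ξ) (p.rename ξ)
  | _, _, ξ, lift m => lift (m.rename ξ)
  | _, _, ξ, force m => force (m.rename ξ)
  | _, _, ξ, fold A m => fold A (m.rename ξ)
  | _, _, ξ, unfold m => unfold (m.rename ξ)

/-- Extend a substitution under a binder. -/
def liftSub {n k : ℕ} (σ : Fin n → Tm k) : Fin (n + 1) → Tm (k + 1) :=
  Fin.cases (var 0) fun i => (σ i).rename Fin.succ

/-- Simultaneous capture-avoiding substitution of terms for term variables. -/
def subst : {n k : ℕ} → (Fin n → Tm k) → Tm n → Tm k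
  | _, _, σ, var i => σ i
  | _, _, σ, left A B m => left A B (m.subst σ)
  | _, _, σ, right A B m => right A B (m.subst σ)
  | _, _, σ, case m l r => case (m.subst σ) (l.subst (liftSub σ)) (r.subst (liftSub σ))
  | _, _, σ, pair m p => pair (m.subst σ) (p.subst σ)
  | _, _, σ, letp m p => letp (m.subst σ) (p.subst (liftSub (liftSub σ)))
  | _, _, σ, lam A m => lam A (m.subst (liftSub σ))
  | _, _, σ, app m p => app (m.subst σ) (p.subst σ)
  | _, _, σ, lift m => lift (m.subst σ)
  | _, _, σ, force m => force (m.subst σ)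
  | _, _, σ, fold A m => fold A (m.subst σ)
  | _, _, σ, unfold m => unfold (m.subst σ)

/-- `m[v/x]`, where `x` is the variable `0` of `m`. -/
def inst {n : ℕ} (m : Tm (n + 1)) (v : Tm n) : Tm n := m.subst (Fin.cases v var)

/-- `m[v/x, w/y]`, where `x` and `y` are the variables `1` and `0` of `m`. -/
def inst₂ {n : ℕ} (m : Tm (n + 2)) (v w : Tm n) : Tm n :=
  m.subst (Fin.cases w (Fin.cases v var))

/-- The values `v, w ::= x | left v | right v | ⟨v, w⟩ | λ x. m | lift m | fold v`. -/
inductive IsValue : {n : ℕ} → Tm n → Prop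
  | var {n : ℕ} (i : Fin n) : IsValue (var i)
  | left {n : ℕ} {A B : Ty 0} {v : Tm n} : IsValue v → IsValue (left A B v)
  | right {n : ℕ} {A B : Ty 0} {v : Tm n} : IsValue v → IsValue (right A B v)
  | pair {n : ℕ} {v w : Tm n} : IsValue v → IsValue w → IsValue (pair v w)
  | lam {n : ℕ} (A : Ty 0) (m : Tm (n + 1)) : IsValue (lam A m)
  | lift {n : ℕ} (m : Tm n) : IsValue (lift m)
  | fold {n : ℕ} {A : Ty 1} {v : Tm n} : IsValue v → IsValue (fold A v)

/-- The big-step call-by-value evaluation relation `m ⇓ v`. -/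
inductive Eval : {n : ℕ} → Tm n → Tm n → Prop
  | var {n : ℕ} (i : Fin n) : Eval (var i) (var i)
  | left {n : ℕ} {A B : Ty 0} {m v : Tm n} : Eval m v → Eval (left A B m) (left A B v)
  | right {n : ℕ} {A B : Ty 0} {m v : Tm n} : Eval m v → Eval (right A B m) (right A B v)
  | case_left {n : ℕ} {A B : Ty 0} {m v w : Tm n} {l r : Tm (n + 1)} :
      Eval m (left A B v) → Eval (l.inst v) w → Eval (case m l r) w
  | case_right {n : ℕ} {A B : Ty 0} {m v w : Tm n} {l r : Tm (n + 1)} :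
      Eval m (right A B v) → Eval (r.inst v) w → Eval (case m l r) w
  | pair {n : ℕ} {m p v w : Tm n} : Eval m v → Eval p w → Eval (pair m p) (pair v w)
  | letp {n : ℕ} {m v v' w : Tm n} {p : Tm (n + 2)} :
      Eval m (pair v v') → Eval (p.inst₂ v v') w → Eval (letp m p) w
  | lam {n : ℕ} (A : Ty 0) (m : Tm (n + 1)) : Eval (lam A m) (lam A m)
  | app {n : ℕ} {A : Ty 0} {m p v w : Tm n} {m' : Tm (n + 1)} :
      Eval m (lam A m') → Eval p v → Eval (m'.inst v) w → Eval (app m p) w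
  | lift {n : ℕ} (m : Tm n) : Eval (lift m) (lift m)
  | force {n : ℕ} {m m' v : Tm n} : Eval m (lift m') → Eval m' v → Eval (force m) v
  | fold {n : ℕ} {A : Ty 1} {m v : Tm n} : Eval m v → Eval (fold A m) (fold A v)
  | unfold {n : ℕ} {A : Ty 1} {m v : Tm n} : Eval m (fold A v) → Eval (unfold m) v

/-- `m ⇓`: the term `m` evaluates to some value. -/
def Terminates {n : ℕ} (m : Tm n) : Prop := ∃ v, IsValue v ∧ Eval m v

end Tm

/-- Term contexts of closed types. Each of the `n` term variables either is assigned a type or is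
absent from the context (`skip`); thus a `Ctx n` is a finite list of distinct variables with
types. -/
inductive Ctx : ℕ → Type
  | nil : Ctx 0
  | snoc {n : ℕ} (Γ : Ctx n) (A : Ty 0) : Ctx (n + 1)
  | skip {n : ℕ} (Γ : Ctx n) : Ctx (n + 1)

/-- Non-linear term contexts. -/
def Ctx.NonLinear : {n : ℕ} → Ctx n → Prop
  | _, nil => True
  | _, snoc Γ A => Γ.NonLinear ∧ A.NonLinear
  | _, skip Γ => Γ.NonLinear

/-- `Lookup Γ i A` : up to exchange, `Γ` is of the form `Φ, i : A` with `Φ` non-linear. -/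
inductive Lookup : {n : ℕ} → Ctx n → Fin n → Ty 0 → Type
  | here {n : ℕ} {Φ : Ctx n} {A : Ty 0} (hΦ : Φ.NonLinear) : Lookup (Φ.snoc A) 0 A
  | there {n : ℕ} {Γ : Ctx n} {i : Fin n} {A P : Ty 0} (hP : P.NonLinear) (h : Lookup Γ i A) :
      Lookup (Γ.snoc P) i.succ A
  | skip {n : ℕ} {Γ : Ctx n} {i : Fin n} {A : Ty 0} (h : Lookup Γ i A) : Lookup Γ.skip i.succ A

/-- `Split Δ Δ₁ Δ₂` : up to exchange, `Δ = Φ, Γ, Σ` and `Δ₁ = Φ, Γ` and `Δ₂ = Φ, Σ` for a non-linear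
`Φ` (introduced by `both`) and contexts `Γ` (introduced by `left`) and `Σ` (introduced by `right`)
without common variables. -/
inductive Split : {n : ℕ} → Ctx n → Ctx n → Ctx n → Type
  | nil : Split .nil .nil .nil
  | both {n : ℕ} {Δ Δ₁ Δ₂ : Ctx n} {P : Ty 0} (hP : P.NonLinear) (s : Split Δ Δ₁ Δ₂) :
      Split (Δ.snoc P) (Δ₁.snoc P) (Δ₂.snoc P)
  | left {n : ℕ} {Δ Δ₁ Δ₂ : Ctx n} {A : Ty 0} (s : Split Δ Δ₁ Δ₂) :
      Split (Δ.snoc A) (Δ₁.snoc A) Δ₂.skip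
  | right {n : ℕ} {Δ Δ₁ Δ₂ : Ctx n} {A : Ty 0} (s : Split Δ Δ₁ Δ₂) :
      Split (Δ.snoc A) Δ₁.skip (Δ₂.snoc A)
  | skip {n : ℕ} {Δ Δ₁ Δ₂ : Ctx n} (s : Split Δ Δ₁ Δ₂) : Split Δ.skip Δ₁.skip Δ₂.skip

/-- Derivations of term judgements `Γ ⊢ m : A`. -/
inductive Deriv : {n : ℕ} → Ctx n → Tm n → Ty 0 → Type
  | var {n : ℕ} {Γ : Ctx n} {i : Fin n} {A : Ty 0} (h : Lookup Γ i A) : Deriv Γ (.var i) A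
  | left {n : ℕ} {Γ : Ctx n} {m : Tm n} {A : Ty 0} (B : Ty 0) (D : Deriv Γ m A) :
      Deriv Γ (.left A B m) (.sum A B)
  | right {n : ℕ} {Γ : Ctx n} {m : Tm n} (A : Ty 0) {B : Ty 0} (D : Deriv Γ m B) :
      Deriv Γ (.right A B m) (.sum A B)
  | case {n : ℕ} {Δ Δ₁ Δ₂ : Ctx n} {m : Tm n} {l r : Tm (n + 1)} {A B C : Ty 0}
      (s : Split Δ Δ₁ Δ₂) (D : Deriv Δ₁ m (.sum A B)) (D₁ : Deriv (Δ₂.snoc A) l C)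
      (D₂ : Deriv (Δ₂.snoc B) r C) : Deriv Δ (.case m l r) C
  | pair {n : ℕ} {Δ Δ₁ Δ₂ : Ctx n} {m p : Tm n} {A B : Ty 0} (s : Split Δ Δ₁ Δ₂)
      (D₁ : Deriv Δ₁ m A) (D₂ : Deriv Δ₂ p B) : Deriv Δ (.pair m p) (.tensor A B)
  | letp {n : ℕ} {Δ Δ₁ Δ₂ : Ctx n} {m : Tm n} {p : Tm (n + 2)} {A B C : Ty 0}
      (s : Split Δ Δ₁ Δ₂) (D₁ : Deriv Δ₁ m (.tensor A B))
      (D₂ : Deriv ((Δ₂.snoc A).snoc B) p C) : Deriv Δ (.letp m p) C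
  | lam {n : ℕ} {Γ : Ctx n} {m : Tm (n + 1)} {A B : Ty 0} (D : Deriv (Γ.snoc A) m B) :
      Deriv Γ (.lam A m) (.lolli A B)
  | app {n : ℕ} {Δ Δ₁ Δ₂ : Ctx n} {m p : Tm n} {A B : Ty 0} (s : Split Δ Δ₁ Δ₂)
      (D₁ : Deriv Δ₁ m (.lolli A B)) (D₂ : Deriv Δ₂ p A) : Deriv Δ (.app m p) B
  | lift {n : ℕ} {Φ : Ctx n} {m : Tm n} {A : Ty 0} (hΦ : Φ.NonLinear) (D : Deriv Φ m A) :
      Deriv Φ (.lift m) (.bang A)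
  | force {n : ℕ} {Γ : Ctx n} {m : Tm n} {A : Ty 0} (D : Deriv Γ m (.bang A)) :
      Deriv Γ (.force m) A
  | fold {n : ℕ} {Γ : Ctx n} {m : Tm n} {A : Ty 1} (D : Deriv Γ m (A.inst (.mu A))) :
      Deriv Γ (.fold A m) (.mu A)
  | unfold {n : ℕ} {Γ : Ctx n} {m : Tm n} {A : Ty 1} (D : Deriv Γ m (.mu A)) :
      Deriv Γ (.unfold m) (A.inst (.mu A))

/-! ## Interpretation of types -/

/-- The isomorphism of categories `K^n × K ≅ K^(n+1)`, the last factor becoming the component at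
`0`. -/
def consF (K : Type u) [Category.{v} K] (n : ℕ) : (Fin n → K) × K ⥤ (Fin (n + 1) → K) :=
  Functor.pi' (Fin.cases (CategoryTheory.Prod.snd (Fin n → K) K)
    fun i => CategoryTheory.Prod.fst (Fin n → K) K ⋙ Pi.eval (fun _ => K) i)

/-- The natural transformation `β ⟨P, R⟩ ∘ T ⟨α, α'⟩`. -/
def pairTrans {A : Type u} [Category.{v} A] {A' : Type u} [Category.{v} A'] {K : Type u}
    [Category.{v} K] {K' : Type u} [Category.{v} K'] {N : A ⥤ A'} {M : K ⥤ K'}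
    {T : K' × K' ⥤ K'} {H : K × K ⥤ K} {X Z : A' ⥤ K'} {P R : A ⥤ K}
    (β : M.prod M ⋙ T ⟶ H ⋙ M) (α : N ⋙ X ⟶ P ⋙ M) (α' : N ⋙ Z ⟶ R ⋙ M) :
    N ⋙ X.prod' Z ⋙ T ⟶ (P.prod' R ⋙ H) ⋙ M where
  app a := T.map (show (X.obj (N.obj a), Z.obj (N.obj a)) ⟶ (M.obj (P.obj a), M.obj (R.obj a))
    from (α.app a, α'.app a)) ≫ β.app (P.obj a, R.obj a)
  naturality a b f := by
    have h := β.naturality (show (P.obj a, R.obj a) ⟶ (P.obj b, R.obj b) from (P.map f, R.map f))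
    have h1 := α.naturality f
    have h2 := α'.naturality f
    simp only [Functor.comp_obj, Functor.comp_map, Functor.prod_map] at h h1 h2
    simp only [Functor.comp_map, Category.assoc, Functor.prod'_map]
    rw [← h, ← Category.assoc, ← Category.assoc, ← T.map_comp, ← T.map_comp]
    congr 2
    exact Prod.ext h1 h2

namespace CPOLNLModel

variable (M : CPOLNLModel.{v, u})

/-- The standard interpretation `⟦Θ ⊢ A⟧ : L_e^|Θ| ⥤ L_e` of types. -/
noncomputable def ty : {n : ℕ} → Ty n → ((Fin n → M.Le) ⥤ M.Le)
  | _, .var i => Pi.eval (fun _ => M.Le) i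
  | _, .sum A B => (ty A).prod' (ty B) ⋙ M.sumE
  | _, .tensor A B => (ty A).prod' (ty B) ⋙ M.tensorE
  | _, .lolli A B => (ty A).prod' (ty B) ⋙ M.lolliE
  | _, .bang A => ty A ⋙ M.Gpe ⋙ M.Fpe
  | n, .mu A => dagger (consF M.Le n ⋙ ty A)

/-- The functor `F_pe^n`. -/
abbrev powF (n : ℕ) : (Fin n → M.Cpe) ⥤ (Fin n → M.Le) := Functor.pi fun _ => M.Fpe

/-- The non-linear interpretation `(|Θ ⊢ P|) : C_pe^|Θ| ⥤ C_pe` of non-linear types. -/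
noncomputable def nl : {n : ℕ} → (P : Ty n) → P.NonLinear → ((Fin n → M.Cpe) ⥤ M.Cpe)
  | _, .var i, _ => Pi.eval (fun _ => M.Cpe) i
  | _, .sum P R, h => (nl P h.1).prod' (nl R h.2) ⋙ M.coprodPe
  | _, .tensor P R, h => (nl P h.1).prod' (nl R h.2) ⋙ M.prodPe
  | n, .bang A, _ => M.powF n ⋙ M.ty A ⋙ M.Gpe
  | n, .mu P, h => dagger (consF M.Cpe n ⋙ nl P h)

/-- The identity transformation between the two equal functors `(X⃗, Y) ↦ (F X⃗, F Y)`. -/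
noncomputable def consComparison (n : ℕ) : (M.powF n).prod M.Fpe ⋙ consF M.Le n ⟶
    consF M.Cpe n ⋙ M.powF (n + 1) where
  app X := fun i => Fin.cases (motive := fun i =>
    ((M.powF n).prod M.Fpe ⋙ consF M.Le n).obj X i ⟶ (consF M.Cpe n ⋙ M.powF (n + 1)).obj X i)
    (𝟙 (M.Fpe.obj X.2)) (fun i => 𝟙 (M.Fpe.obj (X.1 i))) i
  naturality X Y f := by
    funext i
    induction i using Fin.cases with
    | zero =>
      exact (Category.comp_id (M.Fpe.map f.2)).trans (Category.id_comp (M.Fpe.map f.2)).symm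
    | succ i =>
      exact (Category.comp_id (M.Fpe.map (f.1 i))).trans
        (Category.id_comp (M.Fpe.map (f.1 i))).symm

/-- The natural isomorphism `α^(Θ ⊢ P) : ⟦P⟧ ∘ F_pe^|Θ| ⟶ F_pe ∘ (|P|)`. -/
noncomputable def α : {n : ℕ} → (P : Ty n) → (h : P.NonLinear) →
    (M.powF n ⋙ M.ty P ⟶ M.nl P h ⋙ M.Fpe)
  | _, .var i, _ => 𝟙 (Pi.eval (fun _ => M.Cpe) i ⋙ M.Fpe)
  | _, .sum P R, h => pairTrans M.cPe (α P h.1) (α R h.2)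
  | _, .tensor P R, h => pairTrans M.mPe (α P h.1) (α R h.2)
  | n, .bang A, _ => 𝟙 (M.powF n ⋙ M.ty A ⋙ M.Gpe ⋙ M.Fpe)
  | n, .mu P, h => daggerTrans (T := consF M.Le n ⋙ M.ty P) (H := consF M.Cpe n ⋙ M.nl P h)
      (N := M.powF n) (M := M.Fpe)
      (Functor.whiskerRight (M.consComparison n) (M.ty P) ≫
        Functor.whiskerLeft (consF M.Cpe n) (α P h))

end CPOLNLModel

/-! ### The substitution lemma and (un)folding -/

namespace CPOLNLModel

variable (M : CPOLNLModel.{v, u})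

/-- The functor `⟨T_1, …, T_n⟩ : L_e^m ⥤ L_e^n`. -/
abbrev tuple {n m : ℕ} (T : Fin n → ((Fin m → M.Le) ⥤ M.Le)) :
    (Fin m → M.Le) ⥤ (Fin n → M.Le) := Functor.pi' T

theorem consF_tuple {n m : ℕ} (T : Fin n → ((Fin m → M.Le) ⥤ M.Le))
    (T' : Fin (n + 1) → ((Fin (m + 1) → M.Le) ⥤ M.Le))
    (h0 : T' 0 = Pi.eval (fun _ => M.Le) 0)
    (hs : ∀ i : Fin n, consF M.Le m ⋙ T' i.succ = CategoryTheory.Prod.fst _ _ ⋙ T i) :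
    consF M.Le m ⋙ M.tuple T' = (M.tuple T).prod (𝟭 M.Le) ⋙ consF M.Le n := by
  refine Functor.pi_ext _ _ fun i => ?_
  induction i using Fin.cases with
  | zero =>
    have h : consF M.Le m ⋙ T' 0 = CategoryTheory.Prod.snd _ _ := by rw [h0]; rfl
    exact h
  | succ i => exact hs i

theorem ty_rename {n m : ℕ} (A : Ty n) (ξ : Fin n → Fin m) :
    M.ty (A.rename ξ) = M.tuple (fun i => Pi.eval (fun _ => M.Le) (ξ i)) ⋙ M.ty A := by
  induction A generalizing m with
  | var i => rfl
  | sum A B hA hB => simp only [Ty.rename, ty, hA, hB]; rfl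
  | tensor A B hA hB => simp only [Ty.rename, ty, hA, hB]; rfl
  | lolli A B hA hB => simp only [Ty.rename, ty, hA, hB]; rfl
  | bang A hA => simp only [Ty.rename, ty, hA]; rfl
  | mu A hA =>
    simp only [Ty.rename, ty, hA]
    rw [← dagger_comp, ← Functor.assoc, ← Functor.assoc,
      M.consF_tuple (fun i => Pi.eval (fun _ => M.Le) (ξ i)) _ rfl fun i => rfl]

theorem ty_subst {n m : ℕ} (A : Ty n) (σ : Fin n → Ty m) :
    M.ty (A.subst σ) = M.tuple (fun i => M.ty (σ i)) ⋙ M.ty A := by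
  induction A generalizing m with
  | var i => rfl
  | sum A B hA hB => simp only [Ty.subst, ty, hA, hB]; rfl
  | tensor A B hA hB => simp only [Ty.subst, ty, hA, hB]; rfl
  | lolli A B hA hB => simp only [Ty.subst, ty, hA, hB]; rfl
  | bang A hA => simp only [Ty.subst, ty, hA]; rfl
  | mu A hA =>
    simp only [Ty.subst, ty, hA]
    rw [← dagger_comp, ← Functor.assoc, ← Functor.assoc,
      M.consF_tuple (fun i => M.ty (σ i)) _ rfl fun i => ?_]
    simp only [Ty.liftSub, Fin.cases_succ, ty_rename]
    rfl

/-- The unique object of `L_e^0`. -/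
abbrev pt : Fin 0 → M.Le := (M.powF 0).obj Fin.elim0

/-- The object `⟦A⟧` of `L` for a closed type `A`. -/
noncomputable abbrev obj (A : Ty 0) : M.Le := (M.ty A).obj M.pt

theorem obj_inst (A : Ty 1) (B : Ty 0) :
    M.obj (A.inst B) = (consF M.Le 0 ⋙ M.ty A).obj (M.pt, M.obj B) := by
  unfold obj Ty.inst
  rw [ty_subst]
  change (M.ty A).obj _ = (M.ty A).obj _
  congr 1
  funext i
  induction i using Fin.cases with
  | zero => rfl
  | succ i => exact i.elim0

/-- `unfold^(μX.A) : ⟦μX.A⟧ ⟶ ⟦A[μX.A/X]⟧`. -/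
noncomputable def unfoldE (A : Ty 1) : M.obj A.mu ⟶ M.obj (A.inst A.mu) :=
  unroll ((Functor.curry.obj (consF M.Le 0 ⋙ M.ty A)).obj M.pt) ≫
    eqToHom (M.obj_inst A A.mu).symm

/-- The object `⟦A⟧` of `L` interpreting a closed type `A`. -/
noncomputable abbrev Ob (A : Ty 0) : M.L := (M.obj A).obj

/-- The object `(|P|)` of `C` interpreting a closed non-linear type `P`. -/
noncomputable abbrev NOb (P : Ty 0) (h : P.NonLinear) : M.C := ((M.nl P h).obj Fin.elim0).obj

/-- The isomorphism `unfold^(μX.A) : ⟦μX.A⟧ ⟶ ⟦A[μX.A/X]⟧` in `L`. -/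
noncomputable def unfold (A : Ty 1) : M.Ob A.mu ⟶ M.Ob (A.inst A.mu) := (M.unfoldE A).hom

/-- The inverse `fold^(μX.A)` of `unfold^(μX.A)`. The inverse of an isomorphism is its projection
counterpart. -/
noncomputable def fold (A : Ty 1) : M.Ob (A.inst A.mu) ⟶ M.Ob A.mu := proj (M.unfoldE A).property

/-- The isomorphism `α^P : ⟦P⟧ ⟶ F (|P|)` in `L`. -/
noncomputable def alpha (P : Ty 0) (h : P.NonLinear) : M.Ob P ⟶ M.F.obj (M.NOb P h) :=
  ((M.α P h).app Fin.elim0).hom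

/-- The inverse of `α^P`. The inverse of an isomorphism is its projection counterpart. -/
noncomputable def alphaInv (P : Ty 0) (h : P.NonLinear) : M.F.obj (M.NOb P h) ⟶ M.Ob P :=
  proj ((M.α P h).app Fin.elim0).property

/-! ## Interpretation of term contexts -/

/-- The object `⟦Γ⟧` of `L`. -/
noncomputable def ctx : {n : ℕ} → Ctx n → M.L
  | _, .nil => 𝟙_ M.L
  | _, .snoc Γ A => ctx Γ ⊗ M.Ob A
  | _, .skip Γ => ctx Γ

/-- The object `(|Φ|)` of `C`. -/
noncomputable def nctx : {n : ℕ} → (Φ : Ctx n) → Φ.NonLinear → M.C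
  | _, .nil, _ => 𝟙_ M.C
  | _, .snoc Φ P, h => nctx Φ h.1 ⊗ M.NOb P h.2
  | _, .skip Φ, h => nctx Φ h

/-- The isomorphism `α^Φ : ⟦Φ⟧ ⟶ F (|Φ|)`. -/
noncomputable def alphaCtx : {n : ℕ} → (Φ : Ctx n) → (h : Φ.NonLinear) →
    (M.ctx Φ ⟶ M.F.obj (M.nctx Φ h))
  | _, .nil, _ => Functor.LaxMonoidal.ε M.F
  | _, .snoc Φ P, h => (alphaCtx Φ h.1 ⊗ₘ M.alpha P h.2) ≫ Functor.LaxMonoidal.μ M.F _ _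
  | _, .skip Φ, h => alphaCtx Φ h

/-- The inverse of `α^Φ`. -/
noncomputable def alphaCtxInv : {n : ℕ} → (Φ : Ctx n) → (h : Φ.NonLinear) →
    (M.F.obj (M.nctx Φ h) ⟶ M.ctx Φ)
  | _, .nil, _ => Functor.OplaxMonoidal.η M.F
  | _, .snoc Φ P, h =>
    Functor.OplaxMonoidal.δ M.F _ _ ≫ (alphaCtxInv Φ h.1 ⊗ₘ M.alphaInv P h.2)
  | _, .skip Φ, h => alphaCtxInv Φ h

/-- The discarding morphism `⟦Ψ⟧ ⟶ F (|Ψ|) ⟶ F 1 ⟶ I`, given `α^Ψ : ⟦Ψ⟧ ⟶ F (|Ψ|)`. -/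
def discard {X : M.L} {Z : M.C} (a : X ⟶ M.F.obj Z) : X ⟶ 𝟙_ M.L :=
  a ≫ M.F.map (SemiCartesianMonoidalCategory.toUnit Z) ≫ Functor.OplaxMonoidal.η M.F

/-- The copying morphism `⟦Ψ⟧ ⟶ F (|Ψ|) ⟶ F ((|Ψ|) × (|Ψ|)) ⟶ F (|Ψ|) ⊗ F (|Ψ|) ⟶ ⟦Ψ⟧ ⊗ ⟦Ψ⟧`, given
`α^Ψ` and its inverse. -/
def copy {X : M.L} {Z : M.C} (a : X ⟶ M.F.obj Z) (a' : M.F.obj Z ⟶ X) : X ⟶ X ⊗ X :=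
  a ≫ M.F.map (CartesianMonoidalCategory.lift (𝟙 Z) (𝟙 Z)) ≫ Functor.OplaxMonoidal.δ M.F Z Z ≫
    (a' ⊗ₘ a')

/-- The promotion morphism `⟦Ψ⟧ ⟶ F (|Ψ|) ⟶ !F (|Ψ|) ⟶ !⟦Ψ⟧`, given `α^Ψ` and its inverse. -/
def promote {X : M.L} {Z : M.C} (a : X ⟶ M.F.obj Z) (a' : M.F.obj Z ⟶ X) :
    X ⟶ M.bangFunctor.obj X :=
  a ≫ M.F.map (M.adj.unit.app Z) ≫ M.bangFunctor.map a'

/-! ## Interpretation of terms -/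

/-- For `Γ = Φ, i : A`, the morphism `⟦Γ⟧ ≅ ⟦Φ⟧ ⊗ ⟦A⟧ ⟶ I ⊗ ⟦A⟧ ≅ ⟦A⟧` which discards `Φ`. -/
noncomputable def lookup : {n : ℕ} → {Γ : Ctx n} → {i : Fin n} → {A : Ty 0} → Lookup Γ i A →
    (M.ctx Γ ⟶ M.Ob A)
  | _, _, _, A, .here (Φ := Φ) hΦ => (M.discard (M.alphaCtx Φ hΦ) ▷ M.Ob A) ≫ (λ_ (M.Ob A)).hom
  | _, _, _, A, .there (P := P) hP h =>
    (lookup h ⊗ₘ M.discard (M.alpha P hP)) ≫ (ρ_ (M.Ob A)).hom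
  | _, _, _, A, .skip (Γ := Γ) h => (lookup h : M.ctx Γ ⟶ M.Ob A)

/-- For `Δ = Φ, Γ, Σ`, the morphism
`⟦Δ⟧ ≅ ⟦Φ⟧ ⊗ ⟦Γ⟧ ⊗ ⟦Σ⟧ ⟶ ⟦Φ⟧ ⊗ ⟦Φ⟧ ⊗ ⟦Γ⟧ ⊗ ⟦Σ⟧ ≅ ⟦Φ, Γ⟧ ⊗ ⟦Φ, Σ⟧` which copies `Φ`. -/
noncomputable def split : {n : ℕ} → {Δ Δ₁ Δ₂ : Ctx n} → Split Δ Δ₁ Δ₂ →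
    (M.ctx Δ ⟶ M.ctx Δ₁ ⊗ M.ctx Δ₂)
  | _, _, _, _, .nil => (λ_ (𝟙_ M.L)).inv
  | _, _, _, _, .both (P := P) hP s =>
    (split s ⊗ₘ M.copy (M.alpha P hP) (M.alphaInv P hP)) ≫ tensorμ _ _ _ _
  | _, _, _, _, .left (A := A) (Δ₁ := Δ₁) (Δ₂ := Δ₂) s =>
    (split s ▷ M.Ob A) ≫ (α_ (M.ctx Δ₁) (M.ctx Δ₂) (M.Ob A)).hom ≫
      (M.ctx Δ₁ ◁ (β_ (M.ctx Δ₂) (M.Ob A)).hom) ≫ (α_ (M.ctx Δ₁) (M.Ob A) (M.ctx Δ₂)).inv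
  | _, _, _, _, .right (A := A) (Δ₁ := Δ₁) (Δ₂ := Δ₂) s =>
    (split s ▷ M.Ob A) ≫ (α_ (M.ctx Δ₁) (M.ctx Δ₂) (M.Ob A)).hom
  | _, _, _, _, .skip (Δ := Δ) (Δ₁ := Δ₁) (Δ₂ := Δ₂) s =>
    (split s : M.ctx Δ ⟶ M.ctx Δ₁ ⊗ M.ctx Δ₂)

/-- The morphism `[f, g] ∘ d : X ⊗ (A + B) ⟶ Z`, where `d : X ⊗ (A + B) ≅ (X ⊗ A) + (X ⊗ B)` is the
distributivity isomorphism. -/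
noncomputable def distDesc {X A B Z : M.L} (f : X ⊗ A ⟶ Z) (g : X ⊗ B ⟶ Z) : X ⊗ (A ⨿ B) ⟶ Z :=
  inv (coprodComparison (tensorLeft X) A B) ≫ coprod.desc f g

/-- The interpretation `⟦D⟧ : ⟦Γ⟧ ⟶ ⟦A⟧` of a derivation `D` of `Γ ⊢ m : A`. -/
noncomputable def den : {n : ℕ} → {Γ : Ctx n} → {m : Tm n} → {A : Ty 0} → Deriv Γ m A →
    (M.ctx Γ ⟶ M.Ob A)
  | _, _, _, _, .var h => M.lookup h
  | _, _, _, _, .left (A := A) B D => den D ≫ (coprod.inl : M.Ob A ⟶ M.Ob A ⨿ M.Ob B)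
  | _, _, _, _, .right A (B := B) D => den D ≫ (coprod.inr : M.Ob B ⟶ M.Ob A ⨿ M.Ob B)
  | _, _, _, _, .case (Δ₁ := Δ₁) (Δ₂ := Δ₂) (A := A) (B := B) (C := C) s D D₁ D₂ =>
    M.split s ≫ (β_ (M.ctx Δ₁) (M.ctx Δ₂)).hom ≫
      (M.ctx Δ₂ ◁ (show M.ctx Δ₁ ⟶ M.Ob A ⨿ M.Ob B from den D)) ≫
        M.distDesc (show M.ctx Δ₂ ⊗ M.Ob A ⟶ M.Ob C from den D₁)
          (show M.ctx Δ₂ ⊗ M.Ob B ⟶ M.Ob C from den D₂)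
  | _, _, _, _, .pair s D₁ D₂ => M.split s ≫ (den D₁ ⊗ₘ den D₂)
  | _, _, _, _, .letp (Δ₁ := Δ₁) (Δ₂ := Δ₂) (A := A) (B := B) s D₁ D₂ =>
    M.split s ≫ (β_ (M.ctx Δ₁) (M.ctx Δ₂)).hom ≫
      (M.ctx Δ₂ ◁ (show M.ctx Δ₁ ⟶ M.Ob A ⊗ M.Ob B from den D₁)) ≫
        (α_ (M.ctx Δ₂) (M.Ob A) (M.Ob B)).inv ≫ den D₂
  | _, _, _, _, .lam (Γ := Γ) (A := A) (B := B) D =>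
    MonoidalClosed.curry ((β_ (M.Ob A) (M.ctx Γ)).hom ≫
      (show M.ctx Γ ⊗ M.Ob A ⟶ M.Ob B from den D))
  | _, _, _, _, .app (A := A) (B := B) s D₁ D₂ =>
    M.split s ≫ ((show _ ⟶ (ihom (M.Ob A)).obj (M.Ob B) from den D₁) ⊗ₘ den D₂) ≫
      (β_ ((ihom (M.Ob A)).obj (M.Ob B)) (M.Ob A)).hom ≫ (ihom.ev (M.Ob A)).app (M.Ob B)
  | _, _, _, _, .lift (Φ := Φ) hΦ D =>
    M.promote (M.alphaCtx Φ hΦ) (M.alphaCtxInv Φ hΦ) ≫ M.bangFunctor.map (den D)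
  | _, _, _, _, .force (A := A) D => den D ≫ M.adj.counit.app (M.Ob A)
  | _, _, _, _, .fold (A := A) D => den D ≫ M.fold A
  | _, _, _, _, .unfold (A := A) D => den D ≫ M.unfold A

end CPOLNLModel

end LNLFPC

/-! Termination is a logical-relations argument, and the converse at non-linear types is a soundness
argument. Both compare elements `I ⟶ ⟦A⟧` with closed values, and both rest on knowing which
elements can be discarded, copied and promoted.

A recursive type may occur to the left of `⊸`, so a relation between elements and values cannot be
defined by recursion on the type. Cutting off the unfolding of recursive types at level `n` gives
idempotents `approx n A ≤ id`, and a relation `RelAt n A` between elements fixed by `approx n A` and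
values, defined by recursion on `n` and the size of `A`. Consecutive levels are linked by inclusion
and truncation (`RelAt.succ_and_pred`), and each level is closed under suprema (`RelAt.of_isSup`),
where the tensor case needs that `⊗` reflects the order between non-`⊥` elements. An element is
related to a value by `Rel` when almost all its truncations are. As the truncations converge to the
identity (`approxSup_eq`), `Rel` satisfies the expected equation at every connective, in particular
at `fold`. Induction on derivations (`bar_rel`) then shows that an interpretation is `⊥` or the term
evaluates to a related value.

The convergence of `approx` comes from the coincidence of colimits and limits for chains of
embeddings: `⟦A⟧` preserves exhausting sequences of embeddings (`preservesExhaustion_ty`). The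
unfolding of a closed recursive type is not a smaller type, so such facts are proved for open types
under a closing substitution, by induction on the open type and, at `μ`, along the initial sequence
(`substMap_approxSup`, `isCoalgHom_substMap`).

Promotion at a non-linear type is defined through `α`. It is identified with a map `coalg` that is
computed connective by connective (`promote_alpha`). An element compatible with `coalg` agrees,
after the unit of the adjunction, with the image under `F` of a point of `C`. It is therefore
discarded to `id_I` and copied to a pair, and it is not `⊥` because `id_I ≠ ⊥`. Values of non-linear
type denote such elements.

For soundness, `Val` pairs a value with an element, keeping the body of a `λ` or `lift` as an open
derivation with an environment. With such closures no substitution lemma for derivations is needed.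
By `Val.of_eval` the interpretation of a terminating program is that of a value, hence not `⊥` at a
non-linear type. -/

namespace LNLFPC
open CategoryTheory CategoryTheory.Limits OmegaCompletePartialOrder MonoidalCategory

/-! ## Suprema of increasing sequences -/

section Sup

variable {α β γ : Type*}

/-- The sequence `f` is increasing and `a` is its supremum. -/
structure IsSup [Preorder α] (f : ℕ → α) (a : α) : Prop where
  mono : Monotone f
  isLUB : IsLUB (Set.range f) a

theorem IsSup.le [Preorder α] {f : ℕ → α} {a : α} (h : IsSup f a) (n : ℕ) : f n ≤ a :=
  h.isLUB.1 ⟨n, rfl⟩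

theorem IsSup.le_of_forall [Preorder α] {f : ℕ → α} {a b : α} (h : IsSup f a)
    (hb : ∀ n, f n ≤ b) : a ≤ b :=
  h.isLUB.2 (by rintro _ ⟨n, rfl⟩; exact hb n)

theorem IsSup.of_le [Preorder α] {f : ℕ → α} {a : α} (hf : Monotone f) (h : ∀ n, f n ≤ a)
    (h' : ∀ b, (∀ n, f n ≤ b) → a ≤ b) : IsSup f a :=
  ⟨hf, by rintro _ ⟨n, rfl⟩; exact h n, fun b hb => h' b fun n => hb ⟨n, rfl⟩⟩

theorem IsSup.unique [PartialOrder α] {f : ℕ → α} {a b : α} (h : IsSup f a) (h' : IsSup f b) :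
    a = b := h.isLUB.unique h'.isLUB

theorem IsSup.congr [Preorder α] {f g : ℕ → α} {a b : α} (h : IsSup f a) (hfg : ∀ n, g n = f n)
    (hab : b = a) : IsSup g b := by
  rwa [hab, show g = f from funext hfg]

theorem IsSup.const [Preorder α] (a : α) : IsSup (fun _ => a) a :=
  .of_le monotone_const (fun _ => le_rfl) fun _ h => h 0

theorem isSup_ωSup [OmegaCompletePartialOrder α] (c : Chain α) : IsSup c (ωSup c) :=
  .of_le c.monotone (le_ωSup c) (ωSup_le c)

theorem exists_isSup [OmegaCompletePartialOrder α] {f : ℕ → α} (hf : Monotone f) :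
    ∃ a, IsSup f a := ⟨_, isSup_ωSup ⟨f, hf⟩⟩

theorem IsSup.shift [Preorder α] {f : ℕ → α} {a : α} (h : IsSup f a) (k : ℕ) :
    IsSup (fun n => f (n + k)) a :=
  .of_le (fun _ _ hij => h.mono (Nat.add_le_add_right hij k)) (fun _ => h.le _)
    fun _ hb => h.le_of_forall fun n => (h.mono (Nat.le_add_right n k)).trans (hb n)

theorem IsSup.map [OmegaCompletePartialOrder α] [OmegaCompletePartialOrder β] {F : α → β}
    (hF : ωScottContinuous F) {f : ℕ → α} {a : α} (h : IsSup f a) :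
    IsSup (fun n => F (f n)) (F a) := by
  rw [h.unique (isSup_ωSup ⟨f, h.mono⟩), hF.map_ωSup]
  exact isSup_ωSup (Chain.map ⟨f, h.mono⟩ ⟨F, hF.monotone⟩)

theorem IsSup.prodMk [Preorder α] [Preorder β] {f : ℕ → α} {g : ℕ → β} {a : α} {b : β}
    (h : IsSup f a) (h' : IsSup g b) : IsSup (fun n => (f n, g n)) (a, b) :=
  .of_le (fun _ _ hij => ⟨h.mono hij, h'.mono hij⟩) (fun n => ⟨h.le n, h'.le n⟩)
    fun _ hc => ⟨h.le_of_forall fun n => (hc n).1, h'.le_of_forall fun n => (hc n).2⟩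

/-- Suprema of increasing sequences commute. -/
theorem IsSup.interchange [Preorder α] {a : ℕ → ℕ → α} {r c : ℕ → α} {s : α}
    (hr : ∀ k, IsSup (a k) (r k)) (hc : ∀ m, IsSup (fun k => a k m) (c m)) (hs : IsSup c s) :
    IsSup r s :=
  .of_le (fun _ k' h => (hr _).le_of_forall fun m => ((hc m).mono h).trans ((hr k').le m))
    (fun k => (hr k).le_of_forall fun m => ((hc m).le k).trans (hs.le m))
    fun _ hb => hs.le_of_forall fun m => (hc m).le_of_forall fun k => ((hr k).le m).trans (hb k)

end Sup

/-! ### Deflations of embeddings and exhausting sequences -/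

section CPOCat

variable {C : Type u} [Category.{v} C] [CPOCategory C]

theorem IsSup.comp {X Y Z : C} {f : ℕ → (X ⟶ Y)} {g : ℕ → (Y ⟶ Z)} {a : X ⟶ Y} {b : Y ⟶ Z}
    (hf : IsSup f a) (hg : IsSup g b) : IsSup (fun n => f n ≫ g n) (a ≫ b) :=
  (hf.prodMk hg).map (CPOCategory.comp_continuous X Y Z)

theorem IsSup.comp_right {X Y Z : C} {f : ℕ → (X ⟶ Y)} {a : X ⟶ Y}
    (hf : IsSup f a) (g : Y ⟶ Z) : IsSup (fun n => f n ≫ g) (a ≫ g) := hf.comp (.const g)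

theorem IsSup.comp_left {X Y Z : C} {g : ℕ → (Y ⟶ Z)} {b : Y ⟶ Z}
    (f : X ⟶ Y) (hg : IsSup g b) : IsSup (fun n => f ≫ g n) (f ≫ b) := (IsSup.const f).comp hg

theorem IsSup.functor_map {D : Type u} [Category.{v} D] [CPOCategory D] (F : C ⥤ D) [CPOFunctor F]
    {X Y : C} {f : ℕ → (X ⟶ Y)} {a : X ⟶ Y} (hf : IsSup f a) :
    IsSup (fun n => F.map (f n)) (F.map a) := hf.map (CPOFunctor.map_continuous X Y)

/-- The idempotent deflation of the target of an embedding. -/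
noncomputable def defl {X Y : Emb C} (e : X ⟶ Y) : Y.obj ⟶ Y.obj := proj e.property ≫ e.hom

theorem defl_le {X Y : Emb C} (e : X ⟶ Y) : defl e ≤ 𝟙 _ := (proj_spec e.property).proj_emb

theorem defl_eq {X Y : Emb C} (e : X ⟶ Y) {p : Y.obj ⟶ X.obj} (h : IsEPPair e.hom p) :
    defl e = p ≫ e.hom := by rw [defl, (proj_spec e.property).unique h]

@[simp] theorem emb_id_hom (X : Emb C) : InducedWideCategory.Hom.hom (𝟙 X) = 𝟙 X.obj := rfl

@[simp]
theorem emb_proj {X Y : Emb C} (e : X ⟶ Y) : e.hom ≫ proj e.property = 𝟙 X.obj :=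
  (proj_spec e.property).emb_proj

theorem proj_comp {X Y Z : Emb C} (e : X ⟶ Y) (f : Y ⟶ Z) :
    proj (e ≫ f).property = proj f.property ≫ proj e.property :=
  (proj_spec _).unique ((proj_spec e.property).comp (proj_spec f.property))

theorem defl_comp {X Y Z : Emb C} (e : X ⟶ Y) (f : Y ⟶ Z) :
    defl (e ≫ f) = proj f.property ≫ defl e ≫ f.hom := by
  simp [defl, proj_comp]

theorem defl_id (X : Emb C) : defl (𝟙 X) = 𝟙 X.obj := by
  rw [defl_eq (𝟙 X) (p := 𝟙 _) ⟨Category.id_comp _, (Category.id_comp _).le⟩]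
  exact Category.comp_id _

/-- The inverse in the category of embeddings meets the two conditions on a projection counterpart,
which is unique. -/
theorem proj_hom_isIso {X Y : Emb C} (e : X ⟶ Y) [IsIso e] :
    proj e.property ≫ e.hom = 𝟙 Y.obj := by
  have h : proj e.property = (inv e).hom := (proj_spec _).unique
    ⟨congrArg InducedWideCategory.Hom.hom (IsIso.hom_inv_id e),
      (congrArg InducedWideCategory.Hom.hom (IsIso.inv_hom_id e)).le⟩
  rw [h]
  exact congrArg InducedWideCategory.Hom.hom (IsIso.inv_hom_id e)

theorem isIso_emb_of_isIso {X Y : Emb C} (e : X ⟶ Y) (h : IsIso e.hom) : IsIso e :=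
  ⟨⟨inv e.hom, embedding_of_isIso _⟩, WideSubcategory.hom_ext _ (IsIso.hom_inv_id e.hom),
    WideSubcategory.hom_ext _ (IsIso.inv_hom_id e.hom)⟩

/-- An embedding whose image exhausts its target is an isomorphism. -/
theorem isIso_of_isSup_defl {X Y : Emb C} (e : X ⟶ Y) {Z : ℕ → Emb C} (t : ∀ k, Z k ⟶ X)
    (h : IsSup (fun k => defl (t k ≫ e)) (𝟙 Y.obj)) : IsIso e := by
  -- Every embedding that factors through `e` has a deflation below that of `e`, so `defl e` is an
  -- upper bound of a sequence with supremum the identity.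
  have h1 : 𝟙 Y.obj ≤ defl e := h.le_of_forall fun k => by
    rw [defl_comp]
    exact comp_mono le_rfl ((comp_mono (defl_le (t k)) le_rfl).trans (Category.id_comp _).le)
  exact isIso_emb_of_isIso e ⟨_, emb_proj e, le_antisymm (defl_le e) h1⟩

/-- A family of embeddings exhausting its target is jointly epic. -/
theorem hom_ext_of_isSup_defl {Y : Emb C} {Z : ℕ → Emb C} (t : ∀ k, Z k ⟶ Y)
    (h : IsSup (fun k => defl (t k)) (𝟙 Y.obj)) {W : C} {f g : Y.obj ⟶ W}
    (hfg : ∀ k, (t k).hom ≫ f = (t k).hom ≫ g) : f = g := by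
  have h1 := h.comp_right f
  have h2 := h.comp_right g
  simp only [defl, Category.assoc, hfg, Category.id_comp] at h1 h2
  exact h1.unique h2

end CPOCat

/-! ### Continuity and monotonicity of the type constructors -/

namespace CPOLNLModel

variable (M : CPOLNLModel.{v, u})

variable {M}

theorem isSup_tensor {X X' Y Y' : M.L} {f : ℕ → (X ⟶ X')} {g : ℕ → (Y ⟶ Y')} {a : X ⟶ X'}
    {b : Y ⟶ Y'} (hf : IsSup f a) (hg : IsSup g b) : IsSup (fun n => f n ⊗ₘ g n) (a ⊗ₘ b) :=
  (hf.prodMk hg).map (M.tensor_continuous X X' Y Y')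

theorem isSup_desc {X Y Z : M.L} {f : ℕ → (X ⟶ Z)} {g : ℕ → (Y ⟶ Z)} {a : X ⟶ Z}
    {b : Y ⟶ Z} (hf : IsSup f a) (hg : IsSup g b) :
    IsSup (fun n => coprod.desc (f n) (g n)) (coprod.desc a b) :=
  (hf.prodMk hg).map (M.desc_continuous_L X Y Z)

theorem coprod_map_eq_desc {X X' Y Y' : M.L} (f : X ⟶ X') (g : Y ⟶ Y') :
    coprod.map f g = coprod.desc (f ≫ coprod.inl) (g ≫ coprod.inr) := by
  ext <;> simp

theorem isSup_coprod {X X' Y Y' : M.L} {f : ℕ → (X ⟶ X')} {g : ℕ → (Y ⟶ Y')} {a : X ⟶ X'}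
    {b : Y ⟶ Y'} (hf : IsSup f a) (hg : IsSup g b) :
    IsSup (fun n => coprod.map (f n) (g n)) (coprod.map a b) := by
  simp only [coprod_map_eq_desc]
  exact isSup_desc (hf.comp_right _) (hg.comp_right _)

theorem isSup_lolli {X X' Y Y' : M.L} {f : ℕ → (X' ⟶ X)} {g : ℕ → (Y ⟶ Y')} {a : X' ⟶ X}
    {b : Y ⟶ Y'} (hf : IsSup f a) (hg : IsSup g b) :
    IsSup (fun n => M.lolliMap (f n) (g n)) (M.lolliMap a b) :=
  (hf.prodMk hg).map (M.ihom_continuous X X' Y Y')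

theorem isSup_bang {X Y : M.L} {f : ℕ → (X ⟶ Y)} {a : X ⟶ Y} (hf : IsSup f a) :
    IsSup (fun n => M.bangFunctor.map (f n)) (M.bangFunctor.map a) :=
  (hf.functor_map M.G).functor_map M.F

theorem tensor_le {X X' Y Y' : M.L} {f f' : X ⟶ X'} {g g' : Y ⟶ Y'} (h : f ≤ f') (h' : g ≤ g') :
    f ⊗ₘ g ≤ f' ⊗ₘ g' :=
  (M.tensor_continuous X X' Y Y').monotone (a := (f, g)) (b := (f', g')) ⟨h, h'⟩

theorem desc_le {X Y Z : M.L} {f f' : X ⟶ Z} {g g' : Y ⟶ Z} (h : f ≤ f') (h' : g ≤ g') :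
    coprod.desc f g ≤ coprod.desc f' g' :=
  (M.desc_continuous_L X Y Z).monotone (a := (f, g)) (b := (f', g')) ⟨h, h'⟩

theorem coprod_map_le {X X' Y Y' : M.L} {f f' : X ⟶ X'} {g g' : Y ⟶ Y'} (h : f ≤ f')
    (h' : g ≤ g') : coprod.map f g ≤ coprod.map f' g' := by
  simp only [coprod_map_eq_desc]
  exact desc_le (comp_mono h le_rfl) (comp_mono h' le_rfl)

theorem lolliMap_le {X X' Y Y' : M.L} {f f' : X' ⟶ X} {g g' : Y ⟶ Y'} (h : f ≤ f')
    (h' : g ≤ g') : M.lolliMap f g ≤ M.lolliMap f' g' :=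
  (M.ihom_continuous X X' Y Y').monotone (a := (f, g)) (b := (f', g')) ⟨h, h'⟩

theorem bang_map_le {X Y : M.L} {f f' : X ⟶ Y} (h : f ≤ f') :
    M.bangFunctor.map f ≤ M.bangFunctor.map f' := map_mono M.F (map_mono M.G h)

/-! ## The zero object -/

/-- By closedness `X ⊗ -` is a left adjoint, hence preserves initial objects. -/
theorem subsingleton_of_isInitial_tensor {X Y Z : M.L} (h : IsInitial Y) (f g : X ⊗ Y ⟶ Z) :
    f = g :=
  (h.isInitialObj (tensorLeft X) _).hom_ext f g

theorem subsingleton_of_isInitial_tensor' {X Y Z : M.L} (h : IsInitial X) (f g : X ⊗ Y ⟶ Z) :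
    f = g := by
  rw [← cancel_epi (β_ Y X).hom]
  exact subsingleton_of_isInitial_tensor h _ _

/-- The initial object of a symmetric monoidal closed category with e-initial object is terminal. -/
theorem to_initial_unique {X : M.L} (f g : X ⟶ ⊥_ M.L) : f = g := by
  -- By the exchange law, `k ⊗ I` followed by `0 ⊗ p` factors through the initial object `X ⊗ 0`,
  -- and so does not depend on `k`.
  let p : 𝟙_ M.L ⟶ ⊥_ M.L := proj (M.eInitial _)
  have h : ∀ k : X ⟶ ⊥_ M.L, k ▷ 𝟙_ M.L ≫ (⊥_ M.L) ◁ p = X ◁ p ≫ k ▷ (⊥_ M.L) :=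
    fun k => (whisker_exchange k p).symm
  have hk : f ▷ 𝟙_ M.L ≫ (⊥_ M.L) ◁ p = g ▷ 𝟙_ M.L ≫ (⊥_ M.L) ◁ p := by
    rw [h, h]
    congr 1
    exact subsingleton_of_isInitial_tensor initialIsInitial _ _
  -- Nothing is lost by composing with `0 ⊗ p`: its source `0 ⊗ I` is initial too, so the map back
  -- along `0 ⟶ I` undoes it.
  have h0 : ∀ k : X ⟶ ⊥_ M.L, k = (ρ_ X).inv ≫ (k ▷ 𝟙_ M.L ≫ (⊥_ M.L) ◁ p) ≫
      (⊥_ M.L) ◁ initial.to _ ≫ (ρ_ (⊥_ M.L)).hom := by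
    intro k
    have : (⊥_ M.L) ◁ p ≫ (⊥_ M.L) ◁ initial.to (𝟙_ M.L) ≫ (ρ_ (⊥_ M.L)).hom =
        (ρ_ (⊥_ M.L)).hom := subsingleton_of_isInitial_tensor' initialIsInitial _ _
    simp only [Category.assoc]
    rw [this]
    simp
  rw [h0 f, h0 g, hk]

-- Since `0` is both initial and terminal, the choice of maps to and from it is immaterial. This
-- makes `⊥` absorbing under composition.
variable (M) in
theorem bot_eq {X Y : M.L} (f : X ⟶ ⊥_ M.L) (g : ⊥_ M.L ⟶ Y) : f ≫ g = M.bot X Y := by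
  rw [bot, to_initial_unique f (proj (M.eInitial X)), initialIsInitial.hom_ext g (initial.to Y)]

@[simp]
theorem bot_comp {X Y Z : M.L} (f : Y ⟶ Z) : M.bot X Y ≫ f = M.bot X Z := by
  rw [bot, Category.assoc, bot_eq]

@[simp]
theorem comp_bot {X Y Z : M.L} (f : X ⟶ Y) : f ≫ M.bot Y Z = M.bot X Z := by
  rw [bot, ← Category.assoc, bot_eq]

/-- The composite of `f` with the deflation `X ⟶ 0 ⟶ X`, which lies below the identity, is `⊥`. -/
theorem bot_le {X Y : M.L} (f : X ⟶ Y) : M.bot X Y ≤ f := by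
  have h := comp_mono (proj_spec (M.eInitial X)).proj_emb (le_refl f)
  rwa [Category.id_comp, Category.assoc, bot_eq] at h

theorem eq_bot_of_le {X Y : M.L} {f : X ⟶ Y} (h : f ≤ M.bot X Y) : f = M.bot X Y :=
  le_antisymm h (bot_le f)

@[simp] theorem bot_whiskerRight {X Y Z : M.L} : M.bot X Y ▷ Z = M.bot (X ⊗ Z) (Y ⊗ Z) := by
  have h : initial.to Y ▷ Z = (M.bot _ (⊥_ M.L)) ≫ initial.to _ :=
    subsingleton_of_isInitial_tensor' initialIsInitial _ _
  rw [bot, comp_whiskerRight, h, bot_comp, comp_bot]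

@[simp] theorem whiskerLeft_bot {X Y Z : M.L} : Z ◁ M.bot X Y = M.bot (Z ⊗ X) (Z ⊗ Y) := by
  have h : Z ◁ initial.to Y = (M.bot _ (⊥_ M.L)) ≫ initial.to _ :=
    subsingleton_of_isInitial_tensor initialIsInitial _ _
  rw [bot, whiskerLeft_comp, h, bot_comp, comp_bot]

@[simp] theorem bot_tensor {X Y X' Y' : M.L} (f : X' ⟶ Y') :
    M.bot X Y ⊗ₘ f = M.bot (X ⊗ X') (Y ⊗ Y') := by
  rw [MonoidalCategory.tensorHom_def, bot_whiskerRight, bot_comp]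

@[simp] theorem tensor_bot {X Y X' Y' : M.L} (f : X' ⟶ Y') :
    f ⊗ₘ M.bot X Y = M.bot (X' ⊗ X) (Y' ⊗ Y) := by
  rw [MonoidalCategory.tensorHom_def, whiskerLeft_bot, comp_bot]

theorem IsSup.ne_bot {X Y : M.L} {f : ℕ → (X ⟶ Y)} {a : X ⟶ Y} (h : IsSup f a) (k : ℕ)
    (hk : f k ≠ M.bot X Y) : a ≠ M.bot X Y := by
  rintro rfl
  exact hk (eq_bot_of_le (h.le k))

/-- If `⊥` occurred cofinally, monotonicity would make every term `⊥`, and then the supremum as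
well. -/
theorem IsSup.exists_ne_bot {X Y : M.L} {f : ℕ → (X ⟶ Y)} {a : X ⟶ Y} (h : IsSup f a)
    (ha : a ≠ M.bot X Y) : ∃ k, ∀ n, k ≤ n → f n ≠ M.bot X Y := by
  by_contra! hk
  refine ha (eq_bot_of_le (h.le_of_forall fun k => ?_))
  obtain ⟨n, hn, h1⟩ := hk k
  exact h1 ▸ h.mono hn

/-! ## Global elements of tensor products -/

/-- The element `x ⊗ y : I ⟶ X ⊗ Y` formed from elements `x : I ⟶ X` and `y : I ⟶ Y`. -/
def pairElt {X Y : M.L} (x : 𝟙_ M.L ⟶ X) (y : 𝟙_ M.L ⟶ Y) : 𝟙_ M.L ⟶ X ⊗ Y :=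
  (λ_ (𝟙_ M.L)).inv ≫ (x ⊗ₘ y)

infixr:72 " ⊙ " => pairElt

@[simp]
theorem pairElt_tensor {X Y X' Y' : M.L} (x : 𝟙_ M.L ⟶ X) (y : 𝟙_ M.L ⟶ Y) (f : X ⟶ X')
    (g : Y ⟶ Y') : (x ⊙ y) ≫ (f ⊗ₘ g) = (x ≫ f) ⊙ (y ≫ g) := by
  simp [pairElt]

@[simp]
theorem pairElt_tensor_assoc {X Y X' Y' Z : M.L} (x : 𝟙_ M.L ⟶ X) (y : 𝟙_ M.L ⟶ Y) (f : X ⟶ X')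
    (g : Y ⟶ Y') (k : X' ⊗ Y' ⟶ Z) :
    (x ⊙ y) ≫ (f ⊗ₘ g) ≫ k = ((x ≫ f) ⊙ (y ≫ g)) ≫ k := by
  rw [← Category.assoc, pairElt_tensor]

@[simp]
theorem pairElt_whiskerLeft {X Y Y' : M.L} (x : 𝟙_ M.L ⟶ X) (y : 𝟙_ M.L ⟶ Y)
    (g : Y ⟶ Y') : (x ⊙ y) ≫ X ◁ g = x ⊙ (y ≫ g) := by
  rw [← id_tensorHom, pairElt_tensor, Category.comp_id]

@[simp]
theorem pairElt_whiskerLeft_assoc {X Y Y' Z : M.L} (x : 𝟙_ M.L ⟶ X) (y : 𝟙_ M.L ⟶ Y)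
    (g : Y ⟶ Y') (k : X ⊗ Y' ⟶ Z) :
    (x ⊙ y) ≫ X ◁ g ≫ k = (x ⊙ (y ≫ g)) ≫ k := by
  rw [← Category.assoc, pairElt_whiskerLeft]

@[simp]
theorem pairElt_whiskerRight {X Y X' : M.L} (x : 𝟙_ M.L ⟶ X) (y : 𝟙_ M.L ⟶ Y)
    (f : X ⟶ X') : (x ⊙ y) ≫ f ▷ Y = (x ≫ f) ⊙ y := by
  rw [← tensorHom_id, pairElt_tensor, Category.comp_id]

@[simp]
theorem pairElt_whiskerRight_assoc {X Y X' Z : M.L} (x : 𝟙_ M.L ⟶ X) (y : 𝟙_ M.L ⟶ Y)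
    (f : X ⟶ X') (k : X' ⊗ Y ⟶ Z) :
    (x ⊙ y) ≫ f ▷ Y ≫ k = ((x ≫ f) ⊙ y) ≫ k := by
  rw [← Category.assoc, pairElt_whiskerRight]

@[simp]
theorem pairElt_braiding {X Y : M.L} (x : 𝟙_ M.L ⟶ X) (y : 𝟙_ M.L ⟶ Y) :
    (x ⊙ y) ≫ (β_ X Y).hom = y ⊙ x := by
  simp [pairElt, unitors_inv_equal]

@[simp]
theorem pairElt_braiding_assoc {X Y Z : M.L} (x : 𝟙_ M.L ⟶ X) (y : 𝟙_ M.L ⟶ Y) (k : Y ⊗ X ⟶ Z) :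
    (x ⊙ y) ≫ (β_ X Y).hom ≫ k = (y ⊙ x) ≫ k := by
  rw [← Category.assoc, pairElt_braiding]

@[simp]
theorem pairElt_associator {X Y Z : M.L} (x : 𝟙_ M.L ⟶ X) (y : 𝟙_ M.L ⟶ Y) (z : 𝟙_ M.L ⟶ Z) :
    ((x ⊙ y) ⊙ z) ≫ (α_ X Y Z).hom = x ⊙ (y ⊙ z) := by
  have h1 : (x ⊙ y) ⊙ z =
      (λ_ (𝟙_ M.L)).inv ≫ (λ_ (𝟙_ M.L)).inv ▷ 𝟙_ M.L ≫ ((x ⊗ₘ y) ⊗ₘ z) := by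
    rw [pairElt, pairElt, ← tensorHom_id, tensorHom_comp_tensorHom, Category.id_comp]
  have h2 : x ⊙ (y ⊙ z) =
      (λ_ (𝟙_ M.L)).inv ≫ 𝟙_ M.L ◁ (λ_ (𝟙_ M.L)).inv ≫ (x ⊗ₘ (y ⊗ₘ z)) := by
    rw [pairElt, pairElt, ← id_tensorHom, tensorHom_comp_tensorHom, Category.id_comp]
  rw [h1, h2, Category.assoc, Category.assoc, associator_naturality]
  monoidal

@[simp]
theorem pairElt_associator_assoc {X Y Z W : M.L} (x : 𝟙_ M.L ⟶ X) (y : 𝟙_ M.L ⟶ Y) (z : 𝟙_ M.L ⟶ Z)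
    (k : X ⊗ Y ⊗ Z ⟶ W) :
    ((x ⊙ y) ⊙ z) ≫ (α_ X Y Z).hom ≫ k = (x ⊙ (y ⊙ z)) ≫ k := by
  rw [← Category.assoc, pairElt_associator]

@[simp]
theorem pairElt_associator_inv {X Y Z : M.L} (x : 𝟙_ M.L ⟶ X) (y : 𝟙_ M.L ⟶ Y)
    (z : 𝟙_ M.L ⟶ Z) : (x ⊙ (y ⊙ z)) ≫ (α_ X Y Z).inv = (x ⊙ y) ⊙ z := by
  rw [← pairElt_associator, Category.assoc, Iso.hom_inv_id, Category.comp_id]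

@[simp]
theorem pairElt_associator_inv_assoc {X Y Z W : M.L} (x : 𝟙_ M.L ⟶ X) (y : 𝟙_ M.L ⟶ Y) (z : 𝟙_ M.L ⟶ Z)
    (k : (X ⊗ Y) ⊗ Z ⟶ W) :
    (x ⊙ (y ⊙ z)) ≫ (α_ X Y Z).inv ≫ k = ((x ⊙ y) ⊙ z) ≫ k := by
  rw [← Category.assoc, pairElt_associator_inv]

@[simp]
theorem pairElt_leftUnitor {X : M.L} (x : 𝟙_ M.L ⟶ X) : (𝟙 _ ⊙ x) ≫ (λ_ X).hom = x := by
  simp [pairElt]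

@[simp]
theorem pairElt_rightUnitor {X : M.L} (x : 𝟙_ M.L ⟶ X) : (x ⊙ 𝟙 _) ≫ (ρ_ X).hom = x := by
  simp [pairElt, unitors_inv_equal]

@[simp]
theorem pairElt_tensorμ {X Y Z W : M.L} (x : 𝟙_ M.L ⟶ X) (y : 𝟙_ M.L ⟶ Y) (z : 𝟙_ M.L ⟶ Z)
    (w : 𝟙_ M.L ⟶ W) : ((x ⊙ y) ⊙ (z ⊙ w)) ≫ tensorμ X Y Z W = (x ⊙ z) ⊙ (y ⊙ w) := by
  simp [tensorμ]

@[simp] theorem bot_pairElt {X Y : M.L} (y : 𝟙_ M.L ⟶ Y) :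
    M.bot (𝟙_ M.L) X ⊙ y = M.bot _ _ := by simp [pairElt]

@[simp] theorem pairElt_bot {X Y : M.L} (x : 𝟙_ M.L ⟶ X) :
    x ⊙ M.bot (𝟙_ M.L) Y = M.bot _ _ := by simp [pairElt]

theorem isSup_pairElt {X Y : M.L} {f : ℕ → (𝟙_ M.L ⟶ X)} {g : ℕ → (𝟙_ M.L ⟶ Y)} {a : 𝟙_ M.L ⟶ X}
    {b : 𝟙_ M.L ⟶ Y} (hf : IsSup f a) (hg : IsSup g b) : IsSup (fun n => f n ⊙ g n) (a ⊙ b) :=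
  (isSup_tensor hf hg).comp_left _

@[simp] theorem inl_eq_bot_iff {X Y Z : M.L} {f : Z ⟶ X} :
    f ≫ (coprod.inl : X ⟶ X ⨿ Y) = M.bot _ _ ↔ f = M.bot _ _ := by
  refine ⟨fun h => ?_, fun h => by rw [h, bot_comp]⟩
  have := congrArg (· ≫ coprod.desc (𝟙 X) (M.bot Y X)) h
  simpa [coprod.inl_desc] using this

@[simp] theorem inr_eq_bot_iff {X Y Z : M.L} {f : Z ⟶ Y} :
    f ≫ (coprod.inr : Y ⟶ X ⨿ Y) = M.bot _ _ ↔ f = M.bot _ _ := by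
  refine ⟨fun h => ?_, fun h => by rw [h, bot_comp]⟩
  have := congrArg (· ≫ coprod.desc (M.bot X Y) (𝟙 Y)) h
  simpa [coprod.inr_desc] using this

theorem pairElt_reflects (hM : M.ComputationallyAdequate) {X Y : M.L} {x x' : 𝟙_ M.L ⟶ X}
    {y y' : 𝟙_ M.L ⟶ Y} (hx : x ≠ M.bot _ _) (hy : y ≠ M.bot _ _) (hx' : x' ≠ M.bot _ _)
    (hy' : y' ≠ M.bot _ _) (h : x ⊙ y ≤ x' ⊙ y') : x ≤ x' ∧ y ≤ y' := by
  refine hM.tensor_reflects x x' y y' hx hx' hy hy' ?_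
  have := comp_mono (le_refl (λ_ (𝟙_ M.L)).hom) h
  simpa [pairElt] using this

theorem pairElt_injective (hM : M.ComputationallyAdequate) {X Y : M.L} {x x' : 𝟙_ M.L ⟶ X}
    {y y' : 𝟙_ M.L ⟶ Y} (hx : x ≠ M.bot _ _) (hy : y ≠ M.bot _ _) (hx' : x' ≠ M.bot _ _)
    (hy' : y' ≠ M.bot _ _) (h : x ⊙ y = x' ⊙ y') : x = x' ∧ y = y' := by
  have h1 := pairElt_reflects hM hx hy hx' hy' h.le
  have h2 := pairElt_reflects hM hx' hy' hx hy h.symm.le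
  exact ⟨le_antisymm h1.1 h2.1, le_antisymm h1.2 h2.2⟩

/-- Adequacy compares only tensors of non-`⊥` elements and says nothing directly about `⊥`. The way
round is to inject `x` into both summands of `X + X`: if `x ⊙ y` were `⊥`, both injections would
have tensor `⊥` with `y`, hence be equal by injectivity, and `[id, ⊥]` would give `x = ⊥`. -/
theorem pairElt_ne_bot (hM : M.ComputationallyAdequate) {X Y : M.L} {x : 𝟙_ M.L ⟶ X}
    {y : 𝟙_ M.L ⟶ Y} (hx : x ≠ M.bot _ _) (hy : y ≠ M.bot _ _) : x ⊙ y ≠ M.bot _ _ := by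
  intro h
  have e1 : (x ≫ (coprod.inl : X ⟶ X ⨿ X)) ⊙ y = M.bot _ _ := by
    rw [← pairElt_whiskerRight, h, bot_comp]
  have e2 : (x ≫ (coprod.inr : X ⟶ X ⨿ X)) ⊙ y = M.bot _ _ := by
    rw [← pairElt_whiskerRight, h, bot_comp]
  have e := (pairElt_injective hM (by simpa using hx) hy (by simpa using hx) hy
    (e1.trans e2.symm)).1
  have := congrArg (· ≫ coprod.desc (𝟙 X) (M.bot X X)) e
  exact hx (by simpa [coprod.inl_desc, coprod.inr_desc] using this)

end CPOLNLModel

end LNLFPC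

namespace LNLFPC
open CategoryTheory CategoryTheory.Limits OmegaCompletePartialOrder MonoidalCategory

/-! ## Colimits of chains of embeddings -/

/-- The cocone `c` lifts to a colimit cocone of the wide subcategory that the inclusion sends back
to `c`. Hence colimits of chains in `L_e` and `C_pe` may be computed in `L` and `C`. -/
theorem preservesColimit_wide {C : Type u} [Category.{v} C] {W : MorphismProperty C}
    [W.IsMultiplicative] (D : ℕ ⥤ WideSubcategory W)
    {c : Cocone (D ⋙ wideSubcategoryInclusion W)} (hc : IsColimit c)
    (hι : ∀ j, W (c.ι.app j))
    (hdesc : ∀ s : Cocone (D ⋙ wideSubcategoryInclusion W), (∀ j, W (s.ι.app j)) →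
      W (hc.desc s)) : PreservesColimit D (wideSubcategoryInclusion W) := by
  let I := wideSubcategoryInclusion W
  let c' : Cocone D := ⟨⟨c.pt⟩, ⟨fun j => ⟨c.ι.app j, hι j⟩, fun i j f =>
    WideSubcategory.hom_ext _ (c.ι.naturality f)⟩⟩
  have hc' : IsColimit c' :=
    { desc := fun s => ⟨hc.desc (I.mapCocone s), hdesc _ fun j => (s.ι.app j).property⟩
      fac := fun s j => WideSubcategory.hom_ext _ (hc.fac (I.mapCocone s) j)
      uniq := fun s m hm => WideSubcategory.hom_ext _
        (hc.uniq (I.mapCocone s) m.hom fun j => congrArg InducedWideCategory.Hom.hom (hm j)) }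
  exact preservesColimit_of_preserves_colimit_cocone hc' hc

namespace CPOLNLModel

variable {M : CPOLNLModel.{v, u}}

instance (D : ℕ ⥤ M.Le) : PreservesColimit D (wideSubcategoryInclusion (embeddings M.L)) := by
  have hD : IsChainOver (embeddings M.L) (D ⋙ wideSubcategoryInclusion _) :=
    fun _ _ f => (D.map f).property
  have := M.hasColimit_L _ hD
  exact preservesColimit_wide D (colimit.isColimit (D ⋙ wideSubcategoryInclusion _))
    (fun j => ⟨_, isEPPair_ι hD (colimit.isColimit _) j⟩)
    (fun s hs => embedding_desc hD (colimit.isColimit _) s hs)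

instance (D : ℕ ⥤ M.Cpe) : PreservesColimit D (wideSubcategoryInclusion (preEmbeddings M.F)) := by
  have hD : IsChainOver (preEmbeddings M.F) (D ⋙ wideSubcategoryInclusion _) :=
    fun _ _ f => (D.map f).property
  have := M.hasColimit_C _ hD
  have hF : IsChainOver (embeddings M.L) ((D ⋙ wideSubcategoryInclusion _) ⋙ M.F) :=
    fun _ _ f => hD f
  have := M.adj.leftAdjoint_preservesColimits
  let hc := colimit.isColimit (D ⋙ wideSubcategoryInclusion (preEmbeddings M.F))
  have hFc : IsColimit (M.F.mapCocone (colimit.cocone _)) := isColimitOfPreserves M.F hc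
  refine preservesColimit_wide D hc (fun j => ⟨_, isEPPair_ι hF hFc j⟩) (fun s hs => ?_)
  have h := embedding_desc hF hFc (M.F.mapCocone s) hs
  rwa [show hFc.desc (M.F.mapCocone s) = M.F.map (hc.desc s) from
    hFc.hom_ext fun j => by
      rw [hFc.fac]
      exact (congrArg M.F.map (hc.fac s j)).symm.trans (M.F.map_comp _ _)] at h

/-- The limit–colimit coincidence: the deflations are the idempotents of `colimChain`, whose
supremum is the identity. Exhaustion in this sense replaces universal properties in what follows. -/
theorem isSup_defl_of_isColimit (D : ℕ ⥤ M.Le) (c : Cocone D)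
    (hc : IsColimit ((wideSubcategoryInclusion (embeddings M.L)).mapCocone c)) :
    IsSup (fun k => defl (c.ι.app k)) (𝟙 c.pt.obj) := by
  have hD : IsChainOver (embeddings M.L) (D ⋙ wideSubcategoryInclusion _) :=
    fun _ _ f => (D.map f).property
  have h := isSup_ωSup (colimChain hD hc)
  exact h.congr (fun k => defl_eq _ (isEPPair_ι hD hc k)) (ωSup_colimChain hD hc).symm

/-- The members of a chain of embeddings exhaust its colimit. -/
theorem isSup_defl_ι (D : ℕ ⥤ M.Le) :
    IsSup (fun k => defl (colimit.ι D k)) (𝟙 (colimit D).obj) :=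
  isSup_defl_of_isColimit D (colimit.cocone D) (isColimitOfPreserves _ (colimit.isColimit D))

/-- `F` preserves the colimits of chains of pre-embeddings. -/
theorem isSup_defl_Fpe_ι (D : ℕ ⥤ M.Cpe) :
    IsSup (fun k => defl (M.Fpe.map (colimit.ι D k))) (𝟙 (M.Fpe.obj (colimit D)).obj) := by
  have := M.adj.leftAdjoint_preservesColimits
  have hc : IsColimit (M.F.mapCocone
      ((wideSubcategoryInclusion (preEmbeddings M.F)).mapCocone (colimit.cocone D))) :=
    isColimitOfPreserves M.F (isColimitOfPreserves _ (colimit.isColimit D))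
  exact isSup_defl_of_isColimit (D ⋙ M.Fpe) (M.Fpe.mapCocone (colimit.cocone D)) hc

theorem colimit_hom_ext (D : ℕ ⥤ M.Le) {W : M.L} {f g : (colimit D).obj ⟶ W}
    (h : ∀ k, (colimit.ι D k).hom ≫ f = (colimit.ι D k).hom ≫ g) : f = g :=
  hom_ext_of_isSup_defl _ (isSup_defl_ι D) h

end CPOLNLModel

/-! ## Initial sequences -/

section Sequences

variable {K : Type u} [Category.{v} K] [HasInitial K] {A : Type u} [Category.{v} A]

/-- The morphism induced by `f` between members of the initial sequences of `T(a, -)` and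
`T(b, -)`. -/
noncomputable abbrev seqParam (T : A × K ⥤ K) {a b : A} (f : a ⟶ b) (k : ℕ) :
    seqObj ((Functor.curry.obj T).obj a) k ⟶ seqObj ((Functor.curry.obj T).obj b) k :=
  seqTransApp ((Functor.curry.obj T).map f) k

theorem seqParam_succ (T : A × K ⥤ K) {a b : A} (f : a ⟶ b) (k : ℕ) :
    seqParam T f (k + 1) = T.map ((f, seqParam T f k) :
      (a, seqObj ((Functor.curry.obj T).obj a) k) ⟶ (b, seqObj ((Functor.curry.obj T).obj b) k)) := by
  have h : seqParam T f (k + 1) = ((Functor.curry.obj T).obj a).map (seqParam T f k) ≫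
    ((Functor.curry.obj T).map f).app _ := rfl
  rw [h]
  simp [← T.map_comp]
  rfl

variable [HasColimitsOfShape ℕ K]

/-- The morphism from a member of the initial sequence to its colimit. -/
noncomputable def seqι (T : K ⥤ K) (k : ℕ) : seqObj T k ⟶ (Y K).obj T := colimit.ι (seq T) k

theorem seqMap_seqι (T : K ⥤ K) (k : ℕ) : seqMap T k ≫ seqι T (k + 1) = seqι T k := by
  have := colimit.w (seq T) (homOfLE (Nat.le_succ k))
  rwa [Functor.ofSequence_map_homOfLE_succ] at this

theorem seqι_unroll (T : K ⥤ K) (k : ℕ) : seqι T (k + 1) ≫ unroll T = T.map (seqι T k) := by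
  have h : seqι T (k + 1) ≫ unroll T = seqMap T (k + 1) ≫ T.map (seqι T (k + 1)) := by
    change colimit.ι (seq T) (k + 1) ≫ colimMap (seqShift T) ≫ colimit.post (seq T) T = _
    rw [ι_colimMap_assoc, colimit.ι_post]
    rfl
  rw [h, ← seqMap_seqι T k, T.map_comp]
  rfl

theorem seqι_Y_map {T H : K ⥤ K} (τ : T ⟶ H) (k : ℕ) :
    seqι T k ≫ (Y K).map τ = seqTransApp τ k ≫ seqι H k := ι_colimMap _ _

/-- The morphism from the initial sequence of `T(a, -)` to the colimit of that of `T(b, -)`. -/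
noncomputable def seqTo (T : A × K ⥤ K) {a b : A} (f : a ⟶ b) (k : ℕ) :
    seqObj ((Functor.curry.obj T).obj a) k ⟶ (Y K).obj ((Functor.curry.obj T).obj b) :=
  seqParam T f k ≫ seqι ((Functor.curry.obj T).obj b) k

theorem seqι_dagger_map (T : A × K ⥤ K) {a b : A} (f : a ⟶ b) (k : ℕ) :
    seqι ((Functor.curry.obj T).obj a) k ≫ (dagger T).map f = seqTo T f k :=
  seqι_Y_map _ k

/-- This gives a recursion in `k` for the restriction of `(dagger T).map f` to the `k`-th member,
one step of which is `T` applied to the previous one. Statements about recursive types are proved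
along it. -/
theorem seqTo_unroll (T : A × K ⥤ K) {a b : A} (f : a ⟶ b) (k : ℕ) :
    seqTo T f (k + 1) ≫ unroll ((Functor.curry.obj T).obj b) =
      T.map ((f, seqTo T f k) : (a, seqObj ((Functor.curry.obj T).obj a) k) ⟶
        (b, (Y K).obj ((Functor.curry.obj T).obj b))) := by
  rw [seqTo, Category.assoc, seqι_unroll, seqParam_succ]
  refine (T.map_comp _ _).symm.trans (congrArg T.map ?_)
  exact Prod.ext (Category.comp_id f) rfl

end Sequences

namespace CPOLNLModel

variable {M : CPOLNLModel.{v, u}}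

/-! ## Continuity of the interpretation of types -/

theorem _root_.LNLFPC.IsSup.defl_comp {X Y : M.Le} {Z : ℕ → M.Le} {t : ∀ k, Z k ⟶ X}
    (h : IsSup (fun k => defl (t k)) (𝟙 X.obj)) (e : X ⟶ Y) :
    IsSup (fun k => defl (t k ≫ e)) (defl e) := by
  simp only [LNLFPC.defl_comp]
  have h := (h.comp_right e.hom).comp_left (proj e.property)
  rwa [Category.id_comp] at h

/-- `T` preserves exhausting sequences of embeddings. -/
def PreservesExhaustion {n : ℕ} (T : (Fin n → M.Le) ⥤ M.Le) : Prop :=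
  ∀ (X : ℕ → Fin n → M.Le) (Z : Fin n → M.Le) (e : ∀ k, X k ⟶ Z),
    (∀ i, IsSup (fun k => defl (e k i)) (𝟙 (Z i).obj)) →
      IsSup (fun k => defl (T.map (e k))) (𝟙 (T.obj Z).obj)

theorem PreservesExhaustion.curry {n : ℕ} {T : (Fin (n + 1) → M.Le) ⥤ M.Le}
    (hT : PreservesExhaustion T) {X : ℕ → Fin n → M.Le} {Z : Fin n → M.Le} (e : ∀ k, X k ⟶ Z)
    {X' : ℕ → M.Le} {Z' : M.Le} (e' : ∀ k, X' k ⟶ Z')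
    (h : ∀ i, IsSup (fun k => defl (e k i)) (𝟙 (Z i).obj))
    (h' : IsSup (fun k => defl (e' k)) (𝟙 Z'.obj)) :
    IsSup (fun k => defl ((consF M.Le n ⋙ T).map ((e k, e' k) : (X k, X' k) ⟶ (Z, Z'))))
      (𝟙 ((consF M.Le n ⋙ T).obj (Z, Z')).obj) := by
  refine hT _ _ _ fun i => ?_
  induction i using Fin.cases with
  | zero => exact h'
  | succ i => exact h i

/-- On the members with index `k + 1`, `unroll` is `T` applied to the `k`-th coprojection. The
coprojections exhaust the colimit, so these images exhaust the target. -/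
theorem PreservesExhaustion.isIso_unroll {n : ℕ} {T : (Fin (n + 1) → M.Le) ⥤ M.Le}
    (hT : PreservesExhaustion T) (Z : Fin n → M.Le) :
    IsIso (unroll ((Functor.curry.obj (consF M.Le n ⋙ T)).obj Z)) := by
  refine isIso_of_isSup_defl _ (fun k => seqι _ (k + 1)) ?_
  refine (hT.curry (fun _ => 𝟙 Z) _ (fun i => ?_) (isSup_defl_ι _)).congr
    (fun k => congrArg defl (seqι_unroll _ k)) rfl
  exact (IsSup.const (𝟙 (Z i).obj)).congr (fun _ => defl_id _) rfl

/-- Consider the deflations of the `m`-th member of the sequence at `X k`. For fixed `k` their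
supremum over `m` is the deflation of the map induced by `e k`. For fixed `m` the supremum over `k`
is that of the `m`-th coprojection, by induction on `m`. Suprema commute, and the coprojections
exhaust the colimit. -/
theorem PreservesExhaustion.dagger {n : ℕ} {T : (Fin (n + 1) → M.Le) ⥤ M.Le}
    (hT : PreservesExhaustion T) : PreservesExhaustion (dagger (consF M.Le n ⋙ T)) := by
  intro X Z e he
  let H := consF M.Le n ⋙ T
  have hs : ∀ m, IsSup (fun k => defl (seqParam H (e k) m)) (𝟙 _) := by
    intro m
    induction m with
    | zero =>
      exact (IsSup.const (𝟙 _)).congr (fun _ => defl_id _) rfl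
    | succ m ih =>
      exact (hT.curry e _ he ih).congr (fun k => congrArg defl (seqParam_succ H (e k) m)) rfl
  let d (k : ℕ) : (Y M.Le).obj ((Functor.curry.obj H).obj (X k)) ⟶
    (Y M.Le).obj ((Functor.curry.obj H).obj Z) := (LNLFPC.dagger H).map (e k)
  refine IsSup.interchange (a := fun k m => defl (seqι _ m ≫ d k))
    (c := fun m => defl (seqι ((Functor.curry.obj H).obj Z) m)) (fun k => ?_) (fun m => ?_)
    (isSup_defl_ι _)
  · exact (isSup_defl_ι (seq ((Functor.curry.obj H).obj (X k)))).defl_comp (d k)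
  · exact ((hs m).defl_comp (seqι ((Functor.curry.obj H).obj Z) m)).congr
      (fun k => congrArg defl (seqι_dagger_map H (e k) m)) rfl

theorem defl_sumE {X Y : M.Le × M.Le} (e : X ⟶ Y) :
    defl (M.sumE.map e) = coprod.map (defl e.1) (defl e.2) :=
  (defl_eq _ (isEPPair_coprod (proj_spec e.1.property) (proj_spec e.2.property))).trans
    (by simp only [sumE, defl, coprod.map_map])

theorem defl_tensorE {X Y : M.Le × M.Le} (e : X ⟶ Y) :
    defl (M.tensorE.map e) = defl e.1 ⊗ₘ defl e.2 :=
  (defl_eq _ (isEPPair_tensor (proj_spec e.1.property) (proj_spec e.2.property))).trans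
    (by simp only [tensorE, defl, tensorHom_comp_tensorHom])

theorem defl_lolliE {X Y : M.Le × M.Le} (e : X ⟶ Y) :
    defl (M.lolliE.map e) = M.lolliMap (defl e.1) (defl e.2) :=
  (defl_eq _ (isEPPair_lolli (proj_spec e.1.property) (proj_spec e.2.property))).trans
    (lolliMap_comp _ _ _ _).symm

theorem defl_bang {X Y : M.Le} (e : X ⟶ Y) :
    defl (M.Fpe.map (M.Gpe.map e)) = M.bangFunctor.map (defl e) :=
  (defl_eq _ (((proj_spec e.property).map M.G).map M.F)).trans (M.bangFunctor.map_comp _ _).symm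

/-- Deflations commute with every connective, including `⊸`, whose action on embeddings takes the
projection in the contravariant place, and connectives are Scott continuous. This makes `unfold` an
isomorphism. -/
theorem preservesExhaustion_ty {n : ℕ} (A : Ty n) : PreservesExhaustion (M.ty A) := by
  induction A with
  | var i => exact fun X Z e h => h i
  | sum A B hA hB =>
    intro X Z e h
    exact (isSup_coprod (hA X Z e h) (hB X Z e h)).congr (fun k => defl_sumE _) (coprod.map_id_id).symm
  | tensor A B hA hB =>
    intro X Z e h
    exact (isSup_tensor (hA X Z e h) (hB X Z e h)).congr (fun k => defl_tensorE _) (id_tensorHom_id _ _).symm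
  | lolli A B hA hB =>
    intro X Z e h
    exact (isSup_lolli (hA X Z e h) (hB X Z e h)).congr (fun k => defl_lolliE _) (lolliMap_id _ _ _).symm
  | bang A hA =>
    intro X Z e h
    exact (isSup_bang (hA X Z e h)).congr (fun k => defl_bang _) (M.bangFunctor.map_id _).symm
  | mu A hA => exact hA.dagger

instance isIso_unroll_ty {n : ℕ} (A : Ty (n + 1)) (Z : Fin n → M.Le) :
    IsIso (unroll ((Functor.curry.obj (consF M.Le n ⋙ M.ty A)).obj Z)) :=
  (preservesExhaustion_ty A).isIso_unroll Z

instance (A : Ty 1) : IsIso (M.unfoldE A) := 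
  @IsIso.comp_isIso _ _ _ _ _ _ _ (isIso_unroll_ty A M.pt)
    (eqToIso (M.obj_inst A A.mu).symm).isIso_hom

@[simp] theorem unfold_fold (A : Ty 1) : M.unfold A ≫ M.fold A = 𝟙 _ := emb_proj _

@[simp] theorem fold_unfold (A : Ty 1) : M.fold A ≫ M.unfold A = 𝟙 _ := proj_hom_isIso _

@[simp] theorem fold_unfold_assoc (A : Ty 1) {Z : M.L} (k : M.Ob (A.inst A.mu) ⟶ Z) :
    M.fold A ≫ M.unfold A ≫ k = k := by rw [← Category.assoc, fold_unfold, Category.id_comp]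

/-! ## The natural transformation `α` is invertible -/

variable (M) in
/-- The initial object of `L_e` is initial in `L`. -/
noncomputable def isInitialLe : IsInitial (⊥_ M.Le).obj := by
  have h : IsInitial (⟨⊥_ M.L⟩ : M.Le) := IsInitial.ofUniqueHom
    (fun X => ⟨initial.to X.obj, M.eInitial _⟩)
    fun _ _ => WideSubcategory.hom_ext _ (initialIsInitial.hom_ext _ _)
  exact initialIsInitial.ofIso
    ((wideSubcategoryInclusion (embeddings M.L)).mapIso (h.uniqueUpToIso initialIsInitial))

theorem bot_Le_hom_ext {Z : M.L} (f g : (⊥_ M.Le).obj ⟶ Z) : f = g :=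
  M.isInitialLe.hom_ext f g

variable (M) in
/-- `F` preserves the initial object of `C_pe`. -/
noncomputable def isInitialFCpe : IsInitial (M.F.obj (⊥_ M.Cpe).obj) := by
  have := M.adj.leftAdjoint_preservesColimits
  have h : IsInitial (⟨⊥_ M.C⟩ : M.Cpe) := IsInitial.ofUniqueHom
    (fun X => ⟨initial.to X.obj, M.preEmbedding_initial _⟩)
    fun _ _ => WideSubcategory.hom_ext _ (initialIsInitial.hom_ext _ _)
  exact IsInitial.isInitialObj M.F _ (initialIsInitial.ofIso
    ((wideSubcategoryInclusion (preEmbeddings M.F)).mapIso (h.uniqueUpToIso initialIsInitial)))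

/-- At index `0` both objects are initial in `L_e`, since `F` is a left adjoint. Each later
component is an image of the preceding one composed with a component of `τ`. -/
theorem isIso_starApp {n : ℕ} {T : (Fin n → M.Le) × M.Le ⥤ M.Le}
    {H : (Fin n → M.Cpe) × M.Cpe ⥤ M.Cpe} (τ : (M.powF n).prod M.Fpe ⋙ T ⟶ H ⋙ M.Fpe)
    (hτ : ∀ X, IsIso (τ.app X)) (Z : Fin n → M.Cpe) (k : ℕ) : IsIso (starApp τ Z k) := by
  induction k with
  | zero =>
    have hF := M.isInitialFCpe
    have h : IsInitial (M.Fpe.obj (⊥_ M.Cpe)) := IsInitial.ofUniqueHom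
      (fun X => ⟨hF.to X.obj, by
        have h1 : hF.to X.obj = (hF.uniqueUpToIso initialIsInitial).hom ≫ initial.to X.obj :=
          hF.hom_ext _ _
        have h2 : embeddings M.L (hF.uniqueUpToIso initialIsInitial).hom :=
          ⟨_, IsEPPair.of_iso _⟩
        rw [h1]
        exact (embeddings M.L).comp_mem _ _ h2 (M.eInitial _)⟩)
      fun _ _ => WideSubcategory.hom_ext _ (hF.hom_ext _ _)
    exact isIso_of_isInitial initialIsInitial h _
  | succ k ih =>
    have := hτ (Z, seqObj ((Functor.curry.obj H).obj Z) k)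
    exact @IsIso.comp_isIso _ _ _ _ _ _ _ (Functor.map_isIso _ _) this

theorem seqι_daggerTrans {n : ℕ} {T : (Fin n → M.Le) × M.Le ⥤ M.Le}
    {H : (Fin n → M.Cpe) × M.Cpe ⥤ M.Cpe} (τ : (M.powF n).prod M.Fpe ⋙ T ⟶ H ⋙ M.Fpe)
    (Z : Fin n → M.Cpe) (k : ℕ) : seqι ((Functor.curry.obj T).obj ((M.powF n).obj Z)) k ≫
      (daggerTrans τ).app Z = starApp τ Z k ≫ M.Fpe.map (seqι ((Functor.curry.obj H).obj Z) k) := by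
  change colimit.ι (seq ((Functor.curry.obj T).obj ((M.powF n).obj Z))) k ≫
    colimMap (star τ Z) ≫ colimit.post (seq ((Functor.curry.obj H).obj Z)) M.Fpe = _
  rw [ι_colimMap_assoc, colimit.ι_post]
  rfl

theorem defl_isIso_comp {X Y Z : M.Le} (e : X ⟶ Y) [IsIso e] (f : Y ⟶ Z) :
    defl (e ≫ f) = defl f := by
  have h : defl e = 𝟙 _ := proj_hom_isIso _
  rw [defl_comp, h, Category.id_comp]
  rfl

/-- Restricted to the `k`-th member it is an isomorphism followed by `F` of a coprojection.
Preservation of colimits by `F` makes these images exhaust the target. -/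
theorem isIso_daggerTrans_app {n : ℕ} {T : (Fin n → M.Le) × M.Le ⥤ M.Le}
    {H : (Fin n → M.Cpe) × M.Cpe ⥤ M.Cpe} (τ : (M.powF n).prod M.Fpe ⋙ T ⟶ H ⋙ M.Fpe)
    (hτ : ∀ X, IsIso (τ.app X)) (Z : Fin n → M.Cpe) : IsIso ((daggerTrans τ).app Z) := by
  refine isIso_of_isSup_defl _ (fun k => seqι _ k) ?_
  refine (isSup_defl_Fpe_ι (seq ((Functor.curry.obj H).obj Z))).congr (fun k => ?_) rfl
  have := isIso_starApp τ hτ Z k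
  exact (congrArg defl (seqι_daggerTrans τ Z k)).trans (defl_isIso_comp _ _)

instance {X Y : M.Le} (e : X ⟶ Y) [h : IsIso e] : IsIso e.hom :=
  ⟨_, emb_proj e, proj_hom_isIso e⟩

/-- The transformation from which `α` at a recursive type is obtained. -/
noncomputable abbrev αCons {n : ℕ} (P : Ty (n + 1)) (h : P.NonLinear) :
    (M.powF n).prod M.Fpe ⋙ consF M.Le n ⋙ M.ty P ⟶ (consF M.Cpe n ⋙ M.nl P h) ⋙ M.Fpe :=
  Functor.whiskerRight (M.consComparison n) (M.ty P) ≫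
    Functor.whiskerLeft (consF M.Cpe n) (M.α P h)

theorem isIso_αCons_app {n : ℕ} {P : Ty (n + 1)} {h : P.NonLinear}
    (hP : ∀ Z, IsIso ((M.α P h).app Z)) (X : (Fin n → M.Cpe) × M.Cpe) :
    IsIso ((M.αCons P h).app X) := by
  have h1 := hP ((consF M.Cpe _).obj X)
  have h2 : IsIso ((M.consComparison _).app X) := by
    rw [isIso_pi_iff]
    intro i
    induction i using Fin.cases with
    | zero => exact inferInstanceAs (IsIso (𝟙 _))
    | succ i => exact inferInstanceAs (IsIso (𝟙 _))
  exact @IsIso.comp_isIso _ _ _ _ _ _ _ (Functor.map_isIso _ _) h1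

theorem isIso_α_app {n : ℕ} (P : Ty n) (h : P.NonLinear) (Z : Fin n → M.Cpe) :
    IsIso ((M.α P h).app Z) := by
  induction P with
  | var i => exact inferInstanceAs (IsIso (𝟙 (M.Fpe.obj (Z i))))
  | sum P R hP hR =>
    have h1 := hP h.1 Z
    have h2 := hR h.2 Z
    have : IsIso (M.cPe.app ((M.nl P h.1).obj Z, (M.nl R h.2).obj Z)) :=
      isIso_emb_of_isIso _ (M.isIso_coprodComparison _ _)
    have h3 : IsIso ((show ((M.ty P).obj ((M.powF _).obj Z), (M.ty R).obj ((M.powF _).obj Z)) ⟶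
      (M.Fpe.obj ((M.nl P h.1).obj Z), M.Fpe.obj ((M.nl R h.2).obj Z)) from
        ((M.α P h.1).app Z, (M.α R h.2).app Z))) := (isIso_prod_iff _ _).2 ⟨h1, h2⟩
    exact @IsIso.comp_isIso _ _ _ _ _ _ _ (Functor.map_isIso _ _) this
  | tensor P R hP hR =>
    have h1 := hP h.1 Z
    have h2 := hR h.2 Z
    have : IsIso (M.mPe.app ((M.nl P h.1).obj Z, (M.nl R h.2).obj Z)) :=
      isIso_emb_of_isIso _
        (inferInstanceAs (IsIso (Functor.LaxMonoidal.μ M.F _ _)))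
    have h3 : IsIso ((show ((M.ty P).obj ((M.powF _).obj Z), (M.ty R).obj ((M.powF _).obj Z)) ⟶
      (M.Fpe.obj ((M.nl P h.1).obj Z), M.Fpe.obj ((M.nl R h.2).obj Z)) from
        ((M.α P h.1).app Z, (M.α R h.2).app Z))) := (isIso_prod_iff _ _).2 ⟨h1, h2⟩
    exact @IsIso.comp_isIso _ _ _ _ _ _ _ (Functor.map_isIso _ _) this
  | lolli => exact h.elim
  | bang A => exact inferInstanceAs (IsIso (𝟙 _))
  | mu P hP => exact isIso_daggerTrans_app _ (isIso_αCons_app (hP h)) Z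

@[simp] theorem alpha_alphaInv (P : Ty 0) (h : P.NonLinear) :
    M.alpha P h ≫ M.alphaInv P h = 𝟙 _ := emb_proj _

@[simp] theorem alphaInv_alpha (P : Ty 0) (h : P.NonLinear) :
    M.alphaInv P h ≫ M.alpha P h = 𝟙 _ :=
  @proj_hom_isIso _ _ _ _ _ _ (isIso_α_app P h Fin.elim0)

end CPOLNLModel
end LNLFPC

namespace LNLFPC
open CategoryTheory CategoryTheory.Limits OmegaCompletePartialOrder MonoidalCategory

/-! ## Substitution calculus -/

namespace Ty

theorem liftRen_comp {n m k : ℕ} (ξ : Fin n → Fin m) (ζ : Fin m → Fin k) :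
    liftRen (ζ ∘ ξ) = liftRen ζ ∘ liftRen ξ := by
  funext i
  induction i using Fin.cases <;> rfl

theorem rename_rename {n m k : ℕ} (A : Ty n) (ξ : Fin n → Fin m) (ζ : Fin m → Fin k) :
    (A.rename ξ).rename ζ = A.rename (ζ ∘ ξ) := by
  induction A generalizing m k <;> simp only [rename, liftRen_comp, Function.comp_apply, *]

theorem liftSub_comp_liftRen {n m k : ℕ} (ξ : Fin n → Fin m) (σ : Fin m → Ty k) :
    liftSub (σ ∘ ξ) = liftSub σ ∘ liftRen ξ := by
  funext i
  induction i using Fin.cases <;> rfl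

theorem rename_subst {n m k : ℕ} (A : Ty n) (ξ : Fin n → Fin m) (σ : Fin m → Ty k) :
    (A.rename ξ).subst σ = A.subst (σ ∘ ξ) := by
  induction A generalizing m k <;> simp only [rename, subst, liftSub_comp_liftRen, Function.comp_apply, *]

theorem liftSub_rename {n m k : ℕ} (σ : Fin n → Ty m) (ξ : Fin m → Fin k) :
    (fun i => (liftSub σ i).rename (liftRen ξ)) = liftSub fun i => (σ i).rename ξ := by
  funext i
  induction i using Fin.cases with
  | zero => rfl
  | succ i => simp only [liftSub, Fin.cases_succ, rename_rename]; rfl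

theorem subst_rename {n m k : ℕ} (A : Ty n) (σ : Fin n → Ty m) (ξ : Fin m → Fin k) :
    (A.subst σ).rename ξ = A.subst fun i => (σ i).rename ξ := by
  induction A generalizing m k <;> simp only [rename, subst, liftSub_rename, *]

theorem liftSub_subst {n m k : ℕ} (σ : Fin n → Ty m) (ρ : Fin m → Ty k) :
    (fun i => (liftSub σ i).subst (liftSub ρ)) = liftSub fun i => (σ i).subst ρ := by
  funext i
  induction i using Fin.cases with
  | zero => rfl
  | succ i => simp only [liftSub, Fin.cases_succ, rename_subst, subst_rename]; rfl

theorem subst_subst {n m k : ℕ} (A : Ty n) (σ : Fin n → Ty m) (ρ : Fin m → Ty k) :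
    (A.subst σ).subst ρ = A.subst fun i => (σ i).subst ρ := by
  induction A generalizing m k <;> simp only [subst, liftSub_subst, *]

theorem liftSub_var {n : ℕ} : liftSub (var : Fin n → Ty n) = var := by
  funext i
  induction i using Fin.cases <;> rfl

theorem subst_var {n : ℕ} (A : Ty n) : A.subst var = A := by
  induction A <;> simp only [subst, liftSub_var, *]

/-- It identifies the unfolding of `(μX.A)[σ]` with `A` under an extended substitution, so that the
open type `A` can serve as the induction variable. -/
theorem subst_liftSub_inst {n m : ℕ} (A : Ty (n + 1)) (σ : Fin n → Ty m) (B : Ty m) :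
    (A.subst (liftSub σ)).inst B = A.subst (Fin.cases B σ) := by
  rw [inst, subst_subst]
  congr 1
  funext i
  induction i using Fin.cases with
  | zero => rfl
  | succ i =>
    simp only [liftSub, Fin.cases_succ, rename_subst]
    exact subst_var _

end Ty

namespace Tm

theorem rename_rename {n m k : ℕ} (t : Tm n) (ξ : Fin n → Fin m) (ζ : Fin m → Fin k) :
    (t.rename ξ).rename ζ = t.rename (ζ ∘ ξ) := by
  induction t generalizing m k <;> simp only [rename, Ty.liftRen_comp, Function.comp_apply, *]

theorem liftSub_comp_liftRen {n m k : ℕ} (ξ : Fin n → Fin m) (σ : Fin m → Tm k) :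
    liftSub (σ ∘ ξ) = liftSub σ ∘ Ty.liftRen ξ := by
  funext i
  induction i using Fin.cases <;> rfl

theorem rename_subst {n m k : ℕ} (t : Tm n) (ξ : Fin n → Fin m) (σ : Fin m → Tm k) :
    (t.rename ξ).subst σ = t.subst (σ ∘ ξ) := by
  induction t generalizing m k <;> simp only [rename, subst, liftSub_comp_liftRen, Function.comp_apply, *]

theorem liftSub_rename {n m k : ℕ} (σ : Fin n → Tm m) (ξ : Fin m → Fin k) :
    (fun i => (liftSub σ i).rename (Ty.liftRen ξ)) = liftSub fun i => (σ i).rename ξ := by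
  funext i
  induction i using Fin.cases with
  | zero => rfl
  | succ i => simp only [liftSub, Fin.cases_succ, rename_rename]; rfl

theorem subst_rename {n m k : ℕ} (t : Tm n) (σ : Fin n → Tm m) (ξ : Fin m → Fin k) :
    (t.subst σ).rename ξ = t.subst fun i => (σ i).rename ξ := by
  induction t generalizing m k <;> simp only [rename, subst, liftSub_rename, *]

theorem liftSub_subst {n m k : ℕ} (σ : Fin n → Tm m) (ρ : Fin m → Tm k) :
    (fun i => (liftSub σ i).subst (liftSub ρ)) = liftSub fun i => (σ i).subst ρ := by
  funext i
  induction i using Fin.cases with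
  | zero => rfl
  | succ i => simp only [liftSub, Fin.cases_succ, rename_subst, subst_rename]; rfl

theorem subst_subst {n m k : ℕ} (t : Tm n) (σ : Fin n → Tm m) (ρ : Fin m → Tm k) :
    (t.subst σ).subst ρ = t.subst fun i => (σ i).subst ρ := by
  induction t generalizing m k <;> simp only [subst, liftSub_subst, *]

theorem liftSub_var {n : ℕ} : liftSub (var : Fin n → Tm n) = var := by
  funext i
  induction i using Fin.cases <;> rfl

theorem subst_var {n : ℕ} (t : Tm n) : t.subst var = t := by
  induction t <;> simp only [subst, liftSub_var, *]

theorem subst_liftSub_inst {n m : ℕ} (t : Tm (n + 1)) (σ : Fin n → Tm m) (v : Tm m) :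
    (t.subst (liftSub σ)).inst v = t.subst (Fin.cases v σ) := by
  rw [inst, subst_subst]
  congr 1
  funext i
  induction i using Fin.cases with
  | zero => rfl
  | succ i =>
    simp only [liftSub, Fin.cases_succ, rename_subst]
    exact subst_var _

theorem subst_liftSub_inst₂ {n m : ℕ} (t : Tm (n + 2)) (σ : Fin n → Tm m) (v w : Tm m) :
    (t.subst (liftSub (liftSub σ))).inst₂ v w = t.subst (Fin.cases w (Fin.cases v σ)) := by
  rw [inst₂, subst_subst]
  congr 1
  funext i
  induction i using Fin.cases with
  | zero => rfl
  | succ i =>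
    induction i using Fin.cases with
    | zero => rfl
    | succ i =>
      simp only [liftSub, Fin.cases_succ, rename_subst]
      exact subst_var _

end Tm

namespace CPOLNLModel

variable {M : CPOLNLModel.{v, u}}

/-! ## Substitution of closed types -/

theorem obj_subst {n : ℕ} (A : Ty n) (σ : Fin n → Ty 0) :
    (M.ty A).obj (fun i => M.obj (σ i)) = M.obj (A.subst σ) :=
  (congrArg (fun T : (Fin 0 → M.Le) ⥤ M.Le => T.obj M.pt) (M.ty_subst A σ)).symm

/-- The comparison `⟦A⟧(⟦σ⟧) = ⟦A[σ]⟧`. -/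
noncomputable def substE {n : ℕ} (A : Ty n) (σ : Fin n → Ty 0) :
    (M.ty A).obj (fun i => M.obj (σ i)) ⟶ M.obj (A.subst σ) := eqToHom (obj_subst A σ)

/-- The interpretation of a substituted type is only propositionally equal to the substituted
interpretation. Pushing the transport inside the connectives lets proofs about `substMap` go by
structural induction. -/
theorem eqToHom_map₂ {K : Type u} [Category.{v} K] (T : K × K ⥤ K) {X Y X' Y' : K} (h : X = X')
    (h' : Y = Y') (h₂ : T.obj (X, Y) = T.obj (X', Y')) :
    eqToHom h₂ = T.map ((eqToHom h, eqToHom h') : (X, Y) ⟶ (X', Y')) := by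
  subst h h'
  exact (T.map_id (X, Y)).symm

theorem eqToHom_map₁ {K K' : Type u} [Category.{v} K] [Category.{v} K'] (T : K ⥤ K') {X X' : K}
    (h : X = X') (h₂ : T.obj X = T.obj X') :
    eqToHom h₂ = T.map (eqToHom h) := by
  subst h
  exact (T.map_id X).symm

theorem substE_sum {n : ℕ} (A B : Ty n) (σ : Fin n → Ty 0) :
    M.substE (A.sum B) σ = M.sumE.map (M.substE A σ, M.substE B σ) :=
  eqToHom_map₂ M.sumE (obj_subst A σ) (obj_subst B σ) _

theorem substE_tensor {n : ℕ} (A B : Ty n) (σ : Fin n → Ty 0) :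
    M.substE (A.tensor B) σ = M.tensorE.map (M.substE A σ, M.substE B σ) :=
  eqToHom_map₂ M.tensorE (obj_subst A σ) (obj_subst B σ) _

theorem substE_lolli {n : ℕ} (A B : Ty n) (σ : Fin n → Ty 0) :
    M.substE (A.lolli B) σ = M.lolliE.map (M.substE A σ, M.substE B σ) :=
  eqToHom_map₂ M.lolliE (obj_subst A σ) (obj_subst B σ) _

theorem substE_bang {n : ℕ} (A : Ty n) (σ : Fin n → Ty 0) :
    M.substE A.bang σ = M.Fpe.map (M.Gpe.map (M.substE A σ)) :=
  eqToHom_map₁ (M.Gpe ⋙ M.Fpe) (obj_subst A σ) _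

/-- The embedding `⟦A⟧(X) ⟶ ⟦A[σ]⟧` induced by embeddings `X i ⟶ ⟦σ i⟧`. -/
noncomputable def substMap {n : ℕ} (A : Ty n) (σ : Fin n → Ty 0) {X : Fin n → M.Le}
    (e : ∀ i, X i ⟶ M.obj (σ i)) : (M.ty A).obj X ⟶ M.obj (A.subst σ) :=
  (M.ty A).map (X := X) (Y := fun i => M.obj (σ i)) e ≫ M.substE A σ

theorem substMap_sum {n : ℕ} (A B : Ty n) (σ : Fin n → Ty 0) {X : Fin n → M.Le}
    (e : ∀ i, X i ⟶ M.obj (σ i)) :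
    M.substMap (A.sum B) σ e = M.sumE.map (X := ((M.ty A).obj X, (M.ty B).obj X))
      (Y := (M.obj (A.subst σ), M.obj (B.subst σ))) (M.substMap A σ e, M.substMap B σ e) := by
  rw [substMap, substE_sum]
  exact (M.sumE.map_comp _ _).symm

theorem substMap_tensor {n : ℕ} (A B : Ty n) (σ : Fin n → Ty 0) {X : Fin n → M.Le}
    (e : ∀ i, X i ⟶ M.obj (σ i)) :
    M.substMap (A.tensor B) σ e = M.tensorE.map (X := ((M.ty A).obj X, (M.ty B).obj X))
      (Y := (M.obj (A.subst σ), M.obj (B.subst σ))) (M.substMap A σ e, M.substMap B σ e) := by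
  rw [substMap, substE_tensor]
  exact (M.tensorE.map_comp _ _).symm

theorem substMap_lolli {n : ℕ} (A B : Ty n) (σ : Fin n → Ty 0) {X : Fin n → M.Le}
    (e : ∀ i, X i ⟶ M.obj (σ i)) :
    M.substMap (A.lolli B) σ e = M.lolliE.map (X := ((M.ty A).obj X, (M.ty B).obj X))
      (Y := (M.obj (A.subst σ), M.obj (B.subst σ))) (M.substMap A σ e, M.substMap B σ e) := by
  rw [substMap, substE_lolli]
  exact (M.lolliE.map_comp _ _).symm

theorem substMap_bang {n : ℕ} (A : Ty n) (σ : Fin n → Ty 0) {X : Fin n → M.Le}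
    (e : ∀ i, X i ⟶ M.obj (σ i)) :
    M.substMap A.bang σ e = M.Fpe.map (M.Gpe.map (M.substMap A σ e)) := by
  rw [substMap, substE_bang]
  exact ((M.Gpe ⋙ M.Fpe).map_comp _ _).symm

/-- Extend a closing substitution with the recursive type `μX.A` itself. -/
abbrev unrollSub {n : ℕ} (A : Ty (n + 1)) (σ : Fin n → Ty 0) : Fin (n + 1) → Ty 0 :=
  Fin.cases (A.mu.subst σ) σ

/-- The `fold` isomorphism of the closed instance `(μX.A)[σ]`. -/
noncomputable def foldSub {n : ℕ} (A : Ty (n + 1)) (σ : Fin n → Ty 0) :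
    M.Ob (A.subst (unrollSub A σ)) ⟶ M.Ob (A.mu.subst σ) :=
  eqToHom (congrArg M.Ob (A.subst_liftSub_inst σ (A.mu.subst σ)).symm) ≫
    M.fold (A.subst (Ty.liftSub σ))

theorem eqToHom_unroll {T T' : M.Le ⥤ M.Le} (h : T = T') (h₁ : (Y M.Le).obj T = (Y M.Le).obj T')
    (h₂ : T.obj ((Y M.Le).obj T') = T'.obj ((Y M.Le).obj T')) :
    eqToHom h₁ ≫ unroll T' = unroll T ≫ T.map (eqToHom h₁) ≫ eqToHom h₂ := by
  subst h
  simp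

theorem ty_map_cons_substE {n : ℕ} (A : Ty (n + 1)) {Z : Fin (n + 1) → M.Le}
    (τ : Fin (n + 1) → Ty 0) {W : Fin (n + 1) → M.Le} (h : ∀ i, W i = M.obj (τ i))
    (f : Z ⟶ W) (e : ∀ i, Z i ⟶ M.obj (τ i)) (he : ∀ i, f i ≫ eqToHom (h i) = e i)
    (h' : (M.ty A).obj W = M.obj (A.subst τ)) :
    (M.ty A).map f ≫ eqToHom h' = M.substMap A τ e := by
  obtain rfl : W = fun i => M.obj (τ i) := funext h
  obtain rfl : e = f := funext fun i => by rw [← he]; simp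
  rfl

theorem curry_obj_prod {B A K : Type u} [Category.{v} A] [Category.{v} B] [Category.{v} K]
    (H : B ⥤ A) (T : A × K ⥤ K) :
    Functor.curry.obj (H.prod (𝟭 K) ⋙ T) = H ⋙ Functor.curry.obj T := by
  refine CategoryTheory.Functor.ext (fun b => CategoryTheory.Functor.ext (fun _ => rfl) ?_) ?_
  · intro X Y f
    simp
  · intro X Y f
    ext k
    simp [eqToHom_app]

/-- The endofunctor whose initial sequence defines `μX.A` is the same whether `σ` is applied to the
syntax or to the parameters. Hence the two colimits agree, together with their `unroll` maps. -/
theorem curry_ty_subst {n : ℕ} (A : Ty (n + 1)) (σ : Fin n → Ty 0) :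
    (Functor.curry.obj (consF M.Le n ⋙ M.ty A)).obj (fun i => M.obj (σ i)) =
      (Functor.curry.obj (consF M.Le 0 ⋙ M.ty (A.subst (Ty.liftSub σ)))).obj M.pt := by
  have h : consF M.Le 0 ⋙ M.ty (A.subst (Ty.liftSub σ)) =
      (M.tuple fun i => M.ty (σ i)).prod (𝟭 M.Le) ⋙ consF M.Le n ⋙ M.ty A := by
    rw [ty_subst, ← Functor.assoc, M.consF_tuple (fun i => M.ty (σ i)) _ rfl fun i => ?_]
    · rfl
    · simp only [Ty.liftSub, Fin.cases_succ, ty_rename]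
      rfl
  rw [h, curry_obj_prod]
  rfl

theorem substE_mu_unfoldE {n : ℕ} (A : Ty (n + 1)) (σ : Fin n → Ty 0)
    (h : (consF M.Le n ⋙ M.ty A).obj (fun i => M.obj (σ i), M.obj (A.mu.subst σ)) =
      M.obj ((A.subst (Ty.liftSub σ)).inst (A.mu.subst σ))) :
    M.substE A.mu σ ≫ M.unfoldE (A.subst (Ty.liftSub σ)) =
      unroll ((Functor.curry.obj (consF M.Le n ⋙ M.ty A)).obj fun i => M.obj (σ i)) ≫
        ((Functor.curry.obj (consF M.Le n ⋙ M.ty A)).obj fun i => M.obj (σ i)).map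
          (M.substE A.mu σ) ≫ eqToHom h := by
  have h2 := Functor.congr_obj (M.curry_ty_subst A σ)
    ((Y M.Le).obj ((Functor.curry.obj (consF M.Le 0 ⋙ M.ty (A.subst (Ty.liftSub σ)))).obj M.pt))
  have h3 := eqToHom_unroll (M.curry_ty_subst A σ) (congrArg _ (M.curry_ty_subst A σ)) h2
  refine (Category.assoc _ _ _).symm.trans ((congrArg (· ≫ eqToHom _) h3).trans ?_)
  simp only [Category.assoc]
  exact congrArg (fun x => unroll _ ≫ CategoryTheory.Functor.map _ _ ≫ x) (eqToHom_trans _ _)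

/-- The restriction to the `k`-th member of the initial sequence of the embedding
`⟦μX.A⟧(X) ⟶ ⟦(μX.A)[σ]⟧` induced by embeddings `X i ⟶ ⟦σ i⟧`. -/
noncomputable def substSeq {n : ℕ} (A : Ty (n + 1)) (σ : Fin n → Ty 0) {X : Fin n → M.Le}
    (e : ∀ i, X i ⟶ M.obj (σ i)) (k : ℕ) :
    seqObj ((Functor.curry.obj (consF M.Le n ⋙ M.ty A)).obj X) k ⟶ M.obj (A.mu.subst σ) :=
  seqTo (consF M.Le n ⋙ M.ty A) (a := X) (b := fun i => M.obj (σ i)) e k ≫ M.substE A.mu σ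

theorem seqι_substMap {n : ℕ} (A : Ty (n + 1)) (σ : Fin n → Ty 0) {X : Fin n → M.Le}
    (e : ∀ i, X i ⟶ M.obj (σ i)) (k : ℕ) :
    seqι ((Functor.curry.obj (consF M.Le n ⋙ M.ty A)).obj X) k ≫ M.substMap A.mu σ e =
      M.substSeq A σ e k :=
  (Category.assoc _ _ _).symm.trans (congrArg (· ≫ M.substE A.mu σ) (seqι_dagger_map _ _ k))

/-- Extend a family of embeddings `X i ⟶ ⟦σ i⟧` with an embedding into the recursive type. -/
abbrev consMap {n : ℕ} (A : Ty (n + 1)) (σ : Fin n → Ty 0) {X : Fin n → M.Le}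
    (e : ∀ i, X i ⟶ M.obj (σ i)) {D : M.Le} (d : D ⟶ M.obj (A.mu.subst σ)) (i : Fin (n + 1)) :
    (consF M.Le n).obj (X, D) i ⟶ M.obj (unrollSub A σ i) :=
  Fin.cases (motive := fun i => (consF M.Le n).obj (X, D) i ⟶ M.obj (unrollSub A σ i)) d e i

/-- This turns an induction over unfoldings into one over `k`: the next stage is `substMap` for the
body `A`, with the current stage in place of the bound variable, followed by `fold`. The body is
structurally smaller than `A.mu`, which makes nested inductions on `A` and on `k` possible. -/
theorem substSeq_succ {n : ℕ} (A : Ty (n + 1)) (σ : Fin n → Ty 0) {X : Fin n → M.Le}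
    (e : ∀ i, X i ⟶ M.obj (σ i)) (k : ℕ) :
    (M.substSeq A σ e (k + 1)).hom =
      (M.substMap A (unrollSub A σ) (consMap A σ e (M.substSeq A σ e k))).hom ≫ M.foldSub A σ := by
  have hcons : ∀ i, (consF M.Le n).obj (fun i => M.obj (σ i), M.obj (A.mu.subst σ)) i =
      M.obj (unrollSub A σ i) := fun i => by
    induction i using Fin.cases <;> rfl
  have h1 : (consF M.Le n ⋙ M.ty A).obj (fun i => M.obj (σ i), M.obj (A.mu.subst σ)) =
      M.obj (A.subst (unrollSub A σ)) :=
    (congrArg (M.ty A).obj (funext hcons)).trans (obj_subst A (unrollSub A σ))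
  have h2 : M.obj (A.subst (unrollSub A σ)) =
      M.obj ((A.subst (Ty.liftSub σ)).inst (A.mu.subst σ)) :=
    congrArg M.obj (A.subst_liftSub_inst σ (A.mu.subst σ)).symm
  -- Both sides are compared after `unfold`, where `seqTo_unroll` applies, and `fold` cancels it
  -- afterwards. What remains is functoriality of `⟦A⟧` and composition of transports.
  have key : M.substSeq A σ e (k + 1) ≫ M.unfoldE (A.subst (Ty.liftSub σ)) =
      M.substMap A (unrollSub A σ) (consMap A σ e (M.substSeq A σ e k)) ≫ eqToHom h2 := by
    have e1 := substE_mu_unfoldE A σ (h1.trans h2)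
    have e2 := seqTo_unroll (consF M.Le n ⋙ M.ty A) (a := X) (b := fun i => M.obj (σ i)) e k
    have e3 := ty_map_cons_substE A (Z := (consF M.Le n).obj (X, _)) (unrollSub A σ) hcons
      ((consF M.Le n).map (Y := (fun i => M.obj (σ i), M.obj (A.mu.subst σ)))
        (e, M.substSeq A σ e k)) (consMap A σ e (M.substSeq A σ e k)) (fun i => by
          induction i using Fin.cases <;> exact Category.comp_id _) h1
    rw [← e3, Category.assoc, eqToHom_trans]
    refine (Category.assoc _ _ _).trans ((congrArg (seqTo _ _ _ ≫ ·) e1).trans ?_)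
    refine (Category.assoc _ _ _).symm.trans ((congrArg (· ≫ _ ≫ eqToHom _) e2).trans ?_)
    refine (Category.assoc _ _ _).symm.trans (congrArg (· ≫ eqToHom _) ?_)
    refine ((consF M.Le n ⋙ M.ty A).map_comp _ _).symm.trans
      (congrArg (consF M.Le n ⋙ M.ty A).map ?_)
    exact Prod.ext (Category.comp_id _) rfl
  have h3 := congrArg (fun f : (seqObj _ (k + 1) : M.Le) ⟶
    M.obj ((A.subst (Ty.liftSub σ)).inst (A.mu.subst σ)) => f.hom ≫ M.fold (A.subst (Ty.liftSub σ))) key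
  have h4 : InducedWideCategory.Hom.hom (eqToHom h2) =
      eqToHom (congrArg M.Ob (A.subst_liftSub_inst σ (A.mu.subst σ)).symm) :=
    eqToHom_map (wideSubcategoryInclusion (embeddings M.L)) h2
  refine Eq.trans ?_ (h3.trans ?_)
  · exact ((Category.assoc _ _ _).trans ((congrArg ((M.substSeq A σ e (k + 1)).hom ≫ ·)
      (unfold_fold _)).trans (Category.comp_id _))).symm
  · exact (Category.assoc _ _ _).trans (congrArg (_ ≫ · ≫ _) h4)

theorem substMap_var {n : ℕ} (i : Fin n) (σ : Fin n → Ty 0) {X : Fin n → M.Le}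
    (e : ∀ i, X i ⟶ M.obj (σ i)) : M.substMap (.var i) σ e = e i := Category.comp_id _

end CPOLNLModel
end LNLFPC

namespace LNLFPC
open CategoryTheory CategoryTheory.Limits OmegaCompletePartialOrder MonoidalCategory

/-! ## Approximations of the identity -/

/-- Induction over closed types in which the unfolding of a recursive type counts as smaller at the
preceding level. -/
theorem Ty.closed_induction {motive : ℕ → Ty 0 → Prop}
    (sum : ∀ n A B, motive n A → motive n B → motive n (.sum A B))
    (tensor : ∀ n A B, motive n A → motive n B → motive n (.tensor A B))
    (lolli : ∀ n A B, motive n A → motive n B → motive n (.lolli A B))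
    (bang : ∀ n A, motive n A → motive n (.bang A))
    (mu_zero : ∀ A, motive 0 (.mu A))
    (mu_succ : ∀ n A, motive n (A.inst (.mu A)) → motive (n + 1) (.mu A)) :
    ∀ n A, motive n A
  | _, .var i => i.elim0
  | n, .sum A B => sum n A B (closed_induction sum tensor lolli bang mu_zero mu_succ n A)
      (closed_induction sum tensor lolli bang mu_zero mu_succ n B)
  | n, .tensor A B => tensor n A B (closed_induction sum tensor lolli bang mu_zero mu_succ n A)
      (closed_induction sum tensor lolli bang mu_zero mu_succ n B)
  | n, .lolli A B => lolli n A B (closed_induction sum tensor lolli bang mu_zero mu_succ n A)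
      (closed_induction sum tensor lolli bang mu_zero mu_succ n B)
  | n, .bang A => bang n A (closed_induction sum tensor lolli bang mu_zero mu_succ n A)
  | 0, .mu A => mu_zero A
  | n + 1, .mu A =>
    mu_succ n A (closed_induction sum tensor lolli bang mu_zero mu_succ n (A.inst (.mu A)))
termination_by n A => (n, sizeOf A)

namespace CPOLNLModel

/-- The approximations of the identity of `⟦A⟧` obtained by truncating the unfolding of recursive
types at a given level. -/
noncomputable def approx (M : CPOLNLModel.{v, u}) : ℕ → (A : Ty 0) → (M.Ob A ⟶ M.Ob A)
  | _, .var i => i.elim0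
  | n, .sum A B =>
    (coprod.map (M.approx n A) (M.approx n B) : M.Ob A ⨿ M.Ob B ⟶ M.Ob A ⨿ M.Ob B)
  | n, .tensor A B => (M.approx n A ⊗ₘ M.approx n B : M.Ob A ⊗ M.Ob B ⟶ M.Ob A ⊗ M.Ob B)
  | n, .lolli A B => M.lolliMap (M.approx n A) (M.approx n B)
  | n, .bang A => M.bangFunctor.map (M.approx n A)
  | 0, .mu A => M.bot _ _
  | n + 1, .mu A => M.unfold A ≫ M.approx n (A.inst (.mu A)) ≫ M.fold A
termination_by n A => (n, sizeOf A)

variable {M : CPOLNLModel.{v, u}}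

theorem approx_sum (n : ℕ) (A B : Ty 0) : M.approx n (.sum A B) =
    (coprod.map (M.approx n A) (M.approx n B) : M.Ob A ⨿ M.Ob B ⟶ M.Ob A ⨿ M.Ob B) := by
  rw [approx]

theorem approx_tensor (n : ℕ) (A B : Ty 0) : M.approx n (.tensor A B) =
    (M.approx n A ⊗ₘ M.approx n B : M.Ob A ⊗ M.Ob B ⟶ M.Ob A ⊗ M.Ob B) := by
  rw [approx]

theorem approx_lolli (n : ℕ) (A B : Ty 0) : M.approx n (.lolli A B) =
    M.lolliMap (M.approx n A) (M.approx n B) := by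
  rw [approx]

theorem approx_bang (n : ℕ) (A : Ty 0) : M.approx n (.bang A) =
    M.bangFunctor.map (M.approx n A) := by
  rw [approx]

theorem approx_mu_zero (A : Ty 1) : M.approx 0 (.mu A) = M.bot _ _ := by
  rw [approx]

theorem approx_mu_succ (n : ℕ) (A : Ty 1) : M.approx (n + 1) (.mu A) =
    M.unfold A ≫ M.approx n (A.inst (.mu A)) ≫ M.fold A := by
  rw [approx]

theorem approx_le (n : ℕ) (A : Ty 0) : M.approx n A ≤ 𝟙 _ := by
  induction n, A using Ty.closed_induction with
  | sum n A B hA hB =>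
    rw [approx_sum]
    exact (coprod_map_le hA hB).trans coprod.map_id_id.le
  | tensor n A B hA hB =>
    rw [approx_tensor]
    exact (tensor_le hA hB).trans (id_tensorHom_id _ _).le
  | lolli n A B hA hB =>
    rw [approx_lolli]
    exact (lolliMap_le hA hB).trans (lolliMap_id _ _ _).le
  | bang n A hA =>
    rw [approx_bang]
    exact (bang_map_le hA).trans (M.bangFunctor.map_id _).le
  | mu_zero A => rw [approx_mu_zero]; exact bot_le _
  | mu_succ n A hA =>
    rw [approx_mu_succ]
    exact (comp_mono le_rfl (comp_mono hA le_rfl)).trans (by simp)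

/-- The three equations go together because `⊸` reverses composition in its first argument, so that
the second equation at `A ⊸ B` uses the third at `A`, and conversely. -/
theorem approx_comp (n : ℕ) (A : Ty 0) : M.approx n A ≫ M.approx n A = M.approx n A ∧
    M.approx n A ≫ M.approx (n + 1) A = M.approx n A ∧
    M.approx (n + 1) A ≫ M.approx n A = M.approx n A := by
  induction n, A using Ty.closed_induction with
  | sum n A B hA hB =>
    simp only [approx_sum]
    have key : ∀ {f f' f'' : M.Ob A ⟶ M.Ob A} {g g' g'' : M.Ob B ⟶ M.Ob B}, f ≫ f' = f'' →
        g ≫ g' = g'' → coprod.map f g ≫ coprod.map f' g' = coprod.map f'' g'' := by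
      rintro _ _ _ _ _ _ rfl rfl
      exact coprod.map_map _ _ _ _
    exact ⟨key hA.1 hB.1, key hA.2.1 hB.2.1, key hA.2.2 hB.2.2⟩
  | tensor n A B hA hB =>
    simp only [approx_tensor]
    have key : ∀ {f f' f'' : M.Ob A ⟶ M.Ob A} {g g' g'' : M.Ob B ⟶ M.Ob B}, f ≫ f' = f'' →
        g ≫ g' = g'' → (f ⊗ₘ g) ≫ (f' ⊗ₘ g') = f'' ⊗ₘ g'' := by
      rintro _ _ _ _ _ _ rfl rfl
      exact tensorHom_comp_tensorHom _ _ _ _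
    exact ⟨key hA.1 hB.1, key hA.2.1 hB.2.1, key hA.2.2 hB.2.2⟩
  | lolli n A B hA hB =>
    simp only [approx_lolli]
    have key : ∀ {f f' f'' : M.Ob A ⟶ M.Ob A} {g g' g'' : M.Ob B ⟶ M.Ob B}, f' ≫ f = f'' →
        g ≫ g' = g'' → M.lolliMap f g ≫ M.lolliMap f' g' = M.lolliMap f'' g'' := by
      rintro _ _ _ _ _ _ rfl rfl
      exact (lolliMap_comp _ _ _ _).symm
    exact ⟨key hA.1 hB.1, key hA.2.2 hB.2.1, key hA.2.1 hB.2.2⟩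
  | bang n A hA =>
    simp only [approx_bang]
    have key : ∀ {f f' f'' : M.Ob A ⟶ M.Ob A}, f ≫ f' = f'' →
        M.bangFunctor.map f ≫ M.bangFunctor.map f' = M.bangFunctor.map f'' := by
      rintro _ _ _ rfl
      exact (M.bangFunctor.map_comp _ _).symm
    exact ⟨key hA.1, key hA.2.1, key hA.2.2⟩
  | mu_zero A => simp [approx_mu_zero]
  | mu_succ n A hA =>
    simp only [approx_mu_succ]
    have key : ∀ {f f' f'' : M.Ob (A.inst A.mu) ⟶ M.Ob (A.inst A.mu)}, f ≫ f' = f'' →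
        (M.unfold A ≫ f ≫ M.fold A) ≫ M.unfold A ≫ f' ≫ M.fold A =
          M.unfold A ≫ f'' ≫ M.fold A := by
      rintro _ _ _ rfl
      simp
    exact ⟨key hA.1, key hA.2.1, key hA.2.2⟩

@[simp] theorem approx_idem (n : ℕ) (A : Ty 0) : M.approx n A ≫ M.approx n A = M.approx n A :=
  (approx_comp n A).1

@[simp] theorem approx_succ (n : ℕ) (A : Ty 0) :
    M.approx n A ≫ M.approx (n + 1) A = M.approx n A := (approx_comp n A).2.1

@[simp] theorem succ_approx (n : ℕ) (A : Ty 0) :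
    M.approx (n + 1) A ≫ M.approx n A = M.approx n A := (approx_comp n A).2.2

/-- Level `n` is level `n + 1` followed by level `n`, and the latter lies below the identity. -/
theorem approx_mono (A : Ty 0) : Monotone fun n => M.approx n A :=
  monotone_nat_of_le_succ fun n => by
    have := comp_mono (le_refl (M.approx (n + 1) A)) (approx_le n A)
    rwa [succ_approx, Category.comp_id] at this

theorem approx_comp_of_le {n k : ℕ} (h : n ≤ k) (A : Ty 0) :
    M.approx n A ≫ M.approx k A = M.approx n A := by
  refine le_antisymm ((comp_mono le_rfl (approx_le k A)).trans (Category.comp_id _).le) ?_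
  have := comp_mono (le_refl (M.approx n A)) (approx_mono (M := M) A h)
  rwa [approx_idem] at this

theorem comp_approx_of_le {n k : ℕ} (h : n ≤ k) (A : Ty 0) :
    M.approx k A ≫ M.approx n A = M.approx n A := by
  refine le_antisymm ((comp_mono (approx_le k A) le_rfl).trans (Category.id_comp _).le) ?_
  have := comp_mono (approx_mono (M := M) A h) (le_refl (M.approx n A))
  rwa [approx_idem] at this

/-! ## The approximations converge to the identity -/

/-- The supremum of the approximations. -/
noncomputable def approxSup (M : CPOLNLModel.{v, u}) (A : Ty 0) : M.Ob A ⟶ M.Ob A :=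
  (exists_isSup (approx_mono (M := M) A)).choose

theorem isSup_approxSup (A : Ty 0) : IsSup (fun n => M.approx n A) (M.approxSup A) :=
  (exists_isSup (approx_mono (M := M) A)).choose_spec

theorem approxSup_le (A : Ty 0) : M.approxSup A ≤ 𝟙 _ :=
  (isSup_approxSup A).le_of_forall fun n => approx_le n A

theorem approxSup_sum (A B : Ty 0) : M.approxSup (.sum A B) =
    (coprod.map (M.approxSup A) (M.approxSup B) : M.Ob A ⨿ M.Ob B ⟶ M.Ob A ⨿ M.Ob B) :=
  (isSup_approxSup _).unique ((isSup_coprod (isSup_approxSup A) (isSup_approxSup B)).congr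
    (fun n => approx_sum n A B) rfl)

theorem approxSup_tensor (A B : Ty 0) : M.approxSup (.tensor A B) =
    (M.approxSup A ⊗ₘ M.approxSup B : M.Ob A ⊗ M.Ob B ⟶ M.Ob A ⊗ M.Ob B) :=
  (isSup_approxSup _).unique ((isSup_tensor (isSup_approxSup A) (isSup_approxSup B)).congr
    (fun n => approx_tensor n A B) rfl)

theorem approxSup_lolli (A B : Ty 0) : M.approxSup (.lolli A B) =
    M.lolliMap (M.approxSup A) (M.approxSup B) :=
  (isSup_approxSup _).unique ((isSup_lolli (isSup_approxSup A) (isSup_approxSup B)).congr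
    (fun n => approx_lolli n A B) rfl)

theorem approxSup_bang (A : Ty 0) : M.approxSup (.bang A) = M.bangFunctor.map (M.approxSup A) :=
  (isSup_approxSup _).unique ((isSup_bang (isSup_approxSup A)).congr
    (fun n => approx_bang n A) rfl)

/-- One application of `fold` costs one level, which dropping the first term of the sequence
absorbs. -/
theorem approxSup_mu (A : Ty 1) :
    M.approxSup (.mu A) = M.unfold A ≫ M.approxSup (A.inst A.mu) ≫ M.fold A :=
  ((isSup_approxSup _).shift 1).unique
    ((((isSup_approxSup (A.inst A.mu)).comp_right _).comp_left _).congr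
      (fun n => approx_mu_succ n A) rfl)

theorem fold_approxSup (A : Ty 1) :
    M.fold A ≫ M.approxSup A.mu = M.approxSup (A.inst A.mu) ≫ M.fold A := by
  rw [approxSup_mu, fold_unfold_assoc]

theorem foldSub_approxSup {n : ℕ} (A : Ty (n + 1)) (σ : Fin n → Ty 0) :
    M.foldSub A σ ≫ M.approxSup (A.mu.subst σ) =
      M.approxSup (A.subst (unrollSub A σ)) ≫ M.foldSub A σ := by
  have key : ∀ (B : Ty 1) (C : Ty 0) (h : C = B.inst B.mu),
      (eqToHom (congrArg M.Ob h) ≫ M.fold B) ≫ M.approxSup B.mu =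
        M.approxSup C ≫ eqToHom (congrArg M.Ob h) ≫ M.fold B := by
    rintro B _ rfl
    simp [fold_approxSup]
  exact key _ _ (A.subst_liftSub_inst σ (A.mu.subst σ)).symm

/-- Both conditions on a projection counterpart survive precomposition with `q`, and the counterpart
is unique. This serves the contravariant argument of `⊸`, on which embeddings act by their
projections. -/
theorem comp_proj_of_comp_eq {X Y : M.Le} {e : X ⟶ Y} {q : Y.obj ⟶ Y.obj} (hq : q ≤ 𝟙 _)
    (h : e.hom ≫ q = e.hom) : q ≫ proj e.property = proj e.property := by
  refine IsEPPair.unique (e := e.hom) ⟨?_, ?_⟩ (proj_spec e.property)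
  · rw [← Category.assoc, h, emb_proj]
  · rw [Category.assoc]
    exact (comp_mono hq (defl_le e)).trans (Category.id_comp _).le

/-- Minimal invariance for open types. Every connective commutes with `approxSup`. At `μX.A` the
restriction to each member of the initial sequence is fixed, by induction on the index: the body `A`
is taken with the previous stage in place of `X`, and `fold` commutes with `approxSup`. The members
are jointly epic. -/
theorem substMap_approxSup {n : ℕ} (A : Ty n) (σ : Fin n → Ty 0) {X : Fin n → M.Le}
    (e : ∀ i, X i ⟶ M.obj (σ i)) (he : ∀ i, (e i).hom ≫ M.approxSup (σ i) = (e i).hom) :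
    (M.substMap A σ e).hom ≫ M.approxSup (A.subst σ) = (M.substMap A σ e).hom := by
  induction A with
  | var i => rw [substMap_var]; exact he i
  | sum A B hA hB =>
    rw [substMap_sum]
    refine (congrArg (_ ≫ ·) (approxSup_sum _ _)).trans ?_
    exact (coprod.map_map _ _ _ _).trans (congrArg₂ coprod.map (hA σ e he) (hB σ e he))
  | tensor A B hA hB =>
    rw [substMap_tensor]
    refine (congrArg (_ ≫ ·) (approxSup_tensor _ _)).trans ?_
    exact (tensorHom_comp_tensorHom _ _ _ _).trans
      (congrArg₂ tensorHom (hA σ e he) (hB σ e he))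
  | lolli A B hA hB =>
    rw [substMap_lolli]
    refine (congrArg (_ ≫ ·) (approxSup_lolli _ _)).trans ?_
    exact (lolliMap_comp _ _ _ _).symm.trans (congrArg₂ M.lolliMap
      (comp_proj_of_comp_eq (approxSup_le _) (hA σ e he)) (hB σ e he))
  | bang A hA =>
    rw [substMap_bang]
    refine (congrArg (_ ≫ ·) (approxSup_bang _)).trans ?_
    exact (M.bangFunctor.map_comp _ _).symm.trans (congrArg M.bangFunctor.map (hA σ e he))
  | mu A hA =>
    have hk : ∀ k, (M.substSeq A σ e k).hom ≫ M.approxSup (A.mu.subst σ) =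
        (M.substSeq A σ e k).hom := by
      intro k
      induction k with
      | zero => exact bot_Le_hom_ext _ _
      | succ k ih =>
        have h := hA (unrollSub A σ) (consMap A σ e (M.substSeq A σ e k)) fun i => by
          induction i using Fin.cases with
          | zero => exact ih
          | succ i => exact he i
        have glue : ∀ {Z Z' W : M.L} {a : Z ⟶ Z'} {b : Z' ⟶ W} {q : W ⟶ W} {q' : Z' ⟶ Z'},
            b ≫ q = q' ≫ b → a ≫ q' = a → (a ≫ b) ≫ q = a ≫ b := by
          intro Z Z' W a b q q' h h'
          rw [Category.assoc, h, ← Category.assoc, h']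
        rw [substSeq_succ]
        exact glue (foldSub_approxSup A σ) h
    refine colimit_hom_ext (seq ((Functor.curry.obj (consF M.Le _ ⋙ M.ty A)).obj X)) fun k => ?_
    have h := congrArg InducedWideCategory.Hom.hom (seqι_substMap A σ e k)
    refine (Category.assoc _ _ _).symm.trans ?_
    exact (congrArg (· ≫ M.approxSup (A.mu.subst σ)) h).trans ((hk k).trans h.symm)

theorem substMap_closed (A : Ty 0) (σ : Fin 0 → Ty 0) {X : Fin 0 → M.Le}
    (e : ∀ i, X i ⟶ M.obj (σ i)) (h : (M.ty A).obj X = M.obj (A.subst σ)) :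
    M.substMap A σ e = eqToHom h := by
  obtain rfl : X = fun i => M.obj (σ i) := funext fun i => i.elim0
  obtain rfl : e = fun i => 𝟙 (M.obj (σ i)) := funext fun i => i.elim0
  rw [substMap]
  exact (congrArg (· ≫ M.substE A σ) ((M.ty A).map_id _)).trans (Category.id_comp _)

/-- A closed type is an open type without variables, for which `substMap` is a transport along an
equality. Being fixed by `approxSup` then says that `approxSup` is the identity. -/
theorem approxSup_eq (A : Ty 0) : M.approxSup A = 𝟙 _ := by
  have h := substMap_approxSup (M := M) A .var (X := M.pt) (fun i => i.elim0) fun i => i.elim0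
  have h1 : M.obj A = M.obj (A.subst .var) := by rw [Ty.subst_var]
  have key : ∀ (B : Ty 0) (hB : B = A) (h : M.obj A = M.obj B),
      (eqToHom h).hom ≫ M.approxSup B = (eqToHom h).hom → M.approxSup A = 𝟙 _ := by
    rintro _ rfl _ h
    exact (Category.id_comp _).symm.trans h
  rw [substMap_closed A .var (X := M.pt) _ h1] at h
  exact key _ A.subst_var h1 h

theorem isSup_approx (A : Ty 0) : IsSup (fun n => M.approx n A) (𝟙 (M.Ob A)) := by
  rw [← approxSup_eq]
  exact isSup_approxSup A

theorem isSup_comp_approx {X : M.L} {A : Ty 0} (d : X ⟶ M.Ob A) :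
    IsSup (fun n => d ≫ M.approx n A) d := by
  simpa using (isSup_approx A).comp_left d

end CPOLNLModel
end LNLFPC

namespace LNLFPC
open CategoryTheory CategoryTheory.Limits OmegaCompletePartialOrder MonoidalCategory

namespace CPOLNLModel

variable {M : CPOLNLModel.{v, u}}

/-! ## Coalgebra structures -/

/-- The multiplication `!X ⊗ !Y ⟶ !(X ⊗ Y)`. -/
abbrev bangμ (X Y : M.L) : M.bangFunctor.obj X ⊗ M.bangFunctor.obj Y ⟶ M.bangFunctor.obj (X ⊗ Y) :=
  Functor.LaxMonoidal.μ (M.G ⋙ M.F) X Y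

/-- The unit `I ⟶ !I`. -/
abbrev bangε (M : CPOLNLModel.{v, u}) : 𝟙_ M.L ⟶ M.bangFunctor.obj (𝟙_ M.L) :=
  Functor.LaxMonoidal.ε (M.G ⋙ M.F)

/-- The canonical coalgebra structure on `F Z`. -/
def free (M : CPOLNLModel.{v, u}) (Z : M.C) : M.F.obj Z ⟶ M.bangFunctor.obj (M.F.obj Z) :=
  M.F.map (M.adj.unit.app Z)

/-- `f` is a morphism between objects equipped with morphisms to their images under `!`. -/
def IsCoalgHom {X Y : M.L} (p : X ⟶ M.bangFunctor.obj X) (q : Y ⟶ M.bangFunctor.obj Y)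
    (f : X ⟶ Y) : Prop := p ≫ M.bangFunctor.map f = f ≫ q

theorem IsCoalgHom.comp {X Y Z : M.L} {p : X ⟶ M.bangFunctor.obj X} {q : Y ⟶ M.bangFunctor.obj Y}
    {r : Z ⟶ M.bangFunctor.obj Z} {f : X ⟶ Y} {g : Y ⟶ Z} (hf : IsCoalgHom p q f)
    (hg : IsCoalgHom q r g) : IsCoalgHom p r (f ≫ g) := by
  unfold IsCoalgHom at *
  rw [Functor.map_comp, ← Category.assoc, hf, Category.assoc, hg, Category.assoc]

theorem IsCoalgHom.of_isSup {X Y : M.L} {p : X ⟶ M.bangFunctor.obj X}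
    {q : Y ⟶ M.bangFunctor.obj Y} {f : ℕ → (X ⟶ Y)} {a : X ⟶ Y} (h : IsSup f a)
    (hf : ∀ n, IsCoalgHom p q (f n)) : IsCoalgHom p q a :=
  ((isSup_bang h).comp_left p).unique ((h.comp_right q).congr hf rfl)

theorem isCoalgHom_map_free {Z Z' : M.C} (f : Z ⟶ Z') :
    IsCoalgHom (M.free Z) (M.free Z') (M.F.map f) := by
  unfold IsCoalgHom free
  exact (M.F.map_comp _ _).symm.trans ((congrArg M.F.map (M.adj.unit.naturality f).symm).trans
    (M.F.map_comp _ _))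

theorem isCoalgHom_bang_map {X Y : M.L} (f : X ⟶ Y) :
    IsCoalgHom (M.free (M.G.obj X)) (M.free (M.G.obj Y)) (M.bangFunctor.map f) :=
  isCoalgHom_map_free (M.G.map f)

/-- The coalgebra structure on a coproduct. -/
noncomputable abbrev coalgSum {X Y : M.L} (p : X ⟶ M.bangFunctor.obj X)
    (q : Y ⟶ M.bangFunctor.obj Y) : X ⨿ Y ⟶ M.bangFunctor.obj (X ⨿ Y) :=
  coprod.desc (p ≫ M.bangFunctor.map coprod.inl) (q ≫ M.bangFunctor.map coprod.inr)

/-- The coalgebra structure on a tensor product. -/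
abbrev coalgTensor {X Y : M.L} (p : X ⟶ M.bangFunctor.obj X)
    (q : Y ⟶ M.bangFunctor.obj Y) : X ⊗ Y ⟶ M.bangFunctor.obj (X ⊗ Y) := (p ⊗ₘ q) ≫ bangμ X Y

theorem isCoalgHom_inl {X Y : M.L} (p : X ⟶ M.bangFunctor.obj X) (q : Y ⟶ M.bangFunctor.obj Y) :
    IsCoalgHom p (coalgSum p q) coprod.inl := (coprod.inl_desc _ _).symm

theorem isCoalgHom_inr {X Y : M.L} (p : X ⟶ M.bangFunctor.obj X) (q : Y ⟶ M.bangFunctor.obj Y) :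
    IsCoalgHom q (coalgSum p q) coprod.inr := (coprod.inr_desc _ _).symm

theorem IsCoalgHom.tensor {X X' Y Y' : M.L} {p : X ⟶ M.bangFunctor.obj X}
    {q : Y ⟶ M.bangFunctor.obj Y} {p' : X' ⟶ M.bangFunctor.obj X'}
    {q' : Y' ⟶ M.bangFunctor.obj Y'} {f : X ⟶ X'} {g : Y ⟶ Y'} (hf : IsCoalgHom p p' f)
    (hg : IsCoalgHom q q' g) : IsCoalgHom (coalgTensor p q) (coalgTensor p' q') (f ⊗ₘ g) := by
  unfold IsCoalgHom at *
  rw [coalgTensor, Category.assoc, ← Functor.LaxMonoidal.μ_natural, ← Category.assoc,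
    tensorHom_comp_tensorHom, hf, hg, ← tensorHom_comp_tensorHom, Category.assoc]

/-- The unit of a monoidal adjunction is a monoidal natural transformation; this is its image under
`F`. -/
theorem isCoalgHom_free_μ (Z Z' : M.C) : IsCoalgHom (coalgTensor (M.free Z) (M.free Z'))
    (M.free (Z ⊗ Z')) (Functor.LaxMonoidal.μ M.F Z Z') := by
  unfold IsCoalgHom coalgTensor free
  have h1 := M.adj.unit_app_tensor_comp_map_δ Z Z'
  have h2 : M.adj.unit.app (Z ⊗ Z') = (M.adj.unit.app Z ⊗ₘ M.adj.unit.app Z') ≫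
      Functor.LaxMonoidal.μ M.G _ _ ≫ M.G.map (Functor.LaxMonoidal.μ M.F Z Z') := by
    rw [← Category.assoc, ← h1, Category.assoc, ← M.G.map_comp, Functor.Monoidal.δ_μ, M.G.map_id]
    exact (Category.comp_id _).symm
  rw [h2, M.F.map_comp, M.F.map_comp, ← Category.assoc (Functor.LaxMonoidal.μ M.F Z Z')]
  have h3 := Functor.LaxMonoidal.μ_natural M.F (M.adj.unit.app Z) (M.adj.unit.app Z')
  refine Eq.trans ?_ (congrArg (· ≫ _) h3)
  rw [bangμ, Functor.LaxMonoidal.comp_μ]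
  simp

/-- In the application `a`, `a'` are components of `α` with inverses `b`, `b'`, and `g` is the
inverse of `α` at the sum followed by `coprod.map f f'`. Stating `hg` with `α` on the left avoids
computing that inverse. The two restrictions of `g` along the images of the injections suffice, as
`F` preserves coproducts. -/
theorem isCoalgHom_free_sum {U U' X Y : M.L} {Z Z' : M.C} {a : U ⟶ M.F.obj Z}
    {a' : U' ⟶ M.F.obj Z'} {b : M.F.obj Z ⟶ U}
    {b' : M.F.obj Z' ⟶ U'} (hb : b ≫ a = 𝟙 _) (hb' : b' ≫ a' = 𝟙 _) {f : U ⟶ X} {f' : U' ⟶ Y}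
    {p : X ⟶ M.bangFunctor.obj X} {q : Y ⟶ M.bangFunctor.obj Y}
    (hf : IsCoalgHom (M.free Z) p (b ≫ f)) (hf' : IsCoalgHom (M.free Z') q (b' ≫ f'))
    {g : M.F.obj (Z ⨿ Z') ⟶ X ⨿ Y}
    (hg : (coprod.map a a' ≫ coprodComparison M.F Z Z') ≫ g = coprod.map f f') :
    IsCoalgHom (M.free (Z ⨿ Z')) (coalgSum p q) g := by
  have h1 : M.F.map coprod.inl ≫ g = (b ≫ f) ≫ coprod.inl := by
    have h := congrArg (fun k => b ≫ coprod.inl ≫ k) hg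
    simpa [reassoc_of% hb] using h
  have h2 : M.F.map coprod.inr ≫ g = (b' ≫ f') ≫ coprod.inr := by
    have h := congrArg (fun k => b' ≫ coprod.inr ≫ k) hg
    simpa [reassoc_of% hb'] using h
  have e1 := hf.comp (isCoalgHom_inl p q)
  have e2 := hf'.comp (isCoalgHom_inr p q)
  have e3 := isCoalgHom_map_free (M := M) (coprod.inl : Z ⟶ Z ⨿ Z')
  have e4 := isCoalgHom_map_free (M := M) (coprod.inr : Z' ⟶ Z ⨿ Z')
  rw [← h1] at e1
  rw [← h2] at e2
  unfold IsCoalgHom at *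
  rw [Functor.map_comp, ← Category.assoc, e3] at e1
  rw [Functor.map_comp, ← Category.assoc, e4] at e2
  rw [← cancel_epi (coprodComparison M.F Z Z')]
  refine coprod.hom_ext ?_ ?_
  · simpa using e1
  · simpa using e2

theorem isCoalgHom_free_tensor {U U' X Y : M.L} {Z Z' : M.C} {a : U ⟶ M.F.obj Z}
    {a' : U' ⟶ M.F.obj Z'} {b : M.F.obj Z ⟶ U}
    {b' : M.F.obj Z' ⟶ U'} (hb : b ≫ a = 𝟙 _) (hb' : b' ≫ a' = 𝟙 _) {f : U ⟶ X} {f' : U' ⟶ Y}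
    {p : X ⟶ M.bangFunctor.obj X} {q : Y ⟶ M.bangFunctor.obj Y}
    (hf : IsCoalgHom (M.free Z) p (b ≫ f)) (hf' : IsCoalgHom (M.free Z') q (b' ≫ f'))
    {g : M.F.obj (Z ⊗ Z') ⟶ X ⊗ Y}
    (hg : ((a ⊗ₘ a') ≫ Functor.LaxMonoidal.μ M.F Z Z') ≫ g = f ⊗ₘ f') :
    IsCoalgHom (M.free (Z ⊗ Z')) (coalgTensor p q) g := by
  have h1 : Functor.LaxMonoidal.μ M.F Z Z' ≫ g = (b ≫ f) ⊗ₘ (b' ≫ f') := by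
    rw [← tensorHom_comp_tensorHom, ← hg, Category.assoc, ← Category.assoc,
      tensorHom_comp_tensorHom, hb, hb', id_tensorHom_id, Category.id_comp]
  have e1 := hf.tensor hf'
  rw [← h1] at e1
  have e2 := isCoalgHom_free_μ (M := M) Z Z'
  unfold IsCoalgHom at *
  rw [Functor.map_comp, ← Category.assoc, e2] at e1
  rw [← cancel_epi (Functor.LaxMonoidal.μ M.F Z Z')]
  simpa using e1

/-! ## The coalgebra structures of types -/

/-- The truncations of the coalgebra structures on the interpretations of non-linear types. -/
noncomputable def coalgApprox (M : CPOLNLModel.{v, u}) :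
    ℕ → (A : Ty 0) → (M.Ob A ⟶ M.bangFunctor.obj (M.Ob A))
  | _, .var i => i.elim0
  | n, .sum A B => (coalgSum (M.coalgApprox n A) (M.coalgApprox n B) :
      M.Ob A ⨿ M.Ob B ⟶ M.bangFunctor.obj (M.Ob A ⨿ M.Ob B))
  | n, .tensor A B => (coalgTensor (M.coalgApprox n A) (M.coalgApprox n B) :
      M.Ob A ⊗ M.Ob B ⟶ M.bangFunctor.obj (M.Ob A ⊗ M.Ob B))
  | _, .lolli _ _ => M.bot _ _
  | _, .bang A => M.free (M.G.obj (M.Ob A))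
  | 0, .mu _ => M.bot _ _
  | n + 1, .mu A =>
    M.unfold A ≫ M.coalgApprox n (A.inst (.mu A)) ≫ M.bangFunctor.map (M.fold A)
termination_by n A => (n, sizeOf A)

theorem coalgApprox_sum (n : ℕ) (A B : Ty 0) : M.coalgApprox n (.sum A B) =
    (coalgSum (M.coalgApprox n A) (M.coalgApprox n B) :
      M.Ob A ⨿ M.Ob B ⟶ M.bangFunctor.obj (M.Ob A ⨿ M.Ob B)) := by
  rw [coalgApprox]

theorem coalgApprox_tensor (n : ℕ) (A B : Ty 0) : M.coalgApprox n (.tensor A B) =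
    (coalgTensor (M.coalgApprox n A) (M.coalgApprox n B) :
      M.Ob A ⊗ M.Ob B ⟶ M.bangFunctor.obj (M.Ob A ⊗ M.Ob B)) := by
  rw [coalgApprox]

theorem coalgApprox_lolli (n : ℕ) (A B : Ty 0) :
    M.coalgApprox n (.lolli A B) = M.bot _ _ := by
  rw [coalgApprox]

theorem coalgApprox_bang (n : ℕ) (A : Ty 0) :
    M.coalgApprox n (.bang A) = M.free (M.G.obj (M.Ob A)) := by
  rw [coalgApprox]

theorem coalgApprox_mu_zero (A : Ty 1) : M.coalgApprox 0 (.mu A) = M.bot _ _ := by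
  rw [coalgApprox]

theorem coalgApprox_mu_succ (n : ℕ) (A : Ty 1) : M.coalgApprox (n + 1) (.mu A) =
    M.unfold A ≫ M.coalgApprox n (A.inst (.mu A)) ≫ M.bangFunctor.map (M.fold A) := by
  rw [coalgApprox]

theorem coalgApprox_mono (A : Ty 0) : Monotone fun n => M.coalgApprox n A := by
  refine monotone_nat_of_le_succ fun n => ?_
  induction n, A using Ty.closed_induction with
  | sum n A B hA hB =>
    rw [coalgApprox_sum, coalgApprox_sum]
    exact desc_le (comp_mono hA le_rfl) (comp_mono hB le_rfl)
  | tensor n A B hA hB =>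
    rw [coalgApprox_tensor, coalgApprox_tensor]
    exact comp_mono (tensor_le hA hB) le_rfl
  | lolli n A B _ _ => rw [coalgApprox_lolli]; exact bot_le _
  | bang n A _ => exact ((coalgApprox_bang _ _).trans (coalgApprox_bang _ _).symm).le
  | mu_zero A => rw [coalgApprox_mu_zero]; exact bot_le _
  | mu_succ n A hA =>
    rw [coalgApprox_mu_succ, coalgApprox_mu_succ]
    exact comp_mono le_rfl (comp_mono hA le_rfl)

/-- The coalgebra structures on the interpretations of non-linear types. -/
noncomputable def coalg (M : CPOLNLModel.{v, u}) (A : Ty 0) :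
    M.Ob A ⟶ M.bangFunctor.obj (M.Ob A) :=
  (exists_isSup (coalgApprox_mono (M := M) A)).choose

theorem isSup_coalg (A : Ty 0) : IsSup (fun n => M.coalgApprox n A) (M.coalg A) :=
  (exists_isSup (coalgApprox_mono (M := M) A)).choose_spec

theorem coalg_sum (A B : Ty 0) : M.coalg (.sum A B) = (coalgSum (M.coalg A) (M.coalg B) :
    M.Ob A ⨿ M.Ob B ⟶ M.bangFunctor.obj (M.Ob A ⨿ M.Ob B)) :=
  (isSup_coalg _).unique ((isSup_desc ((isSup_coalg A).comp_right _)
    ((isSup_coalg B).comp_right _)).congr (fun n => coalgApprox_sum n A B) rfl)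

theorem coalg_tensor (A B : Ty 0) : M.coalg (.tensor A B) = (coalgTensor (M.coalg A) (M.coalg B) :
    M.Ob A ⊗ M.Ob B ⟶ M.bangFunctor.obj (M.Ob A ⊗ M.Ob B)) :=
  (isSup_coalg _).unique (((isSup_tensor (isSup_coalg A) (isSup_coalg B)).comp_right _).congr
    (fun n => coalgApprox_tensor n A B) rfl)

theorem coalg_bang (A : Ty 0) : M.coalg (.bang A) = M.free (M.G.obj (M.Ob A)) :=
  (isSup_coalg _).unique ((IsSup.const _).congr (fun n => coalgApprox_bang n A) rfl)

/-- With the equations at the other connectives, this makes compatibility with `coalg` checkable one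
constructor at a time, without reference to `α` or `(|P|)`. -/
theorem coalg_mu (A : Ty 1) : M.coalg (.mu A) =
    M.unfold A ≫ M.coalg (A.inst A.mu) ≫ M.bangFunctor.map (M.fold A) :=
  ((isSup_coalg _).shift 1).unique ((((isSup_coalg (A.inst A.mu)).comp_right _).comp_left _).congr
    (fun n => coalgApprox_mu_succ n A) rfl)

theorem isCoalgHom_fold (A : Ty 1) :
    IsCoalgHom (M.coalg (A.inst A.mu)) (M.coalg A.mu) (M.fold A) := by
  rw [IsCoalgHom, coalg_mu, fold_unfold_assoc]

theorem isCoalgHom_foldSub {n : ℕ} (A : Ty (n + 1)) (σ : Fin n → Ty 0) :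
    IsCoalgHom (M.coalg (A.subst (unrollSub A σ))) (M.coalg (A.mu.subst σ)) (M.foldSub A σ) := by
  have key : ∀ (B : Ty 1) (C : Ty 0) (h : C = B.inst B.mu),
      IsCoalgHom (M.coalg C) (M.coalg B.mu) (eqToHom (congrArg M.Ob h) ≫ M.fold B) := by
    rintro B _ rfl
    simpa using isCoalgHom_fold B
  exact key _ _ (A.subst_liftSub_inst σ (A.mu.subst σ)).symm

theorem map_substMap {n : ℕ} (A : Ty n) (σ : Fin n → Ty 0) {X X' : Fin n → M.Le}
    (f : ∀ i, X i ⟶ X' i) (e : ∀ i, X' i ⟶ M.obj (σ i)) :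
    (M.ty A).map (X := X) (Y := X') f ≫ M.substMap A σ e = M.substMap A σ fun i => f i ≫ e i :=
  (Category.assoc _ _ _).symm.trans (congrArg (· ≫ M.substE A σ)
    ((M.ty A).map_comp (X := X) (Y := X') (Z := fun i => M.obj (σ i)) f e).symm)

/-- The component of `α` at `Z`, as a morphism of `L`. -/
noncomputable def αHom {n : ℕ} (P : Ty n) (h : P.NonLinear) (Z : Fin n → M.Cpe) :
    ((M.ty P).obj ((M.powF n).obj Z)).obj ⟶ M.F.obj ((M.nl P h).obj Z).obj := ((M.α P h).app Z).hom

/-- The inverse of the component of `α` at `Z`. -/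
noncomputable def αInv {n : ℕ} (P : Ty n) (h : P.NonLinear) (Z : Fin n → M.Cpe) :
    M.F.obj ((M.nl P h).obj Z).obj ⟶ ((M.ty P).obj ((M.powF n).obj Z)).obj :=
  proj ((M.α P h).app Z).property

theorem αHom_αInv {n : ℕ} (P : Ty n) (h : P.NonLinear) (Z : Fin n → M.Cpe) :
    M.αHom P h Z ≫ M.αInv P h Z = 𝟙 _ := emb_proj _

theorem αInv_αHom {n : ℕ} (P : Ty n) (h : P.NonLinear) (Z : Fin n → M.Cpe) :
    M.αInv P h Z ≫ M.αHom P h Z = 𝟙 _ :=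
  @proj_hom_isIso _ _ _ _ _ _ (isIso_α_app P h Z)

theorem αHom_αInv_assoc {n : ℕ} (P : Ty n) (h : P.NonLinear) (Z : Fin n → M.Cpe) {W : M.L}
    (f : ((M.ty P).obj ((M.powF n).obj Z)).obj ⟶ W) : M.αHom P h Z ≫ M.αInv P h Z ≫ f = f := by
  rw [← Category.assoc, αHom_αInv, Category.id_comp]

/-- The last factor of a successor stage of `star` is `α` at the body, which `αInv` cancels. The
rest is functoriality of `⟦A⟧`, as `consComparison` has identity components. -/
theorem starApp_succ_substMap {n : ℕ} (A : Ty (n + 1)) (hA : A.NonLinear) (Z : Fin n → M.Cpe)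
    (k : ℕ) (τ : Fin (n + 1) → Ty 0)
    (e : ∀ i, M.Fpe.obj ((consF M.Cpe n).obj
      (Z, seqObj ((Functor.curry.obj (consF M.Cpe n ⋙ M.nl A hA)).obj Z) k) i) ⟶ M.obj (τ i))
    (e' : ∀ i, (consF M.Le n).obj ((M.powF n).obj Z, seqObj ((Functor.curry.obj
      (consF M.Le n ⋙ M.ty A)).obj ((M.powF n).obj Z)) k) i ⟶ M.obj (τ i))
    (h : e' = Fin.cases (starApp (M.αCons A hA) Z k ≫ e 0) fun i => e i.succ) :
    (starApp (M.αCons A hA) Z (k + 1)).hom ≫ M.αInv A hA _ ≫ (M.substMap A τ e).hom =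
      (M.substMap A τ e').hom := by
  have h1 := map_substMap A τ ((M.consComparison n).app
    (Z, seqObj ((Functor.curry.obj (consF M.Cpe n ⋙ M.nl A hA)).obj Z) k)) e
  have h2 := map_substMap A τ ((consF M.Le n).map
    (X := ((M.powF n).obj Z, _)) (Y := ((M.powF n).obj Z, _))
    (𝟙 ((M.powF n).obj Z), starApp (M.αCons A hA) Z k)) (fun i => (M.consComparison n).app
      (Z, seqObj ((Functor.curry.obj (consF M.Cpe n ⋙ M.nl A hA)).obj Z) k) i ≫ e i)
  have h3 : e' = fun i => (consF M.Le n).map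
    (X := ((M.powF n).obj Z, _)) (Y := ((M.powF n).obj Z, _))
    (𝟙 ((M.powF n).obj Z), starApp (M.αCons A hA) Z k) i ≫ (M.consComparison n).app
      (Z, seqObj ((Functor.curry.obj (consF M.Cpe n ⋙ M.nl A hA)).obj Z) k) i ≫ e i := by
    rw [h]
    funext i
    induction i using Fin.cases with
    | zero => exact congrArg (_ ≫ ·) (Category.id_comp _).symm
    | succ i => exact ((Category.id_comp _).trans (Category.id_comp _)).symm
  have glue : ∀ {U V W W' : M.L} {Z : M.L} (a : U ⟶ V) (b : V ⟶ W) (c : W ⟶ W') (c' : W' ⟶ W)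
      (d : W ⟶ Z), c ≫ c' = 𝟙 _ → (a ≫ b ≫ c) ≫ c' ≫ d = a ≫ b ≫ d := by
    intro U V W W' Z a b c c' d h
    simp [reassoc_of% h]
  rw [h3, ← h2, ← h1]
  exact glue _ _ _ _ _ (αHom_αInv A hA _)

/-- The inverse of `α` carries the free structure to `coalg`, generalised to open types for the sake
of the induction. The scheme is that of `substMap_approxSup`: at `μ` the stages are handled by
induction along the initial sequence, and the result on the colimit follows by joint epimorphy.
Taking an arbitrary `g` with `hg` keeps the statement free of inverses. -/
theorem isCoalgHom_substMap {n : ℕ} (P : Ty n) (hP : P.NonLinear) (σ : Fin n → Ty 0)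
    (Z : Fin n → M.Cpe) (e : ∀ i, M.Fpe.obj (Z i) ⟶ M.obj (σ i))
    (he : ∀ i, IsCoalgHom (M.free (Z i).obj) (M.coalg (σ i)) (e i).hom)
    (g : M.F.obj ((M.nl P hP).obj Z).obj ⟶ M.Ob (P.subst σ))
    (hg : M.αHom P hP Z ≫ g = (M.substMap P σ e).hom) :
    IsCoalgHom (M.free ((M.nl P hP).obj Z).obj) (M.coalg (P.subst σ)) g := by
  induction P with
  | var i =>
    rw [substMap_var] at hg
    obtain rfl : g = (e i).hom := (Category.id_comp _).symm.trans hg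
    exact he i
  | sum A B hA hB =>
    rw [substMap_sum] at hg
    exact (isCoalgHom_free_sum (a := M.αHom A hP.1 Z) (a' := M.αHom B hP.2 Z)
      (αInv_αHom A hP.1 Z) (αInv_αHom B hP.2 Z) (hA hP.1 σ Z e he _ (αHom_αInv_assoc _ _ _ _))
      (hB hP.2 σ Z e he _ (αHom_αInv_assoc _ _ _ _)) hg).trans
        (congrArg (g ≫ ·) (coalg_sum _ _)).symm
  | tensor A B hA hB =>
    rw [substMap_tensor] at hg
    exact (isCoalgHom_free_tensor (a := M.αHom A hP.1 Z) (a' := M.αHom B hP.2 Z)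
      (αInv_αHom A hP.1 Z) (αInv_αHom B hP.2 Z) (hA hP.1 σ Z e he _ (αHom_αInv_assoc _ _ _ _))
      (hB hP.2 σ Z e he _ (αHom_αInv_assoc _ _ _ _)) hg).trans
        (congrArg (g ≫ ·) (coalg_tensor _ _)).symm
  | lolli => exact hP.elim
  | bang A hA =>
    rw [substMap_bang] at hg
    obtain rfl : g = _ := (Category.id_comp _).symm.trans hg
    exact (isCoalgHom_bang_map (M.substMap A σ e).hom).trans
      (congrArg (_ ≫ ·) (coalg_bang _)).symm
  | mu A hA =>
    have hk : ∀ k (g : M.F.obj (seqObj ((Functor.curry.obj (consF M.Cpe _ ⋙ M.nl A hP)).obj Z)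
        k).obj ⟶ M.Ob (A.mu.subst σ)),
        (starApp (M.αCons A hP) Z k).hom ≫ g = (M.substSeq A σ e k).hom →
          IsCoalgHom (M.free _) (M.coalg (A.mu.subst σ)) g := by
      intro k
      induction k with
      | zero => exact fun g _ => M.isInitialFCpe.hom_ext _ _
      | succ k ih =>
        intro g hg
        have := isIso_starApp (M.αCons A hP) (isIso_αCons_app (isIso_α_app A hP)) Z k
        have hiso := isIso_starApp (M.αCons A hP) (isIso_αCons_app (isIso_α_app A hP)) Z (k + 1)
        -- The stage-`k` map transported to the non-linear side. It takes the place of the bound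
        -- variable when the induction hypothesis for the body is applied.
        let d := inv (starApp (M.αCons A hP) Z k) ≫ M.substSeq A σ e k
        have hd : starApp (M.αCons A hP) Z k ≫ d = M.substSeq A σ e k :=
          IsIso.hom_inv_id_assoc _ _
        have hd' := ih d.hom (congrArg InducedWideCategory.Hom.hom hd)
        let e' : ∀ i, M.Fpe.obj ((consF M.Cpe _).obj (Z, seqObj ((Functor.curry.obj
            (consF M.Cpe _ ⋙ M.nl A hP)).obj Z) k) i) ⟶ M.obj (unrollSub A σ i) :=
          fun i => Fin.cases (motive := fun i => M.Fpe.obj ((consF M.Cpe _).obj (Z, seqObj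
            ((Functor.curry.obj (consF M.Cpe _ ⋙ M.nl A hP)).obj Z) k) i) ⟶
              M.obj (unrollSub A σ i)) d e i
        have h1 := hA hP (unrollSub A σ) _ e' (fun i => by
          induction i using Fin.cases with
          | zero => exact hd'
          | succ i => exact he i) _ (αHom_αInv_assoc A hP _ _)
        have h2 := starApp_succ_substMap A hP Z k (unrollSub A σ) e'
          (consMap A σ e (M.substSeq A σ e k)) (by
            funext i
            induction i using Fin.cases with
            | zero => exact hd.symm
            | succ i => rfl)
        have h3 := h1.comp (isCoalgHom_foldSub A σ)
        have glue : ∀ {U V W W' W'' : M.L} {s : U ⟶ V} {a : V ⟶ W} {b : W ⟶ W'} {f : W' ⟶ W''}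
            {c : U ⟶ W'} {g : V ⟶ W''}, IsIso s → s ≫ a ≫ b = c → s ≫ g = c ≫ f →
              g = (a ≫ b) ≫ f := by
          intro U V W W' W'' s a b f c g hs h h'
          rw [← cancel_epi s, h', ← h]
          simp
        rw [glue (inferInstanceAs (IsIso (starApp (M.αCons A hP) Z (k + 1)).hom)) h2
          (hg.trans (substSeq_succ A σ e k))]
        exact h3
    have hι := fun k => congrArg InducedWideCategory.Hom.hom (seqι_daggerTrans (M.αCons A hP) Z k)
    have : Epi (M.αHom A.mu hP Z) :=
      have := isIso_α_app A.mu hP Z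
      inferInstanceAs (Epi ((M.α A.mu hP).app Z).hom)
    rw [IsCoalgHom, ← cancel_epi (M.αHom A.mu hP Z)]
    refine colimit_hom_ext (seq ((Functor.curry.obj (consF M.Le _ ⋙ M.ty A)).obj
      ((M.powF _).obj Z))) fun k => ?_
    have hs : (starApp (M.αCons A hP) Z k).hom ≫ M.F.map (seqι ((Functor.curry.obj
        (consF M.Cpe _ ⋙ M.nl A hP)).obj Z) k).hom ≫ g = (M.substSeq A σ e k).hom := by
      have h1 := congrArg InducedWideCategory.Hom.hom (seqι_substMap A σ e k)
      refine (Category.assoc _ _ _).symm.trans ((congrArg (· ≫ g) (hι k).symm).trans ?_)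
      exact (Category.assoc _ _ _).trans ((congrArg (_ ≫ ·) hg).trans h1)
    have hc := hk k _ hs
    have hm := isCoalgHom_map_free (M := M) (seqι ((Functor.curry.obj
      (consF M.Cpe _ ⋙ M.nl A hP)).obj Z) k).hom
    have glue : ∀ {U V W : M.L} {Z Z' : M.C} {i : U ⟶ V} {s : U ⟶ M.F.obj Z}
        {a : V ⟶ M.F.obj Z'} {m : Z ⟶ Z'} {g : M.F.obj Z' ⟶ W} {c : W ⟶ M.bangFunctor.obj W},
        i ≫ a = s ≫ M.F.map m → IsCoalgHom (M.free Z) (M.free Z') (M.F.map m) →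
          IsCoalgHom (M.free Z) c (M.F.map m ≫ g) →
            i ≫ a ≫ M.free Z' ≫ M.bangFunctor.map g = i ≫ a ≫ g ≫ c := by
      intro U V W Z Z' i s a m g c h1 h2 h3
      unfold IsCoalgHom at h2 h3
      rw [Functor.map_comp, ← Category.assoc, h2] at h3
      rw [← Category.assoc i, h1, ← Category.assoc i, h1]
      simpa using congrArg (s ≫ ·) h3
    exact glue (hι k) hm hc

theorem isCoalgHom_alphaInv (P : Ty 0) (hP : P.NonLinear) :
    IsCoalgHom (M.free (M.NOb P hP)) (M.coalg P) (M.alphaInv P hP) := by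
  have h1 : M.obj P = M.obj (P.subst .var) := by rw [Ty.subst_var]
  have h := isCoalgHom_substMap (M := M) P hP .var Fin.elim0 (fun i => i.elim0) (fun i => i.elim0)
    _ (αHom_αInv_assoc P hP _ _)
  have key : ∀ (B : Ty 0) (hB : B = P) (h : M.obj P = M.obj B),
      IsCoalgHom (M.free (M.NOb P hP)) (M.coalg B) (M.alphaInv P hP ≫ (eqToHom h).hom) →
        IsCoalgHom (M.free (M.NOb P hP)) (M.coalg P) (M.alphaInv P hP) := by
    rintro _ rfl _ h
    rwa [eqToHom_refl, emb_id_hom, Category.comp_id] at h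
  refine key _ P.subst_var h1 ?_
  rwa [← substMap_closed P .var (X := M.pt) (fun i => i.elim0) h1]

/-- Promotion is the coalgebra structure. -/
theorem promote_alpha (P : Ty 0) (hP : P.NonLinear) :
    M.promote (M.alpha P hP) (M.alphaInv P hP) = M.coalg P := by
  have h := congrArg (M.alpha P hP ≫ ·) (isCoalgHom_alphaInv (M := M) P hP)
  refine Eq.trans ?_ (h.trans ?_)
  · rfl
  · exact (Category.assoc _ _ _).symm.trans
      ((congrArg (· ≫ M.coalg P) (alpha_alphaInv P hP)).trans (Category.id_comp _))

end CPOLNLModel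
end LNLFPC

namespace LNLFPC
open CategoryTheory CategoryTheory.Limits OmegaCompletePartialOrder MonoidalCategory
open CartesianMonoidalCategory SemiCartesianMonoidalCategory

namespace CPOLNLModel

variable {M : CPOLNLModel.{v, u}}

/-! ## Elements that are coalgebra morphisms -/

/-- The element `d` of an object equipped with `c : X ⟶ !X` can be promoted. -/
abbrev IsNice {X : M.L} (c : X ⟶ M.bangFunctor.obj X) (d : 𝟙_ M.L ⟶ X) : Prop :=
  IsCoalgHom M.bangε c d

/-- Since the adjunction is monoidal, the unit `I ⟶ !I` is the free structure on `F 1`, conjugated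
by `F 1 ≅ I`. -/
theorem bangε_eq : M.bangε = Functor.LaxMonoidal.ε M.F ≫ M.free (𝟙_ M.C) ≫
    M.bangFunctor.map (Functor.OplaxMonoidal.η M.F) := by
  rw [bangε, Functor.LaxMonoidal.comp_ε, ← M.adj.unit_app_unit_comp_map_η, M.F.map_comp]
  rfl

theorem isNice_ε : IsNice (M.free (𝟙_ M.C)) (Functor.LaxMonoidal.ε M.F) := by
  unfold IsNice IsCoalgHom
  rw [bangε_eq, Category.assoc, Category.assoc, ← Functor.map_comp]
  simp

theorem isNice_bangε : IsNice (M.free (M.G.obj (𝟙_ M.L))) M.bangε := by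
  have h := isNice_ε.comp (isCoalgHom_map_free (M := M) (Functor.LaxMonoidal.ε M.G))
  rwa [← Functor.LaxMonoidal.comp_ε] at h

theorem isNice_bang {X : M.L} (d : 𝟙_ M.L ⟶ X) :
    IsNice (M.free (M.G.obj X)) (M.bangε ≫ M.bangFunctor.map d) :=
  isNice_bangε.comp (isCoalgHom_bang_map d)

@[simp] theorem bangε_counit : M.bangε ≫ M.adj.counit.app (𝟙_ M.L) = 𝟙 _ := by
  rw [bangε_eq, Category.assoc, Category.assoc]
  have h1 := M.adj.counit.naturality (Functor.OplaxMonoidal.η M.F)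
  have h2 := M.adj.left_triangle_components (𝟙_ M.C)
  refine (congrArg (fun k => _ ≫ _ ≫ k) h1).trans ?_
  refine (congrArg (_ ≫ ·) (Category.assoc _ _ _).symm).trans ?_
  refine (congrArg (fun k => _ ≫ k ≫ _) h2).trans ?_
  simp

@[simp] theorem bangε_map_counit {X : M.L} (d : 𝟙_ M.L ⟶ X) :
    (M.bangε ≫ M.bangFunctor.map d) ≫ M.adj.counit.app X = d := by
  have h := M.adj.counit.naturality d
  rw [Category.assoc]
  refine (congrArg (_ ≫ ·) h).trans ?_
  refine (Category.assoc _ _ _).symm.trans ((congrArg (· ≫ _) bangε_counit).trans ?_)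
  exact Category.id_comp _

theorem IsNice.pairElt {X Y : M.L} {p : X ⟶ M.bangFunctor.obj X} {q : Y ⟶ M.bangFunctor.obj Y}
    {d : 𝟙_ M.L ⟶ X} {e : 𝟙_ M.L ⟶ Y} (hd : IsNice p d) (he : IsNice q e) :
    IsNice (coalgTensor p q) (d ⊙ e) := by
  refine IsCoalgHom.comp (q := coalgTensor M.bangε M.bangε) ?_ (hd.tensor he)
  have h := Functor.LaxMonoidal.left_unitality_inv (M.G ⋙ M.F) (𝟙_ M.L)
  rw [IsCoalgHom, coalgTensor, ← h, leftUnitor_inv_naturality_assoc,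
    MonoidalCategory.tensorHom_def']
  simp

/-! ### Discarding and copying of promotable elements -/

section Promote

variable {X : M.L} {Z : M.C} {a : X ⟶ M.F.obj Z} {a' : M.F.obj Z ⟶ X} {d : 𝟙_ M.L ⟶ X}

theorem promote_eq : M.promote a a' = a ≫ M.free Z ≫ M.bangFunctor.map a' := rfl

/-- Both `a` and its inverse are coalgebra morphisms, since `M.promote a a'` is by construction the
conjugate of the free structure. -/
theorem isNice_promote_iff (h : a ≫ a' = 𝟙 _) (h' : a' ≫ a = 𝟙 _) :
    IsNice (M.promote a a') d ↔ IsNice (M.free Z) (d ≫ a) := by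
  have h1 : IsCoalgHom (M.promote a a') (M.free Z) a := by
    rw [IsCoalgHom, promote_eq, Category.assoc, Category.assoc, ← Functor.map_comp, h',
      M.bangFunctor.map_id, Category.comp_id]
  have h2 : IsCoalgHom (M.free Z) (M.promote a a') a' := by
    rw [IsCoalgHom, promote_eq, ← Category.assoc a', h', Category.id_comp]
  refine ⟨fun hd => hd.comp h1, fun hd => ?_⟩
  have := hd.comp h2
  rwa [Category.assoc, h, Category.comp_id] at this

/-- Compatibility with `η` forces the element, once mapped into `F G F Z`, to come from a point of
`C`. Maps of the form `F c` respect the comonoid structures, and `free Z` is split by the counit, so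
the original element can be discarded and copied as well. -/
theorem IsNice.exists_element {e : 𝟙_ M.L ⟶ M.F.obj Z} (h : IsNice (M.free Z) e) :
    ∃ c : 𝟙_ M.C ⟶ M.G.obj (M.F.obj Z),
      e ≫ M.free Z = Functor.LaxMonoidal.ε M.F ≫ M.F.map c := by
  refine ⟨Functor.LaxMonoidal.ε M.G ≫ M.G.map e, ?_⟩
  rw [IsNice, IsCoalgHom] at h
  rw [← h, bangε, Functor.LaxMonoidal.comp_ε, M.F.map_comp, Category.assoc]
  rfl

theorem free_toUnit (Z : M.C) :
    M.free Z ≫ M.F.map (toUnit (M.G.obj (M.F.obj Z))) = M.F.map (toUnit Z) :=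
  (M.F.map_comp _ _).symm.trans (congrArg M.F.map (toUnit_unique _ _))

theorem free_counit (Z : M.C) : M.free Z ≫ M.adj.counit.app (M.F.obj Z) = 𝟙 _ :=
  M.adj.left_triangle_components Z

/-- The comultiplication of the comonoid `F Z`. -/
def dup (M : CPOLNLModel.{v, u}) (Z : M.C) : M.F.obj Z ⟶ M.F.obj Z ⊗ M.F.obj Z :=
  M.F.map (lift (𝟙 Z) (𝟙 Z)) ≫ Functor.OplaxMonoidal.δ M.F Z Z

theorem map_dup {Z Z' : M.C} (f : Z ⟶ Z') :
    M.F.map f ≫ M.dup Z' = M.dup Z ≫ (M.F.map f ⊗ₘ M.F.map f) := by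
  rw [dup, dup, Category.assoc, Functor.OplaxMonoidal.δ_natural, ← Category.assoc,
    ← Category.assoc, ← M.F.map_comp, ← M.F.map_comp]
  congr 2
  simp

theorem ε_dup : Functor.LaxMonoidal.ε M.F ≫ M.dup (𝟙_ M.C) =
    Functor.LaxMonoidal.ε M.F ⊙ Functor.LaxMonoidal.ε M.F := by
  have h : lift (𝟙 (𝟙_ M.C)) (𝟙 (𝟙_ M.C)) = (λ_ (𝟙_ M.C)).inv := by
    rw [← cancel_mono (λ_ (𝟙_ M.C)).hom]
    exact toUnit_unique _ _
  have h1 := Functor.LaxMonoidal.left_unitality_inv M.F (𝟙_ M.C)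
  rw [dup, h, ← h1]
  simp [CPOLNLModel.pairElt, MonoidalCategory.tensorHom_def']

theorem IsNice.discard (ha : a ≫ a' = 𝟙 _) (ha' : a' ≫ a = 𝟙 _) (h : IsNice (M.promote a a') d) :
    d ≫ M.discard a = 𝟙 _ := by
  obtain ⟨c, hc⟩ := ((isNice_promote_iff ha ha').1 h).exists_element
  have h2 : M.F.map c ≫ M.F.map (toUnit (M.G.obj (M.F.obj Z))) = 𝟙 _ := by
    rw [← M.F.map_comp, ← M.F.map_id]
    exact congrArg M.F.map (toUnit_unique _ _)
  have glue : ∀ {A B C D E : M.L} {e : A ⟶ B} {f : B ⟶ C} {t : C ⟶ D} {x : D ⟶ E} {y : A ⟶ D}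
      {z : D ⟶ C}, e ≫ f = y ≫ z → z ≫ t = 𝟙 _ → e ≫ (f ≫ t) ≫ x = y ≫ x := by
    intro A B C D E e f t x y z h1 h2
    rw [Category.assoc, ← Category.assoc, h1, Category.assoc, ← Category.assoc z, h2,
      Category.id_comp]
  rw [CPOLNLModel.discard, ← free_toUnit, ← Category.assoc d]
  exact (glue hc h2).trans (Functor.Monoidal.ε_η M.F)

/-- After `free` the element comes from a point of `C`, which naturality of the diagonal duplicates.
The counit on both factors then removes `free`. -/
theorem IsNice.copy (ha : a ≫ a' = 𝟙 _) (ha' : a' ≫ a = 𝟙 _) (h : IsNice (M.promote a a') d) :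
    d ≫ M.copy a a' = d ⊙ d := by
  obtain ⟨c, hc⟩ := ((isNice_promote_iff ha ha').1 h).exists_element
  have h1 : (d ≫ a) ≫ M.free Z ≫ M.dup _ = ((d ≫ a) ⊙ (d ≫ a)) ≫ (M.free Z ⊗ₘ M.free Z) := by
    rw [pairElt_tensor, hc, ← Category.assoc, hc, Category.assoc, map_dup, ← Category.assoc, ε_dup,
      pairElt_tensor]
  have h2 : M.free Z ≫ M.dup _ = M.dup Z ≫ (M.free Z ⊗ₘ M.free Z) := map_dup _
  have h3 := congrArg (· ≫ (M.adj.counit.app (M.F.obj Z) ⊗ₘ M.adj.counit.app (M.F.obj Z))) h1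
  rw [h2] at h3
  have glue : ∀ {A B C : M.L} {x : A ⟶ B ⊗ B} {f : B ⟶ C} {g : C ⟶ B}, f ≫ g = 𝟙 _ →
      (x ≫ (f ⊗ₘ f)) ≫ (g ⊗ₘ g) = x := by
    intro A B C x f g h
    simp [h]
  have glue' : ∀ {A B C D : M.L} {y : D ⟶ A} {x : A ⟶ B ⊗ B} {f : B ⟶ C} {g : C ⟶ B}, f ≫ g = 𝟙 _ →
      (y ≫ x ≫ (f ⊗ₘ f)) ≫ (g ⊗ₘ g) = y ≫ x := by
    intro A B C D y x f g h
    simp [h]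
  have h4 : (d ≫ a) ≫ M.dup Z = (d ≫ a) ⊙ (d ≫ a) :=
    (glue' (free_counit Z)).symm.trans (h3.trans (glue (free_counit Z)))
  have h5 : d ≫ M.copy a a' = ((d ≫ a) ≫ M.dup Z) ≫ (a' ⊗ₘ a') := by
    simp [CPOLNLModel.copy, dup]
  rw [h5, h4, pairElt_tensor, Category.assoc, ha, Category.comp_id]

/-- If `d` were `⊥`, discarding it would give both `id_I` and `⊥`. -/
theorem IsNice.ne_bot (hM : M.ComputationallyAdequate) (ha : a ≫ a' = 𝟙 _) (ha' : a' ≫ a = 𝟙 _)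
    (h : IsNice (M.promote a a') d) : d ≠ M.bot _ _ := by
  rintro rfl
  refine hM.id_ne_bot ?_
  rw [← h.discard ha ha', bot_comp]

end Promote

end CPOLNLModel
end LNLFPC

namespace LNLFPC
open CategoryTheory CategoryTheory.Limits OmegaCompletePartialOrder MonoidalCategory

namespace CPOLNLModel

variable {M : CPOLNLModel.{v, u}}

/-! ## Elements of contexts -/

@[simp] theorem alphaCtx_alphaCtxInv {n : ℕ} (Φ : Ctx n) (h : Φ.NonLinear) :
    M.alphaCtx Φ h ≫ M.alphaCtxInv Φ h = 𝟙 _ := by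
  induction Φ with
  | nil => exact Functor.Monoidal.ε_η M.F
  | snoc Φ P ih =>
    have h1 := ih h.1
    have h2 := alpha_alphaInv (M := M) P h.2
    have key : ∀ {X Y : M.L} {Z W : M.C} {a : X ⟶ M.F.obj Z} {a' : M.F.obj Z ⟶ X}
        {b : Y ⟶ M.F.obj W} {b' : M.F.obj W ⟶ Y}, a ≫ a' = 𝟙 _ → b ≫ b' = 𝟙 _ →
        ((a ⊗ₘ b) ≫ Functor.LaxMonoidal.μ M.F _ _) ≫ Functor.OplaxMonoidal.δ M.F _ _ ≫
          (a' ⊗ₘ b') = 𝟙 _ := by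
      intro X Y Z W a a' b b' h1 h2
      simp [h1, h2]
    exact key h1 h2
  | skip Φ ih => exact ih h

@[simp] theorem alphaCtxInv_alphaCtx {n : ℕ} (Φ : Ctx n) (h : Φ.NonLinear) :
    M.alphaCtxInv Φ h ≫ M.alphaCtx Φ h = 𝟙 _ := by
  induction Φ with
  | nil => exact Functor.Monoidal.η_ε M.F
  | snoc Φ P ih =>
    have h1 := ih h.1
    have h2 := alphaInv_alpha (M := M) P h.2
    have key : ∀ {X Y : M.L} {Z W : M.C} {a : X ⟶ M.F.obj Z} {a' : M.F.obj Z ⟶ X}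
        {b : Y ⟶ M.F.obj W} {b' : M.F.obj W ⟶ Y}, a' ≫ a = 𝟙 _ → b' ≫ b = 𝟙 _ →
        (Functor.OplaxMonoidal.δ M.F _ _ ≫ (a' ⊗ₘ b')) ≫
        ((a ⊗ₘ b) ≫ Functor.LaxMonoidal.μ M.F _ _) = 𝟙 _ := by
      intro X Y Z W a a' b b' h1 h2
      simp [reassoc_of% tensorHom_comp_tensorHom, h1, h2]
    exact key h1 h2
  | skip Φ ih => exact ih h

/-- `Env V Γ γ d` : the terms `γ` and the element `d` of `⟦Γ⟧` are built from terms
and elements that are related by `V`. -/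
inductive Env {k : ℕ} (V : (A : Ty 0) → (𝟙_ M.L ⟶ M.Ob A) → Tm k → Prop) :
    {n : ℕ} → (Γ : Ctx n) → (Fin n → Tm k) → (𝟙_ M.L ⟶ M.ctx Γ) → Prop
  | nil (γ : Fin 0 → Tm k) : Env V .nil γ (𝟙 (𝟙_ M.L))
  | snoc {n : ℕ} {Γ : Ctx n} {γ : Fin n → Tm k} {d : 𝟙_ M.L ⟶ M.ctx Γ} {A : Ty 0}
      {e : 𝟙_ M.L ⟶ M.Ob A} {v : Tm k} : Env V Γ γ d → V A e v →
        Env V (Γ.snoc A) (Fin.cases v γ) (d ⊙ e)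
  | skip {n : ℕ} {Γ : Ctx n} {γ : Fin n → Tm k} {d : 𝟙_ M.L ⟶ M.ctx Γ} (v : Tm k) :
      Env V Γ γ d → Env V Γ.skip (Fin.cases v γ) d

/-- The elements of non-linear types that are related to terms by `V` can be promoted. -/
def Promotable {k : ℕ} (V : (A : Ty 0) → (𝟙_ M.L ⟶ M.Ob A) → Tm k → Prop) : Prop :=
  ∀ {P : Ty 0} {d : 𝟙_ M.L ⟶ M.Ob P} {v : Tm k}, P.NonLinear → V P d v → IsNice (M.coalg P) d

namespace Env

variable {k : ℕ} {V : (A : Ty 0) → (𝟙_ M.L ⟶ M.Ob A) → Tm k → Prop}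

/-- Contexts are interpreted by iterated tensors, and both `μ` of `F` and the pairing of elements
respect the coalgebra structures. So the context maps act on `d` as on a single promotable element.
-/
theorem isNice (hV : Promotable V) {n : ℕ} {Φ : Ctx n} {γ : Fin n → Tm k} {d : 𝟙_ M.L ⟶ M.ctx Φ} (h : Env V Φ γ d)
    (hΦ : Φ.NonLinear) : IsNice (M.promote (M.alphaCtx Φ hΦ) (M.alphaCtxInv Φ hΦ)) d := by
  induction h with
  | nil γ =>
    refine (isNice_promote_iff (alphaCtx_alphaCtxInv _ _) (alphaCtxInv_alphaCtx _ _)).2 ?_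
    have key : IsNice (M.free (𝟙_ M.C)) (𝟙 _ ≫ Functor.LaxMonoidal.ε M.F) := by
      rw [Category.id_comp]
      exact isNice_ε
    exact key
  | @snoc n Γ γ d A e v h he ih =>
    refine (isNice_promote_iff (alphaCtx_alphaCtxInv _ _) (alphaCtxInv_alphaCtx _ _)).2 ?_
    have h1 := (isNice_promote_iff (alphaCtx_alphaCtxInv _ _) (alphaCtxInv_alphaCtx _ _)).1
      (ih hΦ.1)
    have h2 := hV hΦ.2 he
    rw [← promote_alpha A hΦ.2, isNice_promote_iff (alpha_alphaInv _ _) (alphaInv_alpha _ _)] at h2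
    have key : ∀ {X Y : M.L} {Z W : M.C} {d : 𝟙_ M.L ⟶ X} {e : 𝟙_ M.L ⟶ Y} {a : X ⟶ M.F.obj Z}
        {b : Y ⟶ M.F.obj W}, IsNice (M.free Z) (d ≫ a) → IsNice (M.free W) (e ≫ b) →
          IsNice (M.free (Z ⊗ W)) ((d ⊙ e) ≫ (a ⊗ₘ b) ≫ Functor.LaxMonoidal.μ M.F _ _) := by
      intro X Y Z W d e a b h1 h2
      rw [pairElt_tensor_assoc]
      exact (h1.pairElt h2).comp (isCoalgHom_free_μ Z W)
    exact key h1 h2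
  | skip v h ih => exact ih hΦ

theorem discard_eq (hV : Promotable V) {n : ℕ} {Φ : Ctx n} {γ : Fin n → Tm k} {d : 𝟙_ M.L ⟶ M.ctx Φ} (h : Env V Φ γ d)
    (hΦ : Φ.NonLinear) : d ≫ M.discard (M.alphaCtx Φ hΦ) = 𝟙 _ :=
  IsNice.discard (alphaCtx_alphaCtxInv _ _) (alphaCtxInv_alphaCtx _ _) (h.isNice hV hΦ)

theorem lookup (hV : Promotable V) {n : ℕ} {Γ : Ctx n} {i : Fin n} {A : Ty 0} {γ : Fin n → Tm k}
    {d : 𝟙_ M.L ⟶ M.ctx Γ} (h : Env V Γ γ d) (l : Lookup Γ i A) : V A (d ≫ M.lookup l) (γ i) := by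
  induction h with
  | nil γ => exact i.elim0
  | @snoc n Γ γ d B e v h he ih =>
    cases l with
    | here hΦ =>
      have h1 := h.discard_eq hV hΦ
      have key : ∀ {X Y : M.L} {d : 𝟙_ M.L ⟶ X} {e : 𝟙_ M.L ⟶ Y} {a : X ⟶ 𝟙_ M.L},
          d ≫ a = 𝟙 _ → (d ⊙ e) ≫ (a ▷ Y) ≫ (λ_ Y).hom = e := by
        intro X Y d e a h
        simp [h]
      exact (congrArg (fun t => V A t v) (key h1)).mpr he
    | there hP l =>
      have h1 := hV hP he
      rw [← promote_alpha B hP] at h1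
      have h2 := IsNice.discard (alpha_alphaInv _ _) (alphaInv_alpha _ _) h1
      have key : ∀ {X Y Z : M.L} {d : 𝟙_ M.L ⟶ X} {e : 𝟙_ M.L ⟶ Y} {a : X ⟶ Z} {b : Y ⟶ 𝟙_ M.L},
          e ≫ b = 𝟙 _ → (d ⊙ e) ≫ (a ⊗ₘ b) ≫ (ρ_ Z).hom = d ≫ a := by
        intro X Y Z d e a b h
        simp [h]
      exact (congrArg (fun t => V A t _) (key h2)).mpr (ih l)
  | skip v h ih =>
    cases l with
    | skip l => exact ih l

/-- A shared variable has non-linear type, so its element is promotable and copying it yields two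
equal components. An unshared variable is only moved past the others by the symmetry. -/
theorem split (hV : Promotable V) {n : ℕ} {Δ Δ₁ Δ₂ : Ctx n} {γ : Fin n → Tm k} {d : 𝟙_ M.L ⟶ M.ctx Δ}
    (h : Env V Δ γ d) (s : Split Δ Δ₁ Δ₂) : ∃ (d₁ : 𝟙_ M.L ⟶ M.ctx Δ₁) (d₂ : 𝟙_ M.L ⟶ M.ctx Δ₂),
      Env V Δ₁ γ d₁ ∧ Env V Δ₂ γ d₂ ∧ d ≫ M.split s = d₁ ⊙ d₂ := by
  induction h with
  | nil γ =>
    cases s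
    refine ⟨_, _, .nil γ, .nil γ, ?_⟩
    refine (Category.id_comp _).trans ?_
    have key : (λ_ (𝟙_ M.L)).inv = 𝟙 (𝟙_ M.L) ⊙ 𝟙 (𝟙_ M.L) := by simp [CPOLNLModel.pairElt]
    exact key
  | @snoc n Γ γ d A e v h he ih =>
    cases s with
    | both hP s =>
      obtain ⟨d₁, d₂, h1, h2, h3⟩ := ih s
      refine ⟨_, _, h1.snoc he, h2.snoc he, ?_⟩
      have h4 := hV hP he
      rw [← promote_alpha A hP] at h4
      have h5 := IsNice.copy (alpha_alphaInv _ _) (alphaInv_alpha _ _) h4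
      have key : ∀ {X X₁ X₂ Y : M.L} {d : 𝟙_ M.L ⟶ X} {d₁ : 𝟙_ M.L ⟶ X₁} {d₂ : 𝟙_ M.L ⟶ X₂}
          {e : 𝟙_ M.L ⟶ Y} {a : X ⟶ X₁ ⊗ X₂} {b : Y ⟶ Y ⊗ Y}, d ≫ a = d₁ ⊙ d₂ → e ≫ b = e ⊙ e →
          (d ⊙ e) ≫ (a ⊗ₘ b) ≫ tensorμ _ _ _ _ = (d₁ ⊙ e) ⊙ (d₂ ⊙ e) := by
        intro X X₁ X₂ Y d d₁ d₂ e a b h h'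
        simp [h, h']
      exact key h3 h5
    | left s =>
      obtain ⟨d₁, d₂, h1, h2, h3⟩ := ih s
      refine ⟨_, _, h1.snoc he, h2.skip v, ?_⟩
      have key : ∀ {X X₁ X₂ Y : M.L} {d : 𝟙_ M.L ⟶ X} {d₁ : 𝟙_ M.L ⟶ X₁} {d₂ : 𝟙_ M.L ⟶ X₂}
          {e : 𝟙_ M.L ⟶ Y} {a : X ⟶ X₁ ⊗ X₂}, d ≫ a = d₁ ⊙ d₂ →
          (d ⊙ e) ≫ (a ▷ Y) ≫ (α_ X₁ X₂ Y).hom ≫ (X₁ ◁ (β_ X₂ Y).hom) ≫ (α_ X₁ Y X₂).inv =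
            (d₁ ⊙ e) ⊙ d₂ := by
        intro X X₁ X₂ Y d d₁ d₂ e a h
        simp [h]
      exact key h3
    | right s =>
      obtain ⟨d₁, d₂, h1, h2, h3⟩ := ih s
      refine ⟨_, _, h1.skip v, h2.snoc he, ?_⟩
      have key : ∀ {X X₁ X₂ Y : M.L} {d : 𝟙_ M.L ⟶ X} {d₁ : 𝟙_ M.L ⟶ X₁} {d₂ : 𝟙_ M.L ⟶ X₂}
          {e : 𝟙_ M.L ⟶ Y} {a : X ⟶ X₁ ⊗ X₂}, d ≫ a = d₁ ⊙ d₂ →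
          (d ⊙ e) ≫ (a ▷ Y) ≫ (α_ X₁ X₂ Y).hom = d₁ ⊙ (d₂ ⊙ e) := by
        intro X X₁ X₂ Y d d₁ d₂ e a h
        simp [h]
      exact key h3
  | skip v h ih =>
    cases s with
    | skip s =>
      obtain ⟨d₁, d₂, h1, h2, h3⟩ := ih s
      exact ⟨d₁, d₂, h1.skip v, h2.skip v, h3⟩

end Env

end CPOLNLModel
end LNLFPC

namespace LNLFPC
open CategoryTheory CategoryTheory.Limits OmegaCompletePartialOrder MonoidalCategory

/-! ## Evaluation -/

namespace Tm

theorem Eval.isValue {n : ℕ} {m v : Tm n} (h : Eval m v) : IsValue v := by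
  induction h with
  | var i => exact .var i
  | left _ ih => exact ih.left
  | right _ ih => exact ih.right
  | case_left _ _ _ ih => exact ih
  | case_right _ _ _ ih => exact ih
  | pair _ _ ih ih' => exact ih.pair ih'
  | letp _ _ _ ih => exact ih
  | lam A m => exact .lam A m
  | app _ _ _ _ _ ih => exact ih
  | lift m => exact .lift m
  | force _ _ _ ih => exact ih
  | fold _ ih => exact ih.fold
  | unfold _ ih => cases ih; assumption

theorem IsValue.eval_self {n : ℕ} {v : Tm n} (h : IsValue v) : Eval v v := by
  induction h with
  | var i => exact .var i
  | left _ ih => exact ih.left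
  | right _ ih => exact ih.right
  | pair _ _ ih ih' => exact ih.pair ih'
  | lam A m => exact .lam A m
  | lift m => exact .lift m
  | fold _ ih => exact ih.fold

/-- Determinism ensures that the values found for different approximants of one element coincide. -/
theorem Eval.unique {n : ℕ} {m v w : Tm n} (h : Eval m v) (h' : Eval m w) : v = w := by
  induction h generalizing w with
  | var i => cases h'; rfl
  | left _ ih => cases h' with | left h' => rw [ih h']
  | right _ ih => cases h' with | right h' => rw [ih h']
  | case_left _ _ ih ih' =>
    cases h' with
    | case_left h1 h2 => cases ih h1; exact ih' h2
    | case_right h1 h2 => cases ih h1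
  | case_right _ _ ih ih' =>
    cases h' with
    | case_left h1 h2 => cases ih h1
    | case_right h1 h2 => cases ih h1; exact ih' h2
  | pair _ _ ih ih' => cases h' with | pair h1 h2 => rw [ih h1, ih' h2]
  | letp _ _ ih ih' => cases h' with | letp h1 h2 => cases ih h1; exact ih' h2
  | lam A m => cases h'; rfl
  | app _ _ _ ih ih' ih'' =>
    cases h' with | app h1 h2 h3 => cases ih h1; cases ih' h2; exact ih'' h3
  | lift m => cases h'; rfl
  | force _ _ ih ih' => cases h' with | force h1 h2 => cases ih h1; exact ih' h2
  | fold _ ih => cases h' with | fold h' => rw [ih h']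
  | unfold _ ih => cases h' with | unfold h' => cases ih h'; rfl

theorem IsValue.eq_of_eval {n : ℕ} {v w : Tm n} (h : IsValue v) (h' : Eval v w) : w = v :=
  h'.unique h.eval_self

end Tm

namespace CPOLNLModel

variable {M : CPOLNLModel.{v, u}}

/-! ## Elements of types -/

/-- The left injection of an element. -/
noncomputable def inlElt {A : Ty 0} (B : Ty 0) (d : 𝟙_ M.L ⟶ M.Ob A) :
    𝟙_ M.L ⟶ M.Ob (.sum A B) :=
  d ≫ (coprod.inl : M.Ob A ⟶ M.Ob A ⨿ M.Ob B)

/-- The right injection of an element. -/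
noncomputable def inrElt (A : Ty 0) {B : Ty 0} (d : 𝟙_ M.L ⟶ M.Ob B) :
    𝟙_ M.L ⟶ M.Ob (.sum A B) :=
  d ≫ (coprod.inr : M.Ob B ⟶ M.Ob A ⨿ M.Ob B)

/-- The pair of two elements. -/
noncomputable def tensorElt {A B : Ty 0} (d : 𝟙_ M.L ⟶ M.Ob A) (e : 𝟙_ M.L ⟶ M.Ob B) :
    𝟙_ M.L ⟶ M.Ob (.tensor A B) :=
  (d ⊙ e : 𝟙_ M.L ⟶ M.Ob A ⊗ M.Ob B)

/-- The application of an element of a function type to an element. -/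
noncomputable def appElt {A B : Ty 0} (d : 𝟙_ M.L ⟶ M.Ob (.lolli A B)) (e : 𝟙_ M.L ⟶ M.Ob A) :
    𝟙_ M.L ⟶ M.Ob B :=
  (e ⊙ (show 𝟙_ M.L ⟶ (ihom (M.Ob A)).obj (M.Ob B) from d)) ≫ (ihom.ev (M.Ob A)).app (M.Ob B)

/-- The promotion of an element. -/
noncomputable def bangElt {A : Ty 0} (d : 𝟙_ M.L ⟶ M.Ob A) : 𝟙_ M.L ⟶ M.Ob (.bang A) :=
  M.bangε ≫ M.bangFunctor.map d

theorem pairElt_inl_distDesc {X Y Z W : M.L} (x : 𝟙_ M.L ⟶ X) (y : 𝟙_ M.L ⟶ Y) (f : X ⊗ Y ⟶ W)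
    (g : X ⊗ Z ⟶ W) : (x ⊙ (y ≫ coprod.inl)) ≫ M.distDesc f g = (x ⊙ y) ≫ f := by
  have h : X ◁ coprod.inl ≫ inv (coprodComparison (tensorLeft X) Y Z) = coprod.inl := by
    rw [IsIso.comp_inv_eq, coprodComparison, coprod.inl_desc]
    rfl
  rw [← pairElt_whiskerLeft, distDesc, Category.assoc, ← Category.assoc (X ◁ coprod.inl), h,
    coprod.inl_desc]

theorem pairElt_inr_distDesc {X Y Z W : M.L} (x : 𝟙_ M.L ⟶ X) (y : 𝟙_ M.L ⟶ Z) (f : X ⊗ Y ⟶ W)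
    (g : X ⊗ Z ⟶ W) : (x ⊙ (y ≫ coprod.inr)) ≫ M.distDesc f g = (x ⊙ y) ≫ g := by
  have h : X ◁ coprod.inr ≫ inv (coprodComparison (tensorLeft X) Y Z) = coprod.inr := by
    rw [IsIso.comp_inv_eq, coprodComparison, coprod.inr_desc]
    rfl
  rw [← pairElt_whiskerLeft, distDesc, Category.assoc, ← Category.assoc (X ◁ coprod.inr), h,
    coprod.inr_desc]

/-! ### The interpretation of derivations on elements -/

section Den

variable {n : ℕ}

theorem comp_den_case_left {Δ Δ₁ Δ₂ : Ctx n} {m : Tm n} {l r : Tm (n + 1)} {A B C : Ty 0}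
    (s : Split Δ Δ₁ Δ₂) (D : Deriv Δ₁ m (.sum A B)) (D₁ : Deriv (Δ₂.snoc A) l C)
    (D₂ : Deriv (Δ₂.snoc B) r C) {d : 𝟙_ M.L ⟶ M.ctx Δ} {d₁ : 𝟙_ M.L ⟶ M.ctx Δ₁}
    {d₂ : 𝟙_ M.L ⟶ M.ctx Δ₂} {e : 𝟙_ M.L ⟶ M.Ob A} (h : d ≫ M.split s = d₁ ⊙ d₂)
    (h' : d₁ ≫ M.den D = inlElt B e) :
    d ≫ M.den (.case s D D₁ D₂) = (d₂ ⊙ e : 𝟙_ M.L ⟶ M.ctx Δ₂ ⊗ M.Ob A) ≫ M.den D₁ := by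
  -- The computation is carried out for arbitrary objects, which prevents the interpretations of
  -- types and contexts from obstructing rewriting. The interpretation is an instance by definition.
  have key : ∀ {X Y Z A B C : M.L} {d : 𝟙_ M.L ⟶ X} {s : X ⟶ Y ⊗ Z} {d₁ : 𝟙_ M.L ⟶ Y}
      {d₂ : 𝟙_ M.L ⟶ Z} {e : 𝟙_ M.L ⟶ A} {f : Y ⟶ A ⨿ B} (f₁ : Z ⊗ A ⟶ C) (f₂ : Z ⊗ B ⟶ C),
      d ≫ s = d₁ ⊙ d₂ → d₁ ≫ f = e ≫ coprod.inl →
        d ≫ s ≫ (β_ Y Z).hom ≫ (Z ◁ f) ≫ M.distDesc f₁ f₂ = (d₂ ⊙ e) ≫ f₁ := by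
    intro X Y Z A B C d s d₁ d₂ e f f₁ f₂ h h'
    rw [← Category.assoc, h, pairElt_braiding_assoc, pairElt_whiskerLeft_assoc, h',
      pairElt_inl_distDesc]
  exact key _ _ h h'

theorem comp_den_case_right {Δ Δ₁ Δ₂ : Ctx n} {m : Tm n} {l r : Tm (n + 1)} {A B C : Ty 0}
    (s : Split Δ Δ₁ Δ₂) (D : Deriv Δ₁ m (.sum A B)) (D₁ : Deriv (Δ₂.snoc A) l C)
    (D₂ : Deriv (Δ₂.snoc B) r C) {d : 𝟙_ M.L ⟶ M.ctx Δ} {d₁ : 𝟙_ M.L ⟶ M.ctx Δ₁}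
    {d₂ : 𝟙_ M.L ⟶ M.ctx Δ₂} {e : 𝟙_ M.L ⟶ M.Ob B} (h : d ≫ M.split s = d₁ ⊙ d₂)
    (h' : d₁ ≫ M.den D = inrElt A e) :
    d ≫ M.den (.case s D D₁ D₂) = (d₂ ⊙ e : 𝟙_ M.L ⟶ M.ctx Δ₂ ⊗ M.Ob B) ≫ M.den D₂ := by
  have key : ∀ {X Y Z A B C : M.L} {d : 𝟙_ M.L ⟶ X} {s : X ⟶ Y ⊗ Z} {d₁ : 𝟙_ M.L ⟶ Y}
      {d₂ : 𝟙_ M.L ⟶ Z} {e : 𝟙_ M.L ⟶ B} {f : Y ⟶ A ⨿ B} (f₁ : Z ⊗ A ⟶ C) (f₂ : Z ⊗ B ⟶ C),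
      d ≫ s = d₁ ⊙ d₂ → d₁ ≫ f = e ≫ coprod.inr →
        d ≫ s ≫ (β_ Y Z).hom ≫ (Z ◁ f) ≫ M.distDesc f₁ f₂ = (d₂ ⊙ e) ≫ f₂ := by
    intro X Y Z A B C d s d₁ d₂ e f f₁ f₂ h h'
    rw [← Category.assoc, h, pairElt_braiding_assoc, pairElt_whiskerLeft_assoc, h',
      pairElt_inr_distDesc]
  exact key _ _ h h'

theorem comp_den_case_bot {Δ Δ₁ Δ₂ : Ctx n} {m : Tm n} {l r : Tm (n + 1)} {A B C : Ty 0}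
    (s : Split Δ Δ₁ Δ₂) (D : Deriv Δ₁ m (.sum A B)) (D₁ : Deriv (Δ₂.snoc A) l C)
    (D₂ : Deriv (Δ₂.snoc B) r C) {d : 𝟙_ M.L ⟶ M.ctx Δ} {d₁ : 𝟙_ M.L ⟶ M.ctx Δ₁}
    {d₂ : 𝟙_ M.L ⟶ M.ctx Δ₂} (h : d ≫ M.split s = d₁ ⊙ d₂)
    (h' : d₁ ≫ M.den D = M.bot _ _) : d ≫ M.den (.case s D D₁ D₂) = M.bot _ _ := by
  have key : ∀ {X Y Z A B C : M.L} {d : 𝟙_ M.L ⟶ X} {s : X ⟶ Y ⊗ Z} {d₁ : 𝟙_ M.L ⟶ Y}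
      {d₂ : 𝟙_ M.L ⟶ Z} {f : Y ⟶ A ⨿ B} (f₁ : Z ⊗ A ⟶ C) (f₂ : Z ⊗ B ⟶ C),
      d ≫ s = d₁ ⊙ d₂ → d₁ ≫ f = M.bot _ _ →
        d ≫ s ≫ (β_ Y Z).hom ≫ (Z ◁ f) ≫ M.distDesc f₁ f₂ = M.bot _ _ := by
    intro X Y Z A B C d s d₁ d₂ f f₁ f₂ h h'
    rw [← Category.assoc, h, pairElt_braiding_assoc, pairElt_whiskerLeft_assoc, h',
      pairElt_bot, bot_comp]
  exact key _ _ h h'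

theorem comp_den_pair {Δ Δ₁ Δ₂ : Ctx n} {m p : Tm n} {A B : Ty 0} (s : Split Δ Δ₁ Δ₂)
    (D₁ : Deriv Δ₁ m A) (D₂ : Deriv Δ₂ p B) {d : 𝟙_ M.L ⟶ M.ctx Δ} {d₁ : 𝟙_ M.L ⟶ M.ctx Δ₁}
    {d₂ : 𝟙_ M.L ⟶ M.ctx Δ₂} (h : d ≫ M.split s = d₁ ⊙ d₂) :
    d ≫ M.den (.pair s D₁ D₂) = tensorElt (d₁ ≫ M.den D₁) (d₂ ≫ M.den D₂) := by
  have key : ∀ {X Y Z A B : M.L} {d : 𝟙_ M.L ⟶ X} {s : X ⟶ Y ⊗ Z} {d₁ : 𝟙_ M.L ⟶ Y}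
      {d₂ : 𝟙_ M.L ⟶ Z} (f₁ : Y ⟶ A) (f₂ : Z ⟶ B), d ≫ s = d₁ ⊙ d₂ →
        d ≫ s ≫ (f₁ ⊗ₘ f₂) = (d₁ ≫ f₁) ⊙ (d₂ ≫ f₂) := by
    intro X Y Z A B d s d₁ d₂ f₁ f₂ h
    rw [← Category.assoc, h, pairElt_tensor]
  exact key _ _ h

theorem comp_den_letp {Δ Δ₁ Δ₂ : Ctx n} {m : Tm n} {p : Tm (n + 2)} {A B C : Ty 0}
    (s : Split Δ Δ₁ Δ₂) (D₁ : Deriv Δ₁ m (.tensor A B)) (D₂ : Deriv ((Δ₂.snoc A).snoc B) p C)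
    {d : 𝟙_ M.L ⟶ M.ctx Δ} {d₁ : 𝟙_ M.L ⟶ M.ctx Δ₁} {d₂ : 𝟙_ M.L ⟶ M.ctx Δ₂}
    {e : 𝟙_ M.L ⟶ M.Ob A} {e' : 𝟙_ M.L ⟶ M.Ob B} (h : d ≫ M.split s = d₁ ⊙ d₂)
    (h' : d₁ ≫ M.den D₁ = tensorElt e e') : d ≫ M.den (.letp s D₁ D₂) =
      ((d₂ ⊙ e) ⊙ e' : 𝟙_ M.L ⟶ (M.ctx Δ₂ ⊗ M.Ob A) ⊗ M.Ob B) ≫ M.den D₂ := by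
  have key : ∀ {X Y Z A B C : M.L} {d : 𝟙_ M.L ⟶ X} {s : X ⟶ Y ⊗ Z} {d₁ : 𝟙_ M.L ⟶ Y}
      {d₂ : 𝟙_ M.L ⟶ Z} {e : 𝟙_ M.L ⟶ A} {e' : 𝟙_ M.L ⟶ B} {f : Y ⟶ A ⊗ B}
      (g : (Z ⊗ A) ⊗ B ⟶ C), d ≫ s = d₁ ⊙ d₂ → d₁ ≫ f = e ⊙ e' →
        d ≫ s ≫ (β_ Y Z).hom ≫ (Z ◁ f) ≫ (α_ Z A B).inv ≫ g = ((d₂ ⊙ e) ⊙ e') ≫ g := by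
    intro X Y Z A B C d s d₁ d₂ e e' f g h h'
    rw [← Category.assoc, h, pairElt_braiding_assoc, pairElt_whiskerLeft_assoc, h',
      pairElt_associator_inv_assoc]
  exact key _ h h'

theorem comp_den_letp_bot {Δ Δ₁ Δ₂ : Ctx n} {m : Tm n} {p : Tm (n + 2)} {A B C : Ty 0}
    (s : Split Δ Δ₁ Δ₂) (D₁ : Deriv Δ₁ m (.tensor A B)) (D₂ : Deriv ((Δ₂.snoc A).snoc B) p C)
    {d : 𝟙_ M.L ⟶ M.ctx Δ} {d₁ : 𝟙_ M.L ⟶ M.ctx Δ₁} {d₂ : 𝟙_ M.L ⟶ M.ctx Δ₂}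
    (h : d ≫ M.split s = d₁ ⊙ d₂) (h' : d₁ ≫ M.den D₁ = M.bot _ _) :
    d ≫ M.den (.letp s D₁ D₂) = M.bot _ _ := by
  have key : ∀ {X Y Z A B C : M.L} {d : 𝟙_ M.L ⟶ X} {s : X ⟶ Y ⊗ Z} {d₁ : 𝟙_ M.L ⟶ Y}
      {d₂ : 𝟙_ M.L ⟶ Z} {f : Y ⟶ A ⊗ B}
      (g : (Z ⊗ A) ⊗ B ⟶ C), d ≫ s = d₁ ⊙ d₂ → d₁ ≫ f = M.bot _ _ →
        d ≫ s ≫ (β_ Y Z).hom ≫ (Z ◁ f) ≫ (α_ Z A B).inv ≫ g = M.bot _ _ := by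
    intro X Y Z A B C d s d₁ d₂ f g h h'
    rw [← Category.assoc, h, pairElt_braiding_assoc, pairElt_whiskerLeft_assoc, h',
      pairElt_bot, bot_comp]
  exact key _ h h'

theorem appElt_den_lam {Γ : Ctx n} {m : Tm (n + 1)} {A B : Ty 0} (D : Deriv (Γ.snoc A) m B)
    (d : 𝟙_ M.L ⟶ M.ctx Γ) (e : 𝟙_ M.L ⟶ M.Ob A) :
    appElt (d ≫ M.den (.lam D)) e = (d ⊙ e : 𝟙_ M.L ⟶ M.ctx Γ ⊗ M.Ob A) ≫ M.den D := by
  have key : ∀ {X A B : M.L} (d : 𝟙_ M.L ⟶ X) (e : 𝟙_ M.L ⟶ A) (f : X ⊗ A ⟶ B),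
      (e ⊙ (d ≫ MonoidalClosed.curry ((β_ A X).hom ≫ f))) ≫ (ihom.ev A).app B =
        (d ⊙ e) ≫ f := by
    intro X A B d e f
    have h : A ◁ MonoidalClosed.curry ((β_ A X).hom ≫ f) ≫ (ihom.ev A).app B =
        (β_ A X).hom ≫ f := by
      rw [← MonoidalClosed.uncurry_eq, MonoidalClosed.uncurry_curry]
    rw [← pairElt_whiskerLeft, Category.assoc, h, pairElt_braiding_assoc]
  exact key _ _ _

theorem comp_den_app {Δ Δ₁ Δ₂ : Ctx n} {m p : Tm n} {A B : Ty 0} (s : Split Δ Δ₁ Δ₂)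
    (D₁ : Deriv Δ₁ m (.lolli A B)) (D₂ : Deriv Δ₂ p A) {d : 𝟙_ M.L ⟶ M.ctx Δ}
    {d₁ : 𝟙_ M.L ⟶ M.ctx Δ₁} {d₂ : 𝟙_ M.L ⟶ M.ctx Δ₂} (h : d ≫ M.split s = d₁ ⊙ d₂) :
    d ≫ M.den (.app s D₁ D₂) = appElt (d₁ ≫ M.den D₁) (d₂ ≫ M.den D₂) := by
  have key : ∀ {X Y Z A B : M.L} {d : 𝟙_ M.L ⟶ X} {s : X ⟶ Y ⊗ Z} {d₁ : 𝟙_ M.L ⟶ Y}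
      {d₂ : 𝟙_ M.L ⟶ Z} (f₁ : Y ⟶ (ihom A).obj B) (f₂ : Z ⟶ A), d ≫ s = d₁ ⊙ d₂ →
        d ≫ s ≫ (f₁ ⊗ₘ f₂) ≫ (β_ ((ihom A).obj B) A).hom ≫ (ihom.ev A).app B =
          ((d₂ ≫ f₂) ⊙ (d₁ ≫ f₁)) ≫ (ihom.ev A).app B := by
    intro X Y Z A B d s d₁ d₂ f₁ f₂ h
    rw [← Category.assoc, h, pairElt_tensor_assoc, pairElt_braiding_assoc]
  exact key _ _ h

theorem comp_den_lift {Φ : Ctx n} {m : Tm n} {A : Ty 0} (hΦ : Φ.NonLinear) (D : Deriv Φ m A)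
    {d : 𝟙_ M.L ⟶ M.ctx Φ} (h : IsNice (M.promote (M.alphaCtx Φ hΦ) (M.alphaCtxInv Φ hΦ)) d) :
    d ≫ M.den (.lift hΦ D) = bangElt (d ≫ M.den D) := by
  have key : ∀ {X A : M.L} {c : X ⟶ M.bangFunctor.obj X} {d : 𝟙_ M.L ⟶ X} (f : X ⟶ A),
      IsNice c d → d ≫ c ≫ M.bangFunctor.map f = M.bangε ≫ M.bangFunctor.map (d ≫ f) := by
    intro X A c d f h
    rw [← Category.assoc, ← h, Category.assoc, ← Functor.map_comp]
  exact key _ h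

theorem comp_den_force {Γ : Ctx n} {m : Tm n} {A : Ty 0} (D : Deriv Γ m (.bang A))
    {d : 𝟙_ M.L ⟶ M.ctx Γ} {e : 𝟙_ M.L ⟶ M.Ob A} (h : d ≫ M.den D = bangElt e) :
    d ≫ M.den (.force D) = e :=
  (Category.assoc _ _ _).symm.trans ((congrArg (· ≫ M.adj.counit.app (M.Ob A)) h).trans
    (bangε_map_counit e))

theorem comp_den_fold {Γ : Ctx n} {m : Tm n} {A : Ty 1} (D : Deriv Γ m (A.inst (.mu A)))
    (d : 𝟙_ M.L ⟶ M.ctx Γ) : d ≫ M.den (.fold D) = (d ≫ M.den D) ≫ M.fold A :=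
  (Category.assoc _ _ _).symm

theorem comp_den_unfold {Γ : Ctx n} {m : Tm n} {A : Ty 1} (D : Deriv Γ m (.mu A))
    (d : 𝟙_ M.L ⟶ M.ctx Γ) : d ≫ M.den (.unfold D) = (d ≫ M.den D) ≫ M.unfold A :=
  (Category.assoc _ _ _).symm

theorem comp_den_left {Γ : Ctx n} {m : Tm n} {A : Ty 0} (B : Ty 0) (D : Deriv Γ m A)
    (d : 𝟙_ M.L ⟶ M.ctx Γ) : d ≫ M.den (.left B D) = inlElt B (d ≫ M.den D) :=
  (Category.assoc _ _ _).symm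

theorem comp_den_right {Γ : Ctx n} {m : Tm n} (A : Ty 0) {B : Ty 0} (D : Deriv Γ m B)
    (d : 𝟙_ M.L ⟶ M.ctx Γ) : d ≫ M.den (.right A D) = inrElt A (d ≫ M.den D) :=
  (Category.assoc _ _ _).symm

end Den

/-! ## Promotable elements of non-linear types -/

theorem isNice_inlElt {A B : Ty 0} {d : 𝟙_ M.L ⟶ M.Ob A} (h : IsNice (M.coalg A) d) :
    IsNice (M.coalg (.sum A B)) (inlElt B d) := by
  rw [coalg_sum]
  exact h.comp (isCoalgHom_inl _ _)

theorem isNice_inrElt {A B : Ty 0} {d : 𝟙_ M.L ⟶ M.Ob B} (h : IsNice (M.coalg B) d) :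
    IsNice (M.coalg (.sum A B)) (inrElt A d) := by
  rw [coalg_sum]
  exact h.comp (isCoalgHom_inr _ _)

theorem isNice_tensorElt {A B : Ty 0} {d : 𝟙_ M.L ⟶ M.Ob A} {e : 𝟙_ M.L ⟶ M.Ob B}
    (h : IsNice (M.coalg A) d) (h' : IsNice (M.coalg B) e) :
    IsNice (M.coalg (.tensor A B)) (tensorElt d e) := by
  rw [coalg_tensor]
  exact h.pairElt h'

theorem isNice_bangElt {A : Ty 0} (d : 𝟙_ M.L ⟶ M.Ob A) :
    IsNice (M.coalg (.bang A)) (bangElt d) := by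
  rw [coalg_bang]
  exact isNice_bang d

theorem isNice_comp_fold {A : Ty 1} {d : 𝟙_ M.L ⟶ M.Ob (A.inst A.mu)}
    (h : IsNice (M.coalg (A.inst A.mu)) d) : IsNice (M.coalg A.mu) (d ≫ M.fold A) :=
  h.comp (isCoalgHom_fold A)

theorem IsNice.ne_bot_of_nonLinear (hM : M.ComputationallyAdequate) {P : Ty 0} (hP : P.NonLinear)
    {d : 𝟙_ M.L ⟶ M.Ob P} (h : IsNice (M.coalg P) d) : d ≠ M.bot _ _ := by
  rw [← promote_alpha P hP] at h
  exact h.ne_bot hM (alpha_alphaInv _ _) (alphaInv_alpha _ _)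

theorem bangElt_ne_bot (hM : M.ComputationallyAdequate) {A : Ty 0} (d : 𝟙_ M.L ⟶ M.Ob A) :
    bangElt d ≠ M.bot _ _ :=
  IsNice.ne_bot_of_nonLinear hM (P := .bang A) trivial (isNice_bangElt d)

end CPOLNLModel

/-! ### Non-linear types are closed under substitution -/

theorem Ty.NonLinear.rename {n m : ℕ} {A : Ty n} (hA : A.NonLinear) (ξ : Fin n → Fin m) :
    (A.rename ξ).NonLinear := by
  induction A generalizing m with
  | var => trivial
  | sum A B ihA ihB => exact ⟨ihA hA.1 ξ, ihB hA.2 ξ⟩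
  | tensor A B ihA ihB => exact ⟨ihA hA.1 ξ, ihB hA.2 ξ⟩
  | lolli => exact hA.elim
  | bang => trivial
  | mu A ih => exact ih hA _

theorem Ty.NonLinear.subst {n m : ℕ} {A : Ty n} (hA : A.NonLinear) {σ : Fin n → Ty m}
    (hσ : ∀ i, (σ i).NonLinear) : (A.subst σ).NonLinear := by
  induction A generalizing m with
  | var i => exact hσ i
  | sum A B ihA ihB => exact ⟨ihA hA.1 hσ, ihB hA.2 hσ⟩
  | tensor A B ihA ihB => exact ⟨ihA hA.1 hσ, ihB hA.2 hσ⟩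
  | lolli => exact hA.elim
  | bang => trivial
  | mu A ih => exact ih hA (Fin.cases (motive := fun i => (liftSub _ i).NonLinear) trivial
    fun i => (hσ i).rename _)

theorem Ty.NonLinear.inst {A : Ty 1} (hA : A.mu.NonLinear) : (A.inst A.mu).NonLinear :=
  Ty.NonLinear.subst (A := A) hA (Fin.cases hA fun i => i.elim0)

end LNLFPC

namespace LNLFPC
open CategoryTheory CategoryTheory.Limits OmegaCompletePartialOrder MonoidalCategory

namespace CPOLNLModel

variable {M : CPOLNLModel.{v, u}}

/-! ## Soundness -/

/-- `Val A d v` : the element `d` of `⟦A⟧` interprets the value `v`, built from closures. -/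
inductive Val {k : ℕ} : (A : Ty 0) → (𝟙_ M.L ⟶ M.Ob A) → Tm k → Prop
  | left {A : Ty 0} (B : Ty 0) {d : 𝟙_ M.L ⟶ M.Ob A} {v : Tm k} : Val A d v →
      Val (.sum A B) (inlElt B d) (.left A B v)
  | right (A : Ty 0) {B : Ty 0} {d : 𝟙_ M.L ⟶ M.Ob B} {v : Tm k} : Val B d v →
      Val (.sum A B) (inrElt A d) (.right A B v)
  | pair {A B : Ty 0} {d : 𝟙_ M.L ⟶ M.Ob A} {e : 𝟙_ M.L ⟶ M.Ob B} {v w : Tm k} : Val A d v →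
      Val B e w → Val (.tensor A B) (tensorElt d e) (.pair v w)
  | lam {n : ℕ} {Γ : Ctx n} {m : Tm (n + 1)} {A B : Ty 0} (D : Deriv (Γ.snoc A) m B)
      {γ : Fin n → Tm k} {d : 𝟙_ M.L ⟶ M.ctx Γ} : Env Val Γ γ d →
      Val (.lolli A B) (d ≫ M.den (.lam D)) ((Tm.lam A m).subst γ)
  | lift {n : ℕ} {Φ : Ctx n} {m : Tm n} {A : Ty 0} (D : Deriv Φ m A)
      {γ : Fin n → Tm k} {d : 𝟙_ M.L ⟶ M.ctx Φ} : Env Val Φ γ d →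
      Val (.bang A) (bangElt (d ≫ M.den D)) ((Tm.lift m).subst γ)
  | fold {A : Ty 1} {d : 𝟙_ M.L ⟶ M.Ob (A.inst A.mu)} {v : Tm k} : Val (A.inst A.mu) d v →
      Val A.mu (d ≫ M.fold A) (.fold A v)

theorem Val.isValue {k : ℕ} {A : Ty 0} {d : 𝟙_ M.L ⟶ M.Ob A} {v : Tm k} (h : Val A d v) :
    v.IsValue := by
  -- `Val` is nested through `Env`, so its recursor has a second motive for environments. Nothing is
  -- needed of them here.
  refine Val.rec (motive_1 := fun _ _ v _ => v.IsValue) (motive_2 := fun _ _ _ _ => True)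
    ?_ ?_ ?_ ?_ ?_ ?_ ?_ ?_ ?_ h
  · exact fun _ _ _ _ ih => ih.left
  · intros; rename_i ih; exact ih.right
  · exact fun _ _ ih ih' => ih.pair ih'
  · intros; exact .lam _ _
  · intros; exact .lift _
  · exact fun _ ih => ih.fold
  all_goals intros; trivial

/-- The element constructors other than `λ` preserve promotability, and `bangElt` always produces
it. A `λ` cannot occur at a non-linear type. -/
theorem promotable_val {k : ℕ} : Promotable (M := M) (Val (k := k)) := by
  intro P d v hP h
  revert hP
  refine Val.rec (motive_1 := fun P d _ _ => P.NonLinear → IsNice (M.coalg P) d)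
    (motive_2 := fun _ _ _ _ => True) ?_ ?_ ?_ ?_ ?_ ?_ ?_ ?_ ?_ h
  · exact fun _ _ _ _ ih hP => isNice_inlElt (ih hP.1)
  · intros; rename_i ih hP; exact isNice_inrElt (ih hP.2)
  · exact fun _ _ ih ih' hP => isNice_tensorElt (ih hP.1) (ih' hP.2)
  · intros; rename_i hP; exact hP.elim
  · intros; exact isNice_bangElt _
  · exact fun _ ih hP => isNice_comp_fold (ih hP.inst)
  all_goals intros; trivial

/-! ### Inversion of `Val` on the shape of the value -/

section Inversion

variable {k : ℕ} {A B : Ty 0} {v w : Tm k}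

theorem Val.of_left {C D : Ty 0} {d : 𝟙_ M.L ⟶ M.Ob (.sum A B)} (h : Val (.sum A B) d (.left C D v)) :
    ∃ e, d = inlElt B e ∧ Val A e v := by
  cases h with
  | left _ h => exact ⟨_, rfl, h⟩

theorem Val.of_right {C D : Ty 0} {d : 𝟙_ M.L ⟶ M.Ob (.sum A B)}
    (h : Val (.sum A B) d (.right C D v)) : ∃ e, d = inrElt A e ∧ Val B e v := by
  cases h with
  | right _ h => exact ⟨_, rfl, h⟩

theorem Val.of_pair {d : 𝟙_ M.L ⟶ M.Ob (.tensor A B)} (h : Val (.tensor A B) d (.pair v w)) :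
    ∃ e e', d = tensorElt e e' ∧ Val A e v ∧ Val B e' w := by
  cases h with
  | pair h h' => exact ⟨_, _, rfl, h, h'⟩

theorem Val.of_fold {A : Ty 1} {C : Ty 1} {d : 𝟙_ M.L ⟶ M.Ob A.mu} (h : Val A.mu d (.fold C v)) :
    ∃ e, d = e ≫ M.fold A ∧ Val (A.inst A.mu) e v := by
  cases h with
  | fold h => exact ⟨_, rfl, h⟩

theorem Val.of_lam {C : Ty 0} {p : Tm (k + 1)} {d : 𝟙_ M.L ⟶ M.Ob (.lolli A B)}
    (h : Val (.lolli A B) d (.lam C p)) : ∃ (n : ℕ) (Γ : Ctx n) (m : Tm (n + 1))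
      (D : Deriv (Γ.snoc A) m B) (γ : Fin n → Tm k) (e : 𝟙_ M.L ⟶ M.ctx Γ), Env Val Γ γ e ∧
        d = e ≫ M.den (.lam D) ∧ p = m.subst (Tm.liftSub γ) := by
  -- The index of the constructor is a substitution instance, which case analysis cannot unify with
  -- `lam` until it is replaced by a variable.
  generalize hv : Tm.lam C p = v at h
  cases h with
  | lam D h =>
    simp only [Tm.subst, Tm.lam.injEq] at hv
    exact ⟨_, _, _, D, _, _, h, rfl, hv.2⟩

theorem Val.of_lift {p : Tm k} {d : 𝟙_ M.L ⟶ M.Ob (.bang A)}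
    (h : Val (.bang A) d (.lift p)) : ∃ (n : ℕ) (Φ : Ctx n) (m : Tm n)
      (D : Deriv Φ m A) (γ : Fin n → Tm k) (e : 𝟙_ M.L ⟶ M.ctx Φ), Env Val Φ γ e ∧
        d = bangElt (e ≫ M.den D) ∧ p = m.subst γ := by
  generalize hv : Tm.lift p = v at h
  cases h with
  | lift D h =>
    simp only [Tm.subst, Tm.lift.injEq] at hv
    exact ⟨_, _, _, D, _, _, h, rfl, hv⟩

end Inversion

/-- Under any evaluation rule the term may be `γ i` for a variable of the derivation, as the head of
`m.subst γ` need not come from `m`. But `γ i` is then a value and evaluates only to itself. -/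
theorem Val.lookup {n k : ℕ} {Γ : Ctx n} {i : Fin n} {A : Ty 0} {γ : Fin n → Tm k}
    {d : 𝟙_ M.L ⟶ M.ctx Γ} (hγ : Env Val Γ γ d) (l : Lookup Γ i A) {v w : Tm k}
    (h : Tm.Eval v w) (hv : v = γ i) : Val A (d ≫ M.den (.var l)) w := by
  subst hv
  have h1 := hγ.lookup promotable_val l
  rw [h1.isValue.eq_of_eval h]
  exact h1

/-- Evaluation preserves the interpretation. -/
theorem Val.of_eval {k : ℕ} {t w : Tm k} (h : Tm.Eval t w) {n : ℕ} {Γ : Ctx n} {m : Tm n}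
    {A : Ty 0} (D : Deriv Γ m A) {γ : Fin n → Tm k} {d : 𝟙_ M.L ⟶ M.ctx Γ} (hγ : Env Val Γ γ d)
    (ht : t = m.subst γ) : Val A (d ≫ M.den D) w := by
  -- The induction is on evaluation, with the derivation and its environment free to vary: entering
  -- the body of a closure changes both.
  induction h generalizing n A with
  | var i =>
    cases D with
    | var l => exact Val.lookup hγ l (.var i) ht
    | _ => simp [Tm.subst] at ht
  | left h ih =>
    cases D with
    | var l => exact Val.lookup hγ l (.left h) ht
    | left B D =>
      simp only [Tm.subst, Tm.left.injEq] at ht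
      obtain ⟨rfl, rfl, rfl⟩ := ht
      rw [comp_den_left]
      exact .left _ (ih D hγ rfl)
    | _ => simp [Tm.subst] at ht
  | right h ih =>
    cases D with
    | var l => exact Val.lookup hγ l (.right h) ht
    | right B D =>
      simp only [Tm.subst, Tm.right.injEq] at ht
      obtain ⟨rfl, rfl, rfl⟩ := ht
      rw [comp_den_right]
      exact .right _ (ih D hγ rfl)
    | _ => simp [Tm.subst] at ht
  | case_left h h' ih ih' =>
    cases D with
    | var l => exact Val.lookup hγ l (.case_left h h') ht
    | case s D D₁ D₂ =>
      simp only [Tm.subst, Tm.case.injEq] at ht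
      obtain ⟨rfl, rfl, rfl⟩ := ht
      obtain ⟨d₁, d₂, hγ₁, hγ₂, hs⟩ := hγ.split promotable_val s
      obtain ⟨e, he, hv⟩ := (ih D hγ₁ rfl).of_left
      rw [comp_den_case_left s D D₁ D₂ hs he]
      exact ih' D₁ (hγ₂.snoc hv) (Tm.subst_liftSub_inst _ _ _)
    | _ => simp [Tm.subst] at ht
  | case_right h h' ih ih' =>
    cases D with
    | var l => exact Val.lookup hγ l (.case_right h h') ht
    | case s D D₁ D₂ =>
      simp only [Tm.subst, Tm.case.injEq] at ht
      obtain ⟨rfl, rfl, rfl⟩ := ht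
      obtain ⟨d₁, d₂, hγ₁, hγ₂, hs⟩ := hγ.split promotable_val s
      obtain ⟨e, he, hv⟩ := (ih D hγ₁ rfl).of_right
      rw [comp_den_case_right s D D₁ D₂ hs he]
      exact ih' D₂ (hγ₂.snoc hv) (Tm.subst_liftSub_inst _ _ _)
    | _ => simp [Tm.subst] at ht
  | pair h h' ih ih' =>
    cases D with
    | var l => exact Val.lookup hγ l (.pair h h') ht
    | pair s D₁ D₂ =>
      simp only [Tm.subst, Tm.pair.injEq] at ht
      obtain ⟨rfl, rfl⟩ := ht
      obtain ⟨d₁, d₂, hγ₁, hγ₂, hs⟩ := hγ.split promotable_val s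
      rw [comp_den_pair s D₁ D₂ hs]
      exact .pair (ih D₁ hγ₁ rfl) (ih' D₂ hγ₂ rfl)
    | _ => simp [Tm.subst] at ht
  | letp h h' ih ih' =>
    cases D with
    | var l => exact Val.lookup hγ l (.letp h h') ht
    | letp s D₁ D₂ =>
      simp only [Tm.subst, Tm.letp.injEq] at ht
      obtain ⟨rfl, rfl⟩ := ht
      obtain ⟨d₁, d₂, hγ₁, hγ₂, hs⟩ := hγ.split promotable_val s
      obtain ⟨e, e', he, hv, hv'⟩ := (ih D₁ hγ₁ rfl).of_pair
      rw [comp_den_letp s D₁ D₂ hs he]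
      exact ih' D₂ ((hγ₂.snoc hv).snoc hv') (Tm.subst_liftSub_inst₂ _ _ _ _)
    | _ => simp [Tm.subst] at ht
  | lam B p =>
    cases D with
    | var l => exact Val.lookup hγ l (.lam B p) ht
    | lam D =>
      rw [ht]
      exact .lam D hγ
    | _ => simp [Tm.subst] at ht
  | app h h' h'' ih ih' ih'' =>
    cases D with
    | var l => exact Val.lookup hγ l (.app h h' h'') ht
    | app s D₁ D₂ =>
      simp only [Tm.subst, Tm.app.injEq] at ht
      obtain ⟨rfl, rfl⟩ := ht
      obtain ⟨d₁, d₂, hγ₁, hγ₂, hs⟩ := hγ.split promotable_val s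
      -- The function value brings the context and environment it was built in. The body is
      -- evaluated in that environment extended by the argument.
      obtain ⟨n', Γ', m', D', γ', e, hγ', he, hm⟩ := (ih D₁ hγ₁ rfl).of_lam
      rw [comp_den_app s D₁ D₂ hs, he, appElt_den_lam]
      rw [hm] at ih''
      exact ih'' D' (hγ'.snoc (ih' D₂ hγ₂ rfl)) (Tm.subst_liftSub_inst _ _ _)
    | _ => simp [Tm.subst] at ht
  | lift p =>
    cases D with
    | var l => exact Val.lookup hγ l (.lift p) ht
    | lift hΦ D =>
      rw [ht, comp_den_lift hΦ D (hγ.isNice promotable_val hΦ)]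
      exact .lift D hγ
    | _ => simp [Tm.subst] at ht
  | force h h' ih ih' =>
    cases D with
    | var l => exact Val.lookup hγ l (.force h h') ht
    | force D =>
      simp only [Tm.subst, Tm.force.injEq] at ht
      obtain ⟨n', Γ', m', D', γ', e, hγ', he, hm⟩ := (ih D hγ ht).of_lift
      rw [comp_den_force D he]
      exact ih' D' hγ' hm
    | _ => simp [Tm.subst] at ht
  | fold h ih =>
    cases D with
    | var l => exact Val.lookup hγ l (.fold h) ht
    | fold D =>
      simp only [Tm.subst, Tm.fold.injEq] at ht
      obtain ⟨rfl, rfl⟩ := ht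
      rw [comp_den_fold]
      exact .fold (ih D hγ rfl)
    | _ => simp [Tm.subst] at ht
  | unfold h ih =>
    cases D with
    | var l => exact Val.lookup hγ l (.unfold h) ht
    | unfold D =>
      simp only [Tm.subst, Tm.unfold.injEq] at ht
      obtain ⟨e, he, hv⟩ := (ih D hγ ht).of_fold
      rw [comp_den_unfold, he, Category.assoc, fold_unfold, Category.comp_id]
      exact hv
    | _ => simp [Tm.subst] at ht

/-- The interpretation of a terminating program of non-linear type is not `⊥`. -/
theorem den_ne_bot_of_eval (hM : M.ComputationallyAdequate) {P : Ty 0} (hP : P.NonLinear)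
    {p v : Tm 0} (D : Deriv Ctx.nil p P) (h : Tm.Eval p v) : M.den D ≠ M.bot _ _ := by
  have h1 := Val.of_eval (M := M) h D (.nil Tm.var) (Tm.subst_var p).symm
  have h2 := (promotable_val hP h1).ne_bot_of_nonLinear hM hP
  exact fun h => h2 ((Category.id_comp _).trans h)

end CPOLNLModel
end LNLFPC

namespace LNLFPC
open CategoryTheory CategoryTheory.Limits OmegaCompletePartialOrder MonoidalCategory

namespace CPOLNLModel

variable {M : CPOLNLModel.{v, u}}

/-! ## Approximations of elements -/

@[simp] theorem inlElt_approx (n : ℕ) {A : Ty 0} (B : Ty 0) (d : 𝟙_ M.L ⟶ M.Ob A) :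
    inlElt B d ≫ M.approx n (.sum A B) = inlElt B (d ≫ M.approx n A) := by
  have key : ∀ {X Y : M.L} (d : 𝟙_ M.L ⟶ X) (f : X ⟶ X) (g : Y ⟶ Y),
      (d ≫ coprod.inl) ≫ coprod.map f g = (d ≫ f) ≫ coprod.inl := by
    intro X Y d f g
    rw [Category.assoc, coprod.inl_map, Category.assoc]
  rw [approx_sum]
  exact key _ _ _

@[simp] theorem inrElt_approx (n : ℕ) (A : Ty 0) {B : Ty 0} (d : 𝟙_ M.L ⟶ M.Ob B) :
    inrElt A d ≫ M.approx n (.sum A B) = inrElt A (d ≫ M.approx n B) := by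
  have key : ∀ {X Y : M.L} (d : 𝟙_ M.L ⟶ Y) (f : X ⟶ X) (g : Y ⟶ Y),
      (d ≫ coprod.inr) ≫ coprod.map f g = (d ≫ g) ≫ coprod.inr := by
    intro X Y d f g
    rw [Category.assoc, coprod.inr_map, Category.assoc]
  rw [approx_sum]
  exact key _ _ _

@[simp] theorem tensorElt_approx (n : ℕ) {A B : Ty 0} (d : 𝟙_ M.L ⟶ M.Ob A)
    (e : 𝟙_ M.L ⟶ M.Ob B) : tensorElt d e ≫ M.approx n (.tensor A B) =
      tensorElt (d ≫ M.approx n A) (e ≫ M.approx n B) := by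
  rw [approx_tensor]
  exact pairElt_tensor _ _ _ _

@[simp] theorem bangElt_approx (n : ℕ) {A : Ty 0} (d : 𝟙_ M.L ⟶ M.Ob A) :
    bangElt d ≫ M.approx n (.bang A) = bangElt (d ≫ M.approx n A) := by
  rw [approx_bang]
  exact (Category.assoc _ _ _).trans (congrArg (M.bangε ≫ ·) (M.bangFunctor.map_comp _ _).symm)

-- Truncating a function truncates its argument and its result: this is naturality of evaluation in
-- the result and its dinaturality in the argument.
@[simp] theorem appElt_approx (n : ℕ) {A B : Ty 0} (d : 𝟙_ M.L ⟶ M.Ob (.lolli A B))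
    (e : 𝟙_ M.L ⟶ M.Ob A) : appElt (d ≫ M.approx n (.lolli A B)) e =
      appElt d (e ≫ M.approx n A) ≫ M.approx n B := by
  have key : ∀ {X Y : M.L} (d : 𝟙_ M.L ⟶ (ihom X).obj Y) (e : 𝟙_ M.L ⟶ X) (f : X ⟶ X) (g : Y ⟶ Y),
      (e ⊙ (d ≫ M.lolliMap f g)) ≫ (ihom.ev X).app Y =
        ((e ≫ f) ⊙ d) ≫ (ihom.ev X).app Y ≫ g := by
    intro X Y d e f g
    have h := MonoidalClosed.id_tensor_pre_app_comp_ev f Y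
    have h1 : (ihom.ev X).app Y ≫ g = X ◁ (ihom X).map g ≫ (ihom.ev X).app Y :=
      ((ihom.ev X).naturality g).symm
    rw [lolliMap, ← Category.assoc d, ← pairElt_whiskerLeft, ← pairElt_whiskerLeft,
      Category.assoc, Category.assoc, ← h1, reassoc_of% h, pairElt_whiskerRight_assoc]
  rw [approx_lolli]
  exact (key _ _ _ _).trans (Category.assoc _ _ _).symm

theorem comp_approx_succ_unfold (n : ℕ) {A : Ty 1} (d : 𝟙_ M.L ⟶ M.Ob A.mu) :
    (d ≫ M.approx (n + 1) A.mu) ≫ M.unfold A =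
      (d ≫ M.unfold A) ≫ M.approx n (A.inst A.mu) := by
  simp [approx_mu_succ]

@[simp] theorem bangElt_counit {A : Ty 0} (d : 𝟙_ M.L ⟶ M.Ob A) :
    bangElt d ≫ M.adj.counit.app (M.Ob A) = d := bangε_map_counit d

@[simp] theorem inlElt_bot {A B : Ty 0} : inlElt B (M.bot (𝟙_ M.L) (M.Ob A)) = M.bot _ _ :=
  bot_comp _

@[simp] theorem inrElt_bot {A B : Ty 0} : inrElt A (M.bot (𝟙_ M.L) (M.Ob B)) = M.bot _ _ :=
  bot_comp _

@[simp] theorem inlElt_eq_bot {A B : Ty 0} {d : 𝟙_ M.L ⟶ M.Ob A} :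
    inlElt B d = M.bot _ _ ↔ d = M.bot _ _ := inl_eq_bot_iff

@[simp] theorem inrElt_eq_bot {A B : Ty 0} {d : 𝟙_ M.L ⟶ M.Ob B} :
    inrElt A d = M.bot _ _ ↔ d = M.bot _ _ := inr_eq_bot_iff

@[simp] theorem bot_tensorElt {A B : Ty 0} (e : 𝟙_ M.L ⟶ M.Ob B) :
    tensorElt (M.bot _ (M.Ob A)) e = M.bot _ _ := bot_pairElt e

@[simp] theorem tensorElt_bot {A B : Ty 0} (e : 𝟙_ M.L ⟶ M.Ob A) :
    tensorElt e (M.bot _ (M.Ob B)) = M.bot _ _ := pairElt_bot e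

@[simp] theorem appElt_bot {A B : Ty 0} (d : 𝟙_ M.L ⟶ M.Ob (.lolli A B)) :
    appElt d (M.bot _ _) = M.bot _ _ :=
  (congrArg (· ≫ _) (bot_pairElt (M := M) _)).trans (bot_comp _)

@[simp] theorem bot_appElt {A B : Ty 0} (e : 𝟙_ M.L ⟶ M.Ob A) :
    appElt (M.bot _ (M.Ob (.lolli A B))) e = M.bot _ _ :=
  (congrArg (· ≫ _) (pairElt_bot (M := M) _)).trans (bot_comp _)

theorem isSup_appElt {A B : Ty 0} {f : ℕ → (𝟙_ M.L ⟶ M.Ob (.lolli A B))}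
    {g : ℕ → (𝟙_ M.L ⟶ M.Ob A)} {d : 𝟙_ M.L ⟶ M.Ob (.lolli A B)} {e : 𝟙_ M.L ⟶ M.Ob A}
    (hf : IsSup f d) (hg : IsSup g e) : IsSup (fun n => appElt (f n) (g n)) (appElt d e) :=
  (isSup_pairElt hg hf).comp_right _

theorem isSup_bangElt {A : Ty 0} {f : ℕ → (𝟙_ M.L ⟶ M.Ob A)} {d : 𝟙_ M.L ⟶ M.Ob A}
    (hf : IsSup f d) : IsSup (fun n => bangElt (f n)) (bangElt d) :=
  (isSup_bang hf).comp_left _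

/-- A left inverse of `inlElt`. -/
noncomputable def fromInl {A B : Ty 0} (d : 𝟙_ M.L ⟶ M.Ob (.sum A B)) : 𝟙_ M.L ⟶ M.Ob A :=
  d ≫ (coprod.desc (𝟙 _) (M.bot _ _) : M.Ob A ⨿ M.Ob B ⟶ M.Ob A)

/-- A left inverse of `inrElt`. -/
noncomputable def fromInr {A B : Ty 0} (d : 𝟙_ M.L ⟶ M.Ob (.sum A B)) : 𝟙_ M.L ⟶ M.Ob B :=
  d ≫ (coprod.desc (M.bot _ _) (𝟙 _) : M.Ob A ⨿ M.Ob B ⟶ M.Ob B)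

@[simp] theorem fromInl_inlElt {A B : Ty 0} (d : 𝟙_ M.L ⟶ M.Ob A) : fromInl (inlElt B d) = d := by
  have key : ∀ {X Y : M.L} (d : 𝟙_ M.L ⟶ X),
      (d ≫ (coprod.inl : X ⟶ X ⨿ Y)) ≫ coprod.desc (𝟙 _) (M.bot _ _) = d := by
    intro X Y d
    rw [Category.assoc, coprod.inl_desc, Category.comp_id]
  exact key d

@[simp] theorem fromInr_inrElt {A B : Ty 0} (d : 𝟙_ M.L ⟶ M.Ob B) : fromInr (inrElt A d) = d := by
  have key : ∀ {X Y : M.L} (d : 𝟙_ M.L ⟶ Y),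
      (d ≫ (coprod.inr : Y ⟶ X ⨿ Y)) ≫ coprod.desc (M.bot _ _) (𝟙 _) = d := by
    intro X Y d
    rw [Category.assoc, coprod.inr_desc, Category.comp_id]
  exact key d

theorem isSup_inlElt {A B : Ty 0} {f : ℕ → (𝟙_ M.L ⟶ M.Ob A)} {d : 𝟙_ M.L ⟶ M.Ob A}
    (hf : IsSup f d) : IsSup (fun n => inlElt B (f n)) (inlElt B d) := hf.comp_right _

theorem isSup_inrElt {A B : Ty 0} {f : ℕ → (𝟙_ M.L ⟶ M.Ob B)} {d : 𝟙_ M.L ⟶ M.Ob B}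
    (hf : IsSup f d) : IsSup (fun n => inrElt A (f n)) (inrElt A d) := hf.comp_right _

theorem isSup_tensorElt {A B : Ty 0} {f : ℕ → (𝟙_ M.L ⟶ M.Ob A)} {g : ℕ → (𝟙_ M.L ⟶ M.Ob B)}
    {d : 𝟙_ M.L ⟶ M.Ob A} {e : 𝟙_ M.L ⟶ M.Ob B} (hf : IsSup f d) (hg : IsSup g e) :
    IsSup (fun n => tensorElt (f n) (g n)) (tensorElt d e) := isSup_pairElt hf hg

theorem isSup_fromInl {A B : Ty 0} {f : ℕ → (𝟙_ M.L ⟶ M.Ob (.sum A B))}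
    {d : 𝟙_ M.L ⟶ M.Ob (.sum A B)} (hf : IsSup f d) :
    IsSup (fun n => fromInl (f n)) (fromInl d) := hf.comp_right _

theorem isSup_fromInr {A B : Ty 0} {f : ℕ → (𝟙_ M.L ⟶ M.Ob (.sum A B))}
    {d : 𝟙_ M.L ⟶ M.Ob (.sum A B)} (hf : IsSup f d) :
    IsSup (fun n => fromInr (f n)) (fromInr d) := hf.comp_right _

/-- An element that is a supremum of left injections is a left injection. -/
theorem exists_inlElt {A B : Ty 0} {f : ℕ → (𝟙_ M.L ⟶ M.Ob A)} {d : 𝟙_ M.L ⟶ M.Ob (.sum A B)}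
    (h : IsSup (fun n => inlElt B (f n)) d) : ∃ e, d = inlElt B e ∧ IsSup f e := by
  have h1 := (isSup_fromInl h).congr (fun n => (fromInl_inlElt (B := B) (f n)).symm) rfl
  exact ⟨_, h.unique (isSup_inlElt h1), h1⟩

theorem exists_inrElt {A B : Ty 0} {f : ℕ → (𝟙_ M.L ⟶ M.Ob B)} {d : 𝟙_ M.L ⟶ M.Ob (.sum A B)}
    (h : IsSup (fun n => inrElt A (f n)) d) : ∃ e, d = inrElt A e ∧ IsSup f e := by
  have h1 := (isSup_fromInr h).congr (fun n => (fromInr_inrElt (A := A) (f n)).symm) rfl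
  exact ⟨_, h.unique (isSup_inrElt h1), h1⟩

theorem exists_bangElt {A : Ty 0} {f : ℕ → (𝟙_ M.L ⟶ M.Ob A)} {d : 𝟙_ M.L ⟶ M.Ob (.bang A)}
    (h : IsSup (fun n => bangElt (f n)) d) : ∃ e, d = bangElt e ∧ IsSup f e := by
  have h1 := (h.comp_right (M.adj.counit.app (M.Ob A))).congr
    (fun n => (bangElt_counit (f n)).symm) rfl
  exact ⟨_, h.unique (isSup_bangElt h1), h1⟩

theorem tensorElt_injective (hM : M.ComputationallyAdequate) {A B : Ty 0} {d d' : 𝟙_ M.L ⟶ M.Ob A}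
    {e e' : 𝟙_ M.L ⟶ M.Ob B} (hd : d ≠ M.bot _ _) (he : e ≠ M.bot _ _) (hd' : d' ≠ M.bot _ _)
    (he' : e' ≠ M.bot _ _) (h : tensorElt d e = tensorElt d' e') : d = d' ∧ e = e' :=
  pairElt_injective hM hd he hd' he' h

theorem tensorElt_ne_bot (hM : M.ComputationallyAdequate) {A B : Ty 0} {d : 𝟙_ M.L ⟶ M.Ob A}
    {e : 𝟙_ M.L ⟶ M.Ob B} (hd : d ≠ M.bot _ _) (he : e ≠ M.bot _ _) :
    tensorElt d e ≠ M.bot _ _ := pairElt_ne_bot hM hd he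

/-- A tensor product has no projections, so monotonicity of the components has to be read off from
that of the pairs. This is the order reflection in the definition of adequacy, for which non-`⊥`
components are needed. -/
theorem exists_tensorElt (hM : M.ComputationallyAdequate) {A B : Ty 0}
    {f : ℕ → (𝟙_ M.L ⟶ M.Ob A)} {g : ℕ → (𝟙_ M.L ⟶ M.Ob B)} (hf : ∀ n, f n ≠ M.bot _ _)
    (hg : ∀ n, g n ≠ M.bot _ _) {d : 𝟙_ M.L ⟶ M.Ob (.tensor A B)}
    (h : IsSup (fun n => tensorElt (f n) (g n)) d) :
    ∃ a b, d = tensorElt a b ∧ IsSup f a ∧ IsSup g b := by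
  have h1 := fun {i j} (hij : i ≤ j) => pairElt_reflects hM (hf i) (hg i) (hf j) (hg j) (h.mono hij)
  obtain ⟨a, ha⟩ := exists_isSup (f := f) fun _ _ hij => (h1 hij).1
  obtain ⟨b, hb⟩ := exists_isSup (f := g) fun _ _ hij => (h1 hij).2
  exact ⟨a, b, h.unique (isSup_tensorElt ha hb), ha, hb⟩

end CPOLNLModel
end LNLFPC

namespace LNLFPC
open CategoryTheory CategoryTheory.Limits OmegaCompletePartialOrder MonoidalCategory

namespace CPOLNLModel

variable {M : CPOLNLModel.{v, u}}

/-! ## Formal approximation -/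

/-- The extension of a relation between elements and values to a relation between elements and
programs. -/
def Bar {X : M.L} (R : (𝟙_ M.L ⟶ X) → Tm 0 → Prop) (d : 𝟙_ M.L ⟶ X) (m : Tm 0) : Prop :=
  d = M.bot _ _ ∨ ∃ v, Tm.Eval m v ∧ R d v

/-- The formal approximation relation at a given level of unfolding of recursive types. -/
def RelAt (M : CPOLNLModel.{v, u}) : ℕ → (A : Ty 0) → (𝟙_ M.L ⟶ M.Ob A) → Tm 0 → Prop
  | _, .var i => i.elim0
  | n, .sum A B => fun d v => (∃ e w, d = inlElt B e ∧ v = .left A B w ∧ M.RelAt n A e w) ∨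
      ∃ e w, d = inrElt A e ∧ v = .right A B w ∧ M.RelAt n B e w
  | n, .tensor A B => fun d v => ∃ e e' w w', d = tensorElt e e' ∧ v = .pair w w' ∧
      M.RelAt n A e w ∧ M.RelAt n B e' w'
  | n, .lolli A B => fun d v => d ≠ M.bot _ _ ∧ d ≫ M.approx n (.lolli A B) = d ∧
      ∃ m, v = .lam A m ∧ ∀ e w, M.RelAt n A e w → Bar (M.RelAt n B) (appElt d e) (m.inst w)
  | n, .bang A => fun d v => ∃ e m, d = bangElt e ∧ v = .lift m ∧ Bar (M.RelAt n A) e m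
  | 0, .mu A => fun _ _ => False
  | n + 1, .mu A => fun d v => ∃ w, v = .fold A w ∧ M.RelAt n (A.inst (.mu A)) (d ≫ M.unfold A) w
termination_by n A => (n, sizeOf A)

section

variable {n : ℕ} {A B : Ty 0} {v : Tm 0}

theorem relAt_sum {d : 𝟙_ M.L ⟶ M.Ob (.sum A B)} : M.RelAt n (.sum A B) d v ↔
    (∃ e w, d = inlElt B e ∧ v = .left A B w ∧ M.RelAt n A e w) ∨
      ∃ e w, d = inrElt A e ∧ v = .right A B w ∧ M.RelAt n B e w := by
  rw [RelAt]

theorem relAt_tensor {d : 𝟙_ M.L ⟶ M.Ob (.tensor A B)} : M.RelAt n (.tensor A B) d v ↔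
    ∃ e e' w w', d = tensorElt e e' ∧ v = .pair w w' ∧ M.RelAt n A e w ∧ M.RelAt n B e' w' := by
  rw [RelAt]

theorem relAt_lolli {d : 𝟙_ M.L ⟶ M.Ob (.lolli A B)} : M.RelAt n (.lolli A B) d v ↔
    d ≠ M.bot _ _ ∧ d ≫ M.approx n (.lolli A B) = d ∧ ∃ m, v = .lam A m ∧
      ∀ e w, M.RelAt n A e w → Bar (M.RelAt n B) (appElt d e) (m.inst w) := by
  rw [RelAt]

theorem relAt_bang {d : 𝟙_ M.L ⟶ M.Ob (.bang A)} : M.RelAt n (.bang A) d v ↔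
    ∃ e m, d = bangElt e ∧ v = .lift m ∧ Bar (M.RelAt n A) e m := by
  rw [RelAt]

theorem relAt_mu_zero {A : Ty 1} {d : 𝟙_ M.L ⟶ M.Ob A.mu} : ¬ M.RelAt 0 A.mu d v := by
  rw [RelAt]
  exact id

theorem relAt_mu_succ {A : Ty 1} {d : 𝟙_ M.L ⟶ M.Ob A.mu} : M.RelAt (n + 1) A.mu d v ↔
    ∃ w, v = .fold A w ∧ M.RelAt n (A.inst A.mu) (d ≫ M.unfold A) w := by
  rw [RelAt]

end

theorem Bar.map {X Y : M.L} {R : (𝟙_ M.L ⟶ X) → Tm 0 → Prop} {R' : (𝟙_ M.L ⟶ Y) → Tm 0 → Prop}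
    {f : (𝟙_ M.L ⟶ X) → (𝟙_ M.L ⟶ Y)} (hf : f (M.bot _ _) = M.bot _ _)
    (h : ∀ {d v}, R d v → f d = M.bot _ _ ∨ R' (f d) v) {d : 𝟙_ M.L ⟶ X} {m : Tm 0}
    (hd : Bar R d m) : Bar R' (f d) m := by
  rcases hd with rfl | ⟨v, hm, hv⟩
  · exact .inl hf
  · exact (h hv).imp id fun h => ⟨v, hm, h⟩

/-- If the supremum is not `⊥`, a tail of the sequence is not `⊥` either. By determinism all its
members are related to one value, and closure of `R` for that value applies. -/
theorem Bar.of_isSup {X : M.L} {R : (𝟙_ M.L ⟶ X) → Tm 0 → Prop}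
    (hR : ∀ {f a v}, IsSup f a → (∀ n, R (f n) v) → R a v) {f : ℕ → (𝟙_ M.L ⟶ X)}
    {a : 𝟙_ M.L ⟶ X} {m : Tm 0} (h : IsSup f a) (hf : ∀ n, Bar R (f n) m) : Bar R a m := by
  refine or_iff_not_imp_left.2 fun ha => ?_
  obtain ⟨k, hk⟩ := IsSup.exists_ne_bot h ha
  obtain ⟨v, hv, _⟩ := (hf k).resolve_left (hk k le_rfl)
  refine ⟨v, hv, hR (h.shift k) fun n => ?_⟩
  obtain ⟨w, hw, hr⟩ := (hf (n + k)).resolve_left (hk _ (Nat.le_add_left _ _))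
  rwa [hv.unique hw]

/-- Level `n` only sees elements that truncation at `n` leaves unchanged. At `⊸` this is imposed in
the definition; elsewhere it is inherited. -/
theorem RelAt.comp_approx {n : ℕ} {A : Ty 0} {d : 𝟙_ M.L ⟶ M.Ob A} {v : Tm 0}
    (hr : M.RelAt n A d v) : d ≫ M.approx n A = d := by
  induction n, A using Ty.closed_induction generalizing v with
  | sum n A B hA hB =>
    obtain ⟨e, w, rfl, rfl, h⟩ | ⟨e, w, rfl, rfl, h⟩ := relAt_sum.1 hr
    · rw [inlElt_approx, hA h]
    · rw [inrElt_approx, hB h]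
  | tensor n A B hA hB =>
    obtain ⟨e, e', w, w', rfl, rfl, h, h'⟩ := relAt_tensor.1 hr
    rw [tensorElt_approx, hA h, hB h']
  | lolli n A B hA hB => exact (relAt_lolli.1 hr).2.1
  | bang n A hA =>
    obtain ⟨e, m, rfl, rfl, rfl | ⟨v, -, h⟩⟩ := relAt_bang.1 hr
    · rw [bangElt_approx, bot_comp]
    · rw [bangElt_approx, hA h]
  | mu_zero A => exact (relAt_mu_zero hr).elim
  | mu_succ n A hA =>
    obtain ⟨w, rfl, h⟩ := relAt_mu_succ.1 hr
    rw [approx_mu_succ, ← Category.assoc, ← Category.assoc, hA h, Category.assoc, unfold_fold,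
      Category.comp_id]

theorem RelAt.isValue {n : ℕ} {A : Ty 0} {d : 𝟙_ M.L ⟶ M.Ob A} {v : Tm 0}
    (hr : M.RelAt n A d v) : v.IsValue := by
  induction n, A using Ty.closed_induction generalizing v with
  | sum n A B hA hB =>
    obtain ⟨e, w, rfl, rfl, h⟩ | ⟨e, w, rfl, rfl, h⟩ := relAt_sum.1 hr
    · exact (hA h).left
    · exact (hB h).right
  | tensor n A B hA hB =>
    obtain ⟨e, e', w, w', rfl, rfl, h, h'⟩ := relAt_tensor.1 hr
    exact (hA h).pair (hB h')
  | lolli n A B hA hB =>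
    obtain ⟨-, -, m, rfl, -⟩ := relAt_lolli.1 hr
    exact .lam _ _
  | bang n A hA =>
    obtain ⟨e, m, rfl, rfl, -⟩ := relAt_bang.1 hr
    exact .lift _
  | mu_zero A => exact (relAt_mu_zero hr).elim
  | mu_succ n A hA =>
    obtain ⟨w, rfl, h⟩ := relAt_mu_succ.1 hr
    exact (hA h).fold

theorem RelAt.ne_bot (hM : M.ComputationallyAdequate) {n : ℕ} {A : Ty 0} {d : 𝟙_ M.L ⟶ M.Ob A}
    {v : Tm 0} (hr : M.RelAt n A d v) : d ≠ M.bot _ _ := by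
  induction n, A using Ty.closed_induction generalizing v with
  | sum n A B hA hB =>
    obtain ⟨e, w, rfl, rfl, h⟩ | ⟨e, w, rfl, rfl, h⟩ := relAt_sum.1 hr
    · exact fun h' => hA h (inlElt_eq_bot.1 h')
    · exact fun h' => hB h (inrElt_eq_bot.1 h')
  | tensor n A B hA hB =>
    obtain ⟨e, e', w, w', rfl, rfl, h, h'⟩ := relAt_tensor.1 hr
    exact tensorElt_ne_bot hM (hA h) (hB h')
  | lolli n A B hA hB => exact (relAt_lolli.1 hr).1
  | bang n A hA =>
    obtain ⟨e, m, rfl, rfl, -⟩ := relAt_bang.1 hr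
    exact bangElt_ne_bot hM e
  | mu_zero A => exact (relAt_mu_zero hr).elim
  | mu_succ n A hA =>
    obtain ⟨w, rfl, h⟩ := relAt_mu_succ.1 hr
    rintro rfl
    exact hA h (bot_comp _)

theorem RelAt.isNice {n : ℕ} {P : Ty 0} (hP : P.NonLinear) {d : 𝟙_ M.L ⟶ M.Ob P} {v : Tm 0}
    (hr : M.RelAt n P d v) : IsNice (M.coalg P) d := by
  induction n, P using Ty.closed_induction generalizing v with
  | sum n A B hA hB =>
    obtain ⟨e, w, rfl, rfl, h⟩ | ⟨e, w, rfl, rfl, h⟩ := relAt_sum.1 hr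
    · exact isNice_inlElt (hA hP.1 h)
    · exact isNice_inrElt (hB hP.2 h)
  | tensor n A B hA hB =>
    obtain ⟨e, e', w, w', rfl, rfl, h, h'⟩ := relAt_tensor.1 hr
    exact isNice_tensorElt (hA hP.1 h) (hB hP.2 h')
  | lolli n A B hA hB => exact hP.elim
  | bang n A hA =>
    obtain ⟨e, m, rfl, rfl, -⟩ := relAt_bang.1 hr
    exact isNice_bangElt e
  | mu_zero A => exact (relAt_mu_zero hr).elim
  | mu_succ n A hA =>
    obtain ⟨w, rfl, h⟩ := relAt_mu_succ.1 hr
    have h1 := isNice_comp_fold (hA hP.inst h)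
    rwa [Category.assoc, unfold_fold, Category.comp_id] at h1

/-- Inclusion of a level in the next and truncation back are proved together, since at `⊸` each uses
the other on the argument type. The alternative `⊥` is needed because truncation may annihilate an
element, while related elements are not `⊥`. -/
theorem RelAt.succ_and_pred {n : ℕ} {A : Ty 0} :
    (∀ {d : 𝟙_ M.L ⟶ M.Ob A} {v : Tm 0}, M.RelAt n A d v → M.RelAt (n + 1) A d v) ∧
    (∀ {d : 𝟙_ M.L ⟶ M.Ob A} {v : Tm 0}, M.RelAt (n + 1) A d v →
      d ≫ M.approx n A = M.bot _ _ ∨ M.RelAt n A (d ≫ M.approx n A) v) := by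
  induction n, A using Ty.closed_induction with
  | sum n A B hA hB =>
    refine ⟨fun hr => ?_, fun hr => ?_⟩
    · exact relAt_sum.2 ((relAt_sum.1 hr).imp
        (fun ⟨e, w, hd, hv, h⟩ => ⟨e, w, hd, hv, hA.1 h⟩)
        fun ⟨e, w, hd, hv, h⟩ => ⟨e, w, hd, hv, hB.1 h⟩)
    · obtain ⟨e, w, rfl, rfl, h⟩ | ⟨e, w, rfl, rfl, h⟩ := relAt_sum.1 hr
      · rw [inlElt_approx]
        exact (hA.2 h).imp (fun h => by rw [h, inlElt_bot])
          fun h => relAt_sum.2 (.inl ⟨_, w, rfl, rfl, h⟩)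
      · rw [inrElt_approx]
        exact (hB.2 h).imp (fun h => by rw [h, inrElt_bot])
          fun h => relAt_sum.2 (.inr ⟨_, w, rfl, rfl, h⟩)
  | tensor n A B hA hB =>
    refine ⟨fun hr => ?_, fun hr => ?_⟩
    · obtain ⟨e, e', w, w', rfl, rfl, h, h'⟩ := relAt_tensor.1 hr
      exact relAt_tensor.2 ⟨e, e', w, w', rfl, rfl, hA.1 h, hB.1 h'⟩
    · obtain ⟨e, e', w, w', rfl, rfl, h, h'⟩ := relAt_tensor.1 hr
      rw [tensorElt_approx]
      rcases hA.2 h with h | h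
      · exact .inl (by rw [h, bot_tensorElt])
      rcases hB.2 h' with h' | h'
      · exact .inl (by rw [h', tensorElt_bot])
      exact .inr (relAt_tensor.2 ⟨_, _, w, w', rfl, rfl, h, h'⟩)
  | lolli n A B hA hB =>
    refine ⟨fun {d v} hr => ?_, fun {d v} hr => ?_⟩
    · obtain ⟨hd, hd', m, rfl, h⟩ := relAt_lolli.1 hr
      refine relAt_lolli.2 ⟨hd, ?_, m, rfl, fun e w he => ?_⟩
      · conv_lhs => rw [← hd', Category.assoc, approx_succ]
        exact hd'
      -- As `d` is already truncated at level `n`, it sees only the truncation of its argument, to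
      -- which the hypothesis at level `n` applies.
      · have h1 : appElt d e = appElt d (e ≫ M.approx n A) := by
          conv_lhs => rw [← hd', appElt_approx]
          conv_rhs => rw [← hd', appElt_approx, Category.assoc, approx_idem]
        rw [h1]
        rcases hA.2 he with he | he
        · exact .inl (by rw [he, appElt_bot])
        · exact (h _ _ he).map (f := id) rfl fun h => .inr (hB.1 h)
    · obtain ⟨hd, hd', m, rfl, h⟩ := relAt_lolli.1 hr
      refine or_iff_not_imp_left.2 fun hn => ?_
      refine relAt_lolli.2 ⟨hn, ?_, m, rfl, fun e w he => ?_⟩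
      · rw [Category.assoc, approx_idem]
      · rw [appElt_approx, he.comp_approx]
        exact (h _ _ (hA.1 he)).map (f := (· ≫ M.approx n B)) (bot_comp _) hB.2
  | bang n A hA =>
    refine ⟨fun {d v} hr => ?_, fun {d v} hr => ?_⟩
    · obtain ⟨e, m, rfl, rfl, h⟩ := relAt_bang.1 hr
      exact relAt_bang.2 ⟨e, m, rfl, rfl, h.map (f := id) rfl fun h => .inr (hA.1 h)⟩
    · obtain ⟨e, m, rfl, rfl, h⟩ := relAt_bang.1 hr
      rw [bangElt_approx]
      exact .inr (relAt_bang.2 ⟨_, m, rfl, rfl,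
        h.map (f := (· ≫ M.approx n A)) (bot_comp _) hA.2⟩)
  | mu_zero A =>
    refine ⟨fun hr => (relAt_mu_zero hr).elim, fun h => .inl ?_⟩
    rw [approx_mu_zero, comp_bot]
  | mu_succ n A hA =>
    refine ⟨fun {d v} hr => ?_, fun {d v} hr => ?_⟩
    · obtain ⟨w, rfl, h⟩ := relAt_mu_succ.1 hr
      exact relAt_mu_succ.2 ⟨w, rfl, hA.1 h⟩
    · obtain ⟨w, rfl, h⟩ := relAt_mu_succ.1 hr
      rcases hA.2 h with h | h
      · refine .inl ?_
        rw [approx_mu_succ, ← Category.assoc, ← Category.assoc, h, bot_comp]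
      · rw [← comp_approx_succ_unfold] at h
        exact .inr (relAt_mu_succ.2 ⟨w, rfl, h⟩)

theorem RelAt.mono {n k : ℕ} (hnk : n ≤ k) {A : Ty 0} {d : 𝟙_ M.L ⟶ M.Ob A} {v : Tm 0}
    (h : M.RelAt n A d v) : M.RelAt k A d v := by
  induction hnk with
  | refl => exact h
  | step _ ih => exact RelAt.succ_and_pred.1 ih

theorem RelAt.of_le {n k : ℕ} (hnk : n ≤ k) {A : Ty 0} {d : 𝟙_ M.L ⟶ M.Ob A} {v : Tm 0}
    (h : M.RelAt k A d v) : d ≫ M.approx n A = M.bot _ _ ∨ M.RelAt n A (d ≫ M.approx n A) v := by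
  induction hnk generalizing d with
  | refl => exact .inr (h.comp_approx.symm ▸ h)
  | @step k hk ih =>
    have e : (d ≫ M.approx k A) ≫ M.approx n A = d ≫ M.approx n A := by
      rw [Category.assoc, comp_approx_of_le hk]
    rcases RelAt.succ_and_pred.2 h with h | h
    · exact .inl (by rw [← e, h, bot_comp])
    · have := ih h
      rwa [e] at this

/-- Admissibility, for a fixed value. The value determines the shape of all members, so the
components form sequences of their own; these are increasing by left inverses at `+` and `!`, and by
order reflection at `⊗`. At `⊸` application is continuous. -/
theorem RelAt.of_isSup (hM : M.ComputationallyAdequate) {n : ℕ} {A : Ty 0}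
    {f : ℕ → (𝟙_ M.L ⟶ M.Ob A)} {a : 𝟙_ M.L ⟶ M.Ob A} {v : Tm 0} (hf : IsSup f a)
    (h : ∀ i, M.RelAt n A (f i) v) : M.RelAt n A a v := by
  induction n, A using Ty.closed_induction generalizing v with
  | sum n A B hA hB =>
    obtain ⟨e, w, -, rfl, -⟩ | ⟨e, w, -, rfl, -⟩ := relAt_sum.1 (h 0)
    · have h1 : ∀ i, ∃ e, f i = inlElt B e ∧ M.RelAt n A e w := by
        intro i
        obtain ⟨e', w', h1, h2, h3⟩ | ⟨e', w', h1, h2, h3⟩ := relAt_sum.1 (h i)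
        · cases h2
          exact ⟨_, h1, h3⟩
        · cases h2
      choose g hg hg' using h1
      obtain rfl : f = fun i => inlElt B (g i) := funext hg
      obtain ⟨b, rfl, hb⟩ := exists_inlElt hf
      exact relAt_sum.2 (.inl ⟨b, w, rfl, rfl, hA hb hg'⟩)
    · have h1 : ∀ i, ∃ e, f i = inrElt A e ∧ M.RelAt n B e w := by
        intro i
        obtain ⟨e', w', h1, h2, h3⟩ | ⟨e', w', h1, h2, h3⟩ := relAt_sum.1 (h i)
        · cases h2
        · cases h2
          exact ⟨_, h1, h3⟩
      choose g hg hg' using h1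
      obtain rfl : f = fun i => inrElt A (g i) := funext hg
      obtain ⟨b, rfl, hb⟩ := exists_inrElt hf
      exact relAt_sum.2 (.inr ⟨b, w, rfl, rfl, hB hb hg'⟩)
  | tensor n A B hA hB =>
    obtain ⟨-, -, w, w', -, rfl, -, -⟩ := relAt_tensor.1 (h 0)
    have h1 : ∀ i, ∃ e e', f i = tensorElt e e' ∧ M.RelAt n A e w ∧ M.RelAt n B e' w' := by
      intro i
      obtain ⟨e, e', u, u', h1, h2, h3, h4⟩ := relAt_tensor.1 (h i)
      cases h2
      exact ⟨_, _, h1, h3, h4⟩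
    choose g g' hg hr hr' using h1
    obtain rfl : f = fun i => tensorElt (g i) (g' i) := funext hg
    obtain ⟨b, b', rfl, hb, hb'⟩ := exists_tensorElt hM (fun i => (hr i).ne_bot hM)
      (fun i => (hr' i).ne_bot hM) hf
    exact relAt_tensor.2 ⟨b, b', w, w', rfl, rfl, hA hb hr, hB hb' hr'⟩
  | lolli n A B hA hB =>
    obtain ⟨hd, -, m, rfl, -⟩ := relAt_lolli.1 (h 0)
    refine relAt_lolli.2 ⟨IsSup.ne_bot hf 0 hd, ?_, m, rfl, fun e w he => ?_⟩
    · exact (hf.comp_right _).unique (hf.congr (fun i => (h i).comp_approx) rfl)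
    · refine Bar.of_isSup (R := M.RelAt n B) (fun hf h => hB hf h) (isSup_appElt hf (.const e)) fun i => ?_
      obtain ⟨-, -, m', hm, hi⟩ := relAt_lolli.1 (h i)
      cases hm
      exact hi e w he
  | bang n A hA =>
    obtain ⟨-, m, -, rfl, -⟩ := relAt_bang.1 (h 0)
    have h1 : ∀ i, ∃ e, f i = bangElt e ∧ Bar (M.RelAt n A) e m := by
      intro i
      obtain ⟨e, m', h1, h2, h3⟩ := relAt_bang.1 (h i)
      cases h2
      exact ⟨_, h1, h3⟩
    choose g hg hg' using h1
    obtain rfl : f = fun i => bangElt (g i) := funext hg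
    obtain ⟨b, rfl, hb⟩ := exists_bangElt hf
    exact relAt_bang.2 ⟨b, m, rfl, rfl, Bar.of_isSup (R := M.RelAt n A)
      (fun hf h => hA hf h) hb hg'⟩
  | mu_zero A => exact (relAt_mu_zero (h 0)).elim
  | mu_succ n A hA =>
    obtain ⟨w, rfl, -⟩ := relAt_mu_succ.1 (h 0)
    refine relAt_mu_succ.2 ⟨w, rfl, hA (hf.comp_right _) fun i => ?_⟩
    obtain ⟨w', h1, h2⟩ := relAt_mu_succ.1 (h i)
    cases h1
    exact h2

end CPOLNLModel
end LNLFPC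

/-! ### Formal approximation at all sufficiently high levels -/

namespace LNLFPC
open CategoryTheory CategoryTheory.Limits OmegaCompletePartialOrder MonoidalCategory

namespace CPOLNLModel

variable {M : CPOLNLModel.{v, u}}

/-- The formal approximation relation between elements and values. -/
def Rel (M : CPOLNLModel.{v, u}) (A : Ty 0) (d : 𝟙_ M.L ⟶ M.Ob A) (v : Tm 0) : Prop :=
  ∃ k, ∀ n, k ≤ n → M.RelAt n A (d ≫ M.approx n A) v

section

variable {A B : Ty 0} {v w m : Tm 0}

theorem Rel.isValue {d : 𝟙_ M.L ⟶ M.Ob A} (h : M.Rel A d v) : v.IsValue := by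
  obtain ⟨k, hk⟩ := h
  exact (hk k le_rfl).isValue

/-- The truncations beyond some level are promotable, and promotability passes to their supremum by
continuity of `!`. -/
theorem promotable_rel : Promotable M.Rel := by
  rintro P d v hP ⟨k, hk⟩
  exact IsCoalgHom.of_isSup ((isSup_comp_approx d).shift k) fun n =>
    (hk (n + k) (Nat.le_add_left _ _)).isNice hP

/-- An element fixed by `approx n A` is fixed by all later approximations, so the sequence of its
truncations is constant from level `n` on. -/
theorem RelAt.rel {n : ℕ} {d : 𝟙_ M.L ⟶ M.Ob A} (h : M.RelAt n A d v) : M.Rel A d v :=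
  ⟨n, fun k hk => by
    have h1 : d ≫ M.approx k A = d := by
      conv_lhs => rw [← h.comp_approx, Category.assoc, approx_comp_of_le hk, h.comp_approx]
    rw [h1]
    exact h.mono hk⟩

/-- Being related at high levels says something at every level, by truncating from a higher one. -/
theorem Rel.relAt {d : 𝟙_ M.L ⟶ M.Ob A} (h : M.Rel A d v) (n : ℕ) :
    d ≫ M.approx n A = M.bot _ _ ∨ M.RelAt n A (d ≫ M.approx n A) v := by
  obtain ⟨k, hk⟩ := h
  have h1 := (hk (max n k) (le_max_right _ _)).of_le (le_max_left n k)
  rwa [Category.assoc, comp_approx_of_le (le_max_left n k)] at h1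

theorem Bar.relAt {d : 𝟙_ M.L ⟶ M.Ob A} (h : Bar (M.Rel A) d m) (n : ℕ) :
    Bar (M.RelAt n A) (d ≫ M.approx n A) m :=
  h.map (f := (· ≫ M.approx n A)) (bot_comp _) fun h => h.relAt n

/-- The value obtained at one level where the truncation is not `⊥` serves for all later levels,
because evaluation is deterministic. -/
theorem Bar.of_relAt {d : 𝟙_ M.L ⟶ M.Ob A} {k : ℕ}
    (h : ∀ n, k ≤ n → Bar (M.RelAt n A) (d ≫ M.approx n A) m) : Bar (M.Rel A) d m := by
  refine or_iff_not_imp_left.2 fun hd => ?_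
  obtain ⟨j, hj⟩ := IsSup.exists_ne_bot (isSup_comp_approx d) hd
  obtain ⟨v, hv, -⟩ := (h (max j k) (le_max_right _ _)).resolve_left (hj _ (le_max_left _ _))
  refine ⟨v, hv, max j k, fun n hn => ?_⟩
  obtain ⟨w, hw, hr⟩ := (h n ((le_max_right _ _).trans hn)).resolve_left
    (hj n ((le_max_left _ _).trans hn))
  rwa [hv.unique hw]

theorem Rel.left {d : 𝟙_ M.L ⟶ M.Ob A} (B : Ty 0) (h : M.Rel A d v) :
    M.Rel (.sum A B) (inlElt B d) (.left A B v) := by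
  obtain ⟨k, hk⟩ := h
  refine ⟨k, fun n hn => ?_⟩
  rw [inlElt_approx]
  exact relAt_sum.2 (.inl ⟨_, _, rfl, rfl, hk n hn⟩)

theorem Rel.right {d : 𝟙_ M.L ⟶ M.Ob B} (A : Ty 0) (h : M.Rel B d v) :
    M.Rel (.sum A B) (inrElt A d) (.right A B v) := by
  obtain ⟨k, hk⟩ := h
  refine ⟨k, fun n hn => ?_⟩
  rw [inrElt_approx]
  exact relAt_sum.2 (.inr ⟨_, _, rfl, rfl, hk n hn⟩)

/-- The value decides the side for all truncations at once. A supremum of injections from one side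
is again such an injection, and the left inverse recovers the truncations of its component. -/
theorem Rel.sum_cases {d : 𝟙_ M.L ⟶ M.Ob (.sum A B)} (h : M.Rel (.sum A B) d v) :
    (∃ e w, d = inlElt B e ∧ v = .left A B w ∧ M.Rel A e w) ∨
      ∃ e w, d = inrElt A e ∧ v = .right A B w ∧ M.Rel B e w := by
  obtain ⟨k, hk⟩ := h
  have hs := (isSup_comp_approx d).shift k
  obtain ⟨-, w, -, rfl, -⟩ | ⟨-, w, -, rfl, -⟩ := relAt_sum.1 (hk k le_rfl)
  · have h1 : ∀ i, ∃ e, d ≫ M.approx (i + k) _ = inlElt B e := by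
      intro i
      obtain ⟨e, w', h1, -, -⟩ | ⟨e, w', -, h2, -⟩ := relAt_sum.1 (hk _ (Nat.le_add_left k i))
      · exact ⟨_, h1⟩
      · cases h2
    choose g hg using h1
    obtain ⟨e, rfl, -⟩ := exists_inlElt (hs.congr (fun i => (hg i).symm) rfl)
    refine .inl ⟨e, w, rfl, rfl, k, fun n hn => ?_⟩
    obtain ⟨e', w', h1, h2, h3⟩ | ⟨e', w', -, h2, -⟩ := relAt_sum.1 (hk n hn)
    · cases h2
      rw [inlElt_approx] at h1
      rwa [← fromInl_inlElt (B := B) e', ← h1, fromInl_inlElt] at h3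
    · cases h2
  · have h1 : ∀ i, ∃ e, d ≫ M.approx (i + k) _ = inrElt A e := by
      intro i
      obtain ⟨e, w', -, h2, -⟩ | ⟨e, w', h1, -, -⟩ := relAt_sum.1 (hk _ (Nat.le_add_left k i))
      · cases h2
      · exact ⟨_, h1⟩
    choose g hg using h1
    obtain ⟨e, rfl, -⟩ := exists_inrElt (hs.congr (fun i => (hg i).symm) rfl)
    refine .inr ⟨e, w, rfl, rfl, k, fun n hn => ?_⟩
    obtain ⟨e', w', -, h2, -⟩ | ⟨e', w', h1, h2, h3⟩ := relAt_sum.1 (hk n hn)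
    · cases h2
    · cases h2
      rw [inrElt_approx] at h1
      rwa [← fromInr_inrElt (A := A) e', ← h1, fromInr_inrElt] at h3

theorem Rel.pair {d : 𝟙_ M.L ⟶ M.Ob A} {e : 𝟙_ M.L ⟶ M.Ob B} (h : M.Rel A d v)
    (h' : M.Rel B e w) : M.Rel (.tensor A B) (tensorElt d e) (.pair v w) := by
  obtain ⟨k, hk⟩ := h
  obtain ⟨k', hk'⟩ := h'
  refine ⟨max k k', fun n hn => ?_⟩
  rw [tensorElt_approx]
  exact relAt_tensor.2 ⟨_, _, _, _, rfl, rfl, hk n ((le_max_left _ _).trans hn),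
    hk' n ((le_max_right _ _).trans hn)⟩

theorem Rel.tensor_cases (hM : M.ComputationallyAdequate) {d : 𝟙_ M.L ⟶ M.Ob (.tensor A B)}
    (h : M.Rel (.tensor A B) d v) :
    ∃ e e' w w', d = tensorElt e e' ∧ v = .pair w w' ∧ M.Rel A e w ∧ M.Rel B e' w' := by
  obtain ⟨k, hk⟩ := h
  have hs := (isSup_comp_approx d).shift k
  obtain ⟨-, -, w, w', -, rfl, -, -⟩ := relAt_tensor.1 (hk k le_rfl)
  have h1 : ∀ i, ∃ e e', d ≫ M.approx (i + k) _ = tensorElt e e' ∧ M.RelAt (i + k) A e w ∧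
      M.RelAt (i + k) B e' w' := by
    intro i
    obtain ⟨e, e', u, u', h1, h2, h3, h4⟩ := relAt_tensor.1 (hk _ (Nat.le_add_left k i))
    cases h2
    exact ⟨_, _, h1, h3, h4⟩
  choose g g' hg hr hr' using h1
  obtain ⟨e, e', rfl, he, he'⟩ := exists_tensorElt hM (fun i => (hr i).ne_bot hM)
    (fun i => (hr' i).ne_bot hM) (hs.congr (fun i => (hg i).symm) rfl)
  -- The components chosen level by level must be the truncations of the components of the supremum.
  -- Both pairs have the same non-`⊥` tensor, so injectivity identifies them.
  have h2 : ∀ i, e ≫ M.approx (i + k) A = g i ∧ e' ≫ M.approx (i + k) B = g' i := by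
    intro i
    have h3 := hg i
    have h4 := tensorElt_ne_bot hM ((hr i).ne_bot hM) ((hr' i).ne_bot hM)
    rw [← h3] at h4
    rw [tensorElt_approx] at h3 h4
    refine tensorElt_injective hM (fun h => h4 ?_) (fun h => h4 ?_) ((hr i).ne_bot hM)
      ((hr' i).ne_bot hM) h3
    · rw [h, bot_tensorElt]
    · rw [h, tensorElt_bot]
  refine ⟨e, e', w, w', rfl, rfl, ⟨k, fun n hn => ?_⟩, ⟨k, fun n hn => ?_⟩⟩
  · obtain ⟨i, rfl⟩ := Nat.exists_eq_add_of_le' hn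
    exact (h2 i).1.symm ▸ hr i
  · obtain ⟨i, rfl⟩ := Nat.exists_eq_add_of_le' hn
    exact (h2 i).2.symm ▸ hr' i

/-- An argument related at level `n` is fixed by truncation and lies in `Rel`, so the hypothesis
applies to it and only the result remains to be truncated. -/
theorem Rel.lam {d : 𝟙_ M.L ⟶ M.Ob (.lolli A B)} {p : Tm 1} (hd : d ≠ M.bot _ _)
    (h : ∀ e w, M.Rel A e w → Bar (M.Rel B) (appElt d e) (p.inst w)) :
    M.Rel (.lolli A B) d (.lam A p) := by
  obtain ⟨k, hk⟩ := IsSup.exists_ne_bot (isSup_comp_approx d) hd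
  refine ⟨k, fun n hn => relAt_lolli.2 ⟨hk n hn, ?_, p, rfl, fun e w he => ?_⟩⟩
  · rw [Category.assoc, approx_idem]
  · rw [appElt_approx, he.comp_approx]
    exact (h e w he.rel).relAt n

/-- The argument is related only through its truncations, so the application is approached through
them. For a fixed output level `n`, truncating function and argument at the same level `i + n` gives
a related result, which is cut down to level `n`; admissibility then passes to the supremum over
`i`. -/
theorem Rel.lolli_cases (hM : M.ComputationallyAdequate) {d : 𝟙_ M.L ⟶ M.Ob (.lolli A B)} (h : M.Rel (.lolli A B) d v) :
    ∃ p, v = .lam A p ∧ ∀ e w, M.Rel A e w → Bar (M.Rel B) (appElt d e) (p.inst w) := by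
  obtain ⟨k, hk⟩ := h
  obtain ⟨-, -, p, rfl, -⟩ := relAt_lolli.1 (hk k le_rfl)
  refine ⟨p, rfl, fun e w he => Bar.of_relAt (k := k) fun n hn => ?_⟩
  have hs := ((isSup_appElt (.const d) (isSup_comp_approx e)).comp_right (M.approx n B)).shift n
  refine Bar.of_isSup (R := M.RelAt n B) (fun hf h => RelAt.of_isSup hM hf h) hs fun i => ?_
  have hi : n ≤ i + n := Nat.le_add_left _ _
  obtain ⟨-, -, p', hp, hr⟩ := relAt_lolli.1 (hk _ (hn.trans hi))
  cases hp
  rcases he.relAt (i + n) with h0 | h0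
  · exact .inl (by rw [h0, appElt_bot, bot_comp])
  have h1 := hr _ _ h0
  rw [appElt_approx, Category.assoc, approx_idem] at h1
  have h2 := h1.map (R' := M.RelAt n B) (f := (· ≫ M.approx n B)) (bot_comp _)
    fun h => h.of_le hi
  simpa only [Category.assoc, comp_approx_of_le hi] using h2

theorem Rel.lift {d : 𝟙_ M.L ⟶ M.Ob A} (h : Bar (M.Rel A) d m) :
    M.Rel (.bang A) (bangElt d) (.lift m) := by
  refine ⟨0, fun n _ => ?_⟩
  rw [bangElt_approx]
  exact relAt_bang.2 ⟨_, _, rfl, rfl, h.relAt n⟩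

theorem Rel.bang_cases {d : 𝟙_ M.L ⟶ M.Ob (.bang A)} (h : M.Rel (.bang A) d v) :
    ∃ e m, d = bangElt e ∧ v = .lift m ∧ Bar (M.Rel A) e m := by
  obtain ⟨k, hk⟩ := h
  have hs := (isSup_comp_approx d).shift k
  obtain ⟨-, m, -, rfl, -⟩ := relAt_bang.1 (hk k le_rfl)
  have h1 : ∀ i, ∃ e, d ≫ M.approx (i + k) _ = bangElt e := by
    intro i
    obtain ⟨e, m', h1, -, -⟩ := relAt_bang.1 (hk _ (Nat.le_add_left k i))
    exact ⟨_, h1⟩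
  choose g hg using h1
  obtain ⟨e, rfl, -⟩ := exists_bangElt (hs.congr (fun i => (hg i).symm) rfl)
  refine ⟨e, m, rfl, rfl, Bar.of_relAt (k := k) fun n hn => ?_⟩
  obtain ⟨e', m', h1, h2, h3⟩ := relAt_bang.1 (hk n hn)
  cases h2
  rw [bangElt_approx] at h1
  rwa [← bangElt_counit e', ← h1, bangElt_counit] at h3

/-- The two sides differ by a shift of one level, which does not matter for a condition on all large
levels. This is the recursive equation that `Rel` is designed to satisfy. -/
theorem rel_fold_iff {A : Ty 1} {d : 𝟙_ M.L ⟶ M.Ob A.mu} :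
    M.Rel A.mu d (.fold A v) ↔ M.Rel (A.inst A.mu) (d ≫ M.unfold A) v := by
  refine ⟨fun ⟨k, hk⟩ => ⟨k, fun n hn => ?_⟩, fun ⟨k, hk⟩ => ⟨k + 1, fun n hn => ?_⟩⟩
  · obtain ⟨w, h1, h2⟩ := relAt_mu_succ.1 (hk (n + 1) (hn.trans n.le_succ))
    cases h1
    rwa [comp_approx_succ_unfold] at h2
  · obtain ⟨n, rfl⟩ := Nat.exists_eq_add_of_le' (Nat.one_le_of_lt hn)
    refine relAt_mu_succ.2 ⟨v, rfl, ?_⟩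
    rw [comp_approx_succ_unfold]
    exact hk n (Nat.le_of_succ_le_succ hn)

theorem Rel.exists_eq_fold {A : Ty 1} {d : 𝟙_ M.L ⟶ M.Ob A.mu} (h : M.Rel A.mu d v) :
    ∃ w, v = .fold A w := by
  obtain ⟨k, hk⟩ := h
  obtain ⟨w, h, -⟩ := relAt_mu_succ.1 (hk (k + 1) k.le_succ)
  exact ⟨w, h⟩

end

/-- The interpretation of a term formally approximates it. -/
theorem bar_rel (hM : M.ComputationallyAdequate) {n : ℕ} {Γ : Ctx n} {m : Tm n} {A : Ty 0}
    (D : Deriv Γ m A) {γ : Fin n → Tm 0} {d : 𝟙_ M.L ⟶ M.ctx Γ} (hγ : Env M.Rel Γ γ d) :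
    Bar (M.Rel A) (d ≫ M.den D) (m.subst γ) := by
  induction D with
  | var l =>
    have h := hγ.lookup promotable_rel l
    exact .inr ⟨_, h.isValue.eval_self, h⟩
  | left B D ih =>
    rw [comp_den_left]
    refine (ih hγ).imp (fun h => by rw [h, inlElt_bot]) ?_
    exact fun ⟨v, hv, h⟩ => ⟨_, hv.left, h.left B⟩
  | right A D ih =>
    rw [comp_den_right]
    refine (ih hγ).imp (fun h => by rw [h, inrElt_bot]) ?_
    exact fun ⟨v, hv, h⟩ => ⟨_, hv.right, h.right A⟩
  | case s D D₁ D₂ ih ih₁ ih₂ =>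
    obtain ⟨d₁, d₂, hγ₁, hγ₂, hs⟩ := hγ.split promotable_rel s
    rcases ih hγ₁ with h | ⟨v, hv, hr⟩
    · exact .inl (comp_den_case_bot s D D₁ D₂ hs h)
    obtain ⟨e, w, he, rfl, h⟩ | ⟨e, w, he, rfl, h⟩ := hr.sum_cases
    · rw [comp_den_case_left s D D₁ D₂ hs he]
      refine (ih₁ (hγ₂.snoc h)).imp id ?_
      rw [← Tm.subst_liftSub_inst]
      exact fun ⟨u, hu, h⟩ => ⟨u, hv.case_left hu, h⟩
    · rw [comp_den_case_right s D D₁ D₂ hs he]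
      refine (ih₂ (hγ₂.snoc h)).imp id ?_
      rw [← Tm.subst_liftSub_inst]
      exact fun ⟨u, hu, h⟩ => ⟨u, hv.case_right hu, h⟩
  | pair s D₁ D₂ ih₁ ih₂ =>
    obtain ⟨d₁, d₂, hγ₁, hγ₂, hs⟩ := hγ.split promotable_rel s
    rw [comp_den_pair s D₁ D₂ hs]
    rcases ih₁ hγ₁ with h₁ | ⟨v, hv, h₁⟩
    · exact .inl (by rw [h₁, bot_tensorElt])
    rcases ih₂ hγ₂ with h₂ | ⟨w, hw, h₂⟩
    · exact .inl (by rw [h₂, tensorElt_bot])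
    exact .inr ⟨_, hv.pair hw, h₁.pair h₂⟩
  | letp s D₁ D₂ ih₁ ih₂ =>
    obtain ⟨d₁, d₂, hγ₁, hγ₂, hs⟩ := hγ.split promotable_rel s
    rcases ih₁ hγ₁ with h | ⟨v, hv, h⟩
    · exact .inl (comp_den_letp_bot s D₁ D₂ hs h)
    obtain ⟨e, e', w, w', he, rfl, h, h'⟩ := h.tensor_cases hM
    rw [comp_den_letp s D₁ D₂ hs he]
    refine (ih₂ ((hγ₂.snoc h).snoc h')).imp id ?_
    rw [← Tm.subst_liftSub_inst₂]
    exact fun ⟨u, hu, h⟩ => ⟨u, hv.letp hu, h⟩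
  | lam D ih =>
    -- A `λ` is a value whatever it denotes, but it is related only when its interpretation is not
    -- `⊥`. The other case is the first alternative of `Bar`.
    refine or_iff_not_imp_left.2 fun hd => ⟨_, .lam _ _, Rel.lam hd fun e w he => ?_⟩
    rw [appElt_den_lam, Tm.subst_liftSub_inst]
    exact ih (hγ.snoc he)
  | app s D₁ D₂ ih₁ ih₂ =>
    obtain ⟨d₁, d₂, hγ₁, hγ₂, hs⟩ := hγ.split promotable_rel s
    rw [comp_den_app s D₁ D₂ hs]
    rcases ih₁ hγ₁ with h₁ | ⟨v, hv, h₁⟩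
    · exact .inl (by rw [h₁, bot_appElt])
    rcases ih₂ hγ₂ with h₂ | ⟨w, hw, h₂⟩
    · exact .inl (by rw [h₂, appElt_bot])
    obtain ⟨p, rfl, h⟩ := h₁.lolli_cases hM
    exact (h _ _ h₂).imp id fun ⟨u, hu, h⟩ => ⟨u, hv.app hw hu, h⟩
  | lift hΦ D ih =>
    -- The environment of a `lift` is promotable, so its interpretation is the promotion of that of
    -- the body. The result is related even if the body denotes `⊥`, as `lift` suspends evaluation.
    rw [comp_den_lift hΦ D (hγ.isNice promotable_rel hΦ)]
    exact .inr ⟨_, .lift _, .lift (ih hγ)⟩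
  | force D ih =>
    rcases ih hγ with h | ⟨v, hv, hr⟩
    · refine .inl ?_
      exact (Category.assoc _ _ _).symm.trans ((congrArg (· ≫ _) h).trans (bot_comp _))
    · obtain ⟨e, p, he, rfl, h⟩ := hr.bang_cases
      rw [comp_den_force D he]
      exact h.imp id fun ⟨u, hu, h⟩ => ⟨u, hv.force hu, h⟩
  | fold D ih =>
    rw [comp_den_fold]
    refine (ih hγ).imp (fun h => by rw [h, bot_comp]) fun ⟨v, hv, h⟩ => ⟨_, hv.fold, ?_⟩
    rwa [rel_fold_iff, Category.assoc, fold_unfold, Category.comp_id]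
  | unfold D ih =>
    rw [comp_den_unfold]
    refine (ih hγ).imp (fun h => by rw [h, bot_comp]) fun ⟨v, hv, h⟩ => ?_
    obtain ⟨w, rfl⟩ := h.exists_eq_fold
    exact ⟨w, hv.unfold, rel_fold_iff.1 h⟩

/-- A program whose interpretation is not `⊥` terminates. -/
theorem terminates_of_den_ne_bot (hM : M.ComputationallyAdequate) {A : Ty 0} {p : Tm 0}
    (D : Deriv Ctx.nil p A) (h : M.den D ≠ M.bot _ _) : p.Terminates := by
  -- The empty environment carries the element `id_I` and the identity substitution.
  have h1 := bar_rel hM D (.nil Tm.var)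
  rw [Tm.subst_var] at h1
  rcases h1 with h1 | ⟨v, hv, -⟩
  · exact (h ((Category.id_comp _).symm.trans h1)).elim
  · exact ⟨v, hv.isValue, hv⟩

end CPOLNLModel
end LNLFPC

/-! ### Termination and adequacy -/

theorem mainTheorem2 (M : LNLFPC.CPOLNLModel.{v, u}) (hM : M.ComputationallyAdequate) :
    (∀ (A : LNLFPC.Ty 0) (p : LNLFPC.Tm 0) (D : LNLFPC.Deriv LNLFPC.Ctx.nil p A),
      M.den D ≠ M.bot (M.ctx LNLFPC.Ctx.nil) (M.Ob A) → p.Terminates) ∧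
    (∀ (P : LNLFPC.Ty 0) (p : LNLFPC.Tm 0) (D : LNLFPC.Deriv LNLFPC.Ctx.nil p P), P.NonLinear →
      (p.Terminates ↔ M.den D ≠ M.bot (M.ctx LNLFPC.Ctx.nil) (M.Ob P))) := by
  refine ⟨fun A p D h => LNLFPC.CPOLNLModel.terminates_of_den_ne_bot hM D h, fun P p D hP =>
    ⟨fun h => ?_, fun h => LNLFPC.CPOLNLModel.terminates_of_den_ne_bot hM D h⟩⟩
  obtain ⟨v, -, hv⟩ := h
  exact LNLFPC.CPOLNLModel.den_ne_bot_of_eval hM hP D hv
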